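/- Theorem. Let $d\ge 1$ and let $p(i,j)$ be a translation invariant, symmetric, irreducible, finite range Markov transition function on $\mathbb Z^d$. Write $\Gamma_{ij}=\sum_{z}p(0,z)z_iz_j$ and let $g_t(v)=\big((2\pi t)^{d}\det\Gamma\big)^{-1/2}e^{-\langle v,\Gamma^{-1}v\rangle/(2t)}$ be the Gaussian density with covariance $t\Gamma$. Let $p_t(x,y)$ be the transition probability of the continuous-time random walk $(X_t)$ on $\mathbb Z^d$ that jumps at rate $1$ according to $p$, and let $p_t(\xi,\xi')$ be the transition probability between finite configurations $\xi,\xi'\in\mathbb N^{\mathbb Z^d}$ of the system IRW of independent particles, each performing such a walk. Let $\rho:\mathbb R^d\to[0,\infty)$ be bounded and continuous. For $N\ge1$ let $\{\eta(t)\}_{t\ge0}$ be IRW started from the product $\nu_{\rho}^N=\bigotimes_{x\in\mathbb Z^d}\mathrm{Poisson}(\rho(x/N))$, and put $\rho_t(x)=\mathbb E_x[\rho(X_t/N)]$. For $r:\mathbb Z^d\to[0,\infty)$ let $$\mathscr D_r(\xi,\eta)=\prod_{x}\sum_{j=0}^{\xi_x}\binom{\xi_x}{j}(-r(x))^{\xi_x-j}\frac{\eta_x!}{(\eta_x-j)!}$$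 be the Charlier polynomials (with $\eta_x!/(\eta_x-j)!:=0$ for $j>\eta_x$), and let $a_0(\xi)=\|\mathscr D_{\rho_0}(\xi,\cdot)\|^2_{L^2(\nu^N_{\rho})}$. Fix $\mathbf x=(x_1,\dots,x_k)\in(\mathbb Z^d)^k$, a Schwartz function $\phi\in\mathcal S(\mathbb R^d)$, and define the $k$-th order field $$X_N(\mathbf x,\rho,\phi,t)=\sum_{z\in\mathbb Z^d}\phi(\tfrac zN)\,\mathscr D_{\rho_{N^2t}}\Big(\sum_{i=1}^k\delta_{z+x_i},\,\eta(N^2t)\Big).$$ For every $t\ge0$ this series is almost surely absolutely convergent and its sum is square integrable. Moreover: 1. For all $N\ge 1$ and $t>0$, $$\mathbb E\big[X_N(\mathbf x,\rho,\phi,t)X_N(\mathbf x,\rho,\phi,0)\big]=\sum_{x,y\in\mathbb Z^d}\phi(\tfrac xN)\phi(\tfrac yN)\,a_0\Big(\sum_{i=1}^k\delta_{y+x_i}\Big)\,p_{N^2t}\Big(\sum_{i=1}^k\delta_{x+x_i},\sum_{i=1}^k\delta_{y+x_i}\Big),$$ the double series converging absolutely. 2. For all $t>s>0$, $$\lim_{N\to\infty}N^{d(k-2)}\,\mathbb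 E\big[X_N(\mathbf x,\rho,\phi,t)X_N(\mathbf x,\rho,\phi,s)\big]=\int_{\mathbb R^{2d}}\mathscr K\big(\mathbf x;\bar\rho_s(y)\big)\,g_{t-s}(x-y)^k\,\phi(x)\phi(y)\,dx\,dy ,$$ where $\bar\rho_s(y)=\int_{\mathbb R^d} g_s(y-u)\rho(u)\,du$ is the evolved macroscopic density and, for a constant $c\ge 0$, $\mathscr K(\mathbf x;c)=|\mathcal P_k(\mathbf x)|\;\big\|\mathscr D_c\big(\sum_{i}\delta_{x_i},\cdot\big)\big\|^2_{L^2(\nu_c)}$; here $\nu_c$ is the homogeneous Poisson product measure of density $c$ and $|\mathcal P_k(\mathbf x)|$ is the number of distinct rearrangements of $(x_1,\dots,x_k)$. The integral converges absolutely. In particular, if $\rho$ is constant, $a_0$ and $\mathscr K$ are constants that can be taken out of the sum and of the integral, and for the nearest neighbour walk ($p(0,\pm e_i)=\frac1{2d}$, $\Gamma=I/d$) the kernel is $g_{t}(v)^k=\big(\tfrac{d}{2\pi t}\big)^{dk/2}e^{-kd|v|^2/(2t)}$. -/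

import Mathlib

open MeasureTheory ProbabilityTheory Filter Topology
open scoped NNReal ENNReal SchwartzMap

namespace IRW

/-- Sites of the lattice `ℤ^d`. -/
abbrev Site (d : ℕ) := Fin d → ℤ

/-- Particle configurations: `η x` is the number of particles at the site `x`. -/
abbrev Config (d : ℕ) := Site d → ℕ

/-- Macroscopic space `ℝ^d` with its Euclidean structure. -/
abbrev Space (d : ℕ) := EuclideanSpace ℝ (Fin d)

/-- The macroscopic point `z / N` of a lattice site `z`. -/
noncomputable def scaledSite {d : ℕ} (N : ℕ) (z : Site d) : Space d :=
  WithLp.toLp 2 (fun i => (z i : ℝ) / (N : ℝ))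

/-! ### The single random walk -/

/-- Standing assumptions on the jump probabilities `p(i, j)`: a Markov transition function (each
`p i` is a probability mass function) that is symmetric, translation invariant, of finite range
and irreducible. -/
structure IsJumpKernel {d : ℕ} (p : Site d → PMF (Site d)) : Prop where
  symm : ∀ i j, p i j = p j i
  transl : ∀ i j, p i j = p 0 (j - i)
  finite_range : ∃ R : ℝ, 0 < R ∧ ∀ i j, R < ‖i - j‖ → p i j = 0
  irreducible : ∀ x y, Relation.ReflTransGen (fun i j => 0 < p i j) x y

/-- Law after `n` jumps of the discrete-time walk with jump probabilities `p`. -/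
noncomputable def stepLaw {d : ℕ} (p : Site d → PMF (Site d)) : ℕ → Site d → PMF (Site d)
  | 0, x => PMF.pure x
  | n + 1, x => (stepLaw p n x).bind p

/-- Law at time `t` of the continuous-time random walk started at `x`, which jumps at rate `1`
with jump probabilities `p`: the number of jumps is Poisson with parameter `t`. Thus
`walkLaw p t x y` is the transition probability `p_t(x, y)`. -/
noncomputable def walkLaw {d : ℕ} (p : Site d → PMF (Site d)) (t : ℝ≥0) (x : Site d) :
    PMF (Site d) :=
  (poissonMeasure t).toPMF.bind fun n => stepLaw p n x

/-- The evolved profile `r_t(x) = 𝔼_x[r(X_t)]` of a bounded profile `r` on the lattice. -/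
noncomputable def evolve {d : ℕ} (p : Site d → PMF (Site d)) (t : ℝ≥0) (r : Site d → ℝ≥0)
    (x : Site d) : ℝ≥0 :=
  ∑' y, (walkLaw p t x y).toNNReal * r y

/-- Covariance matrix `Γ` of a single jump, `Γ i j = ∑ z, p(0, z) z_i z_j`. -/
noncomputable def jumpCov {d : ℕ} (p : Site d → PMF (Site d)) : Matrix (Fin d) (Fin d) ℝ :=
  Matrix.of fun i j => ∑' z : Site d, (p 0 z).toReal * ((z i : ℝ) * (z j : ℝ))

/-- Gaussian density on `ℝ^d` with mean zero and covariance matrix `t Γ`. -/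
noncomputable def gaussKernel {d : ℕ} (Γ : Matrix (Fin d) (Fin d) ℝ) (t : ℝ) (v : Space d) : ℝ :=
  (Real.sqrt ((2 * Real.pi * t) ^ d * Γ.det))⁻¹ *
    Real.exp (-((v : Fin d → ℝ) ⬝ᵥ (Γ⁻¹.mulVec (v : Fin d → ℝ))) / (2 * t))

/-! ### The system of independent random walkers -/

/-- The configuration reached from `η` when the particles are labelled `(x, i)` with `i < η x` and
the particle `(x, i)` moves to the site `w (x, i)`. -/
noncomputable def relocate {d : ℕ} (η : Config d) (w : Site d × ℕ → Site d) : Config d :=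
  fun y => Set.ncard {l : Site d × ℕ | l.2 < η l.1 ∧ w l = y}

theorem measurable_relocate {d : ℕ} :
    Measurable (fun q : Config d × (Site d × ℕ → Site d) => relocate q.1 q.2) := by
  refine measurable_pi_lambda _ fun y => ?_
  have key : ∀ q : Config d × (Site d × ℕ → Site d), relocate q.1 q.2 y
      = ⌊(∑' l : Site d × ℕ,
          Set.indicator {l : Site d × ℕ | l.2 < q.1 l.1 ∧ q.2 l = y}
            (fun _ => (1 : ℝ≥0∞)) l).toReal⌋₊ := by
    intro q
    rw [← tsum_subtype, ENNReal.tsum_set_one]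
    unfold relocate Set.ncard
    generalize Set.encard _ = e
    cases e with
    | top => simp
    | coe n => simp
  simp_rw [key]
  refine Nat.measurable_floor.comp (ENNReal.measurable_toReal.comp ?_)
  refine Measurable.tsum fun l => ?_
  have hs : MeasurableSet {q : Config d × (Site d × ℕ → Site d) | l.2 < q.1 l.1 ∧ q.2 l = y} := by
    have h1 : Measurable fun q : Config d × (Site d × ℕ → Site d) => q.1 l.1 :=
      (measurable_pi_apply _).comp measurable_fst
    have h2 : Measurable fun q : Config d × (Site d × ℕ → Site d) => q.2 l :=
      (measurable_pi_apply _).comp measurable_snd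
    exact (measurableSet_lt measurable_const h1).inter (h2 (measurableSet_singleton y))
  exact (measurable_const (a := (1 : ℝ≥0∞))).indicator hs

/-- Joint law of the positions at time `t` of independent walkers, the walker `(x, i)` starting
at `x`. -/
noncomputable def destLaw {d : ℕ} (p : Site d → PMF (Site d)) (t : ℝ≥0) :
    Measure (Site d × ℕ → Site d) :=
  Measure.infinitePi fun l => (walkLaw p t l.1).toMeasure

instance {d : ℕ} (p : Site d → PMF (Site d)) (t : ℝ≥0) : IsProbabilityMeasure (destLaw p t) := by
  unfold destLaw; infer_instance

/-- Transition kernel of independent random walkers: `irwKernel p t η` is the law at time `t` of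
the configuration started from `η`, all particles moving as independent continuous-time walks. -/
noncomputable def irwKernel {d : ℕ} (p : Site d → PMF (Site d)) (t : ℝ≥0) :
    Kernel (Config d) (Config d) where
  toFun η := (destLaw p t).map (relocate η)
  measurable' := by
    refine Measure.measurable_of_measurable_coe _ fun s hs => ?_
    have h : ∀ η : Config d, (destLaw p t).map (relocate η) s
        = destLaw p t (Prod.mk η ⁻¹' ((fun q => relocate q.1 q.2) ⁻¹' s)) := fun η =>
      Measure.map_apply (measurable_relocate.comp measurable_prodMk_left) hs
    simp_rw [h]
    exact measurable_measure_prodMk_left (measurable_relocate hs)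

instance {d : ℕ} (p : Site d → PMF (Site d)) (t : ℝ≥0) : IsMarkovKernel (irwKernel p t) where
  isProbabilityMeasure η := by
    change IsProbabilityMeasure ((destLaw p t).map (relocate η))
    exact Measure.isProbabilityMeasure_map
      (measurable_relocate.comp measurable_prodMk_left).aemeasurable

/-- `η` is a system of independent random walkers with initial law `ν`: the Markov process (with
respect to its own past) with transition kernels `irwKernel p` started from `ν`. -/
structure IsIRW {d : ℕ} (p : Site d → PMF (Site d)) (ν : Measure (Config d))
    {Ω : Type*} [MeasurableSpace Ω] (P : Measure Ω) (η : ℝ≥0 → Ω → Config d) : Prop where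
  measurable : ∀ t, Measurable (η t)
  initial : P.map (η 0) = ν
  markov : ∀ s t : ℝ≥0, s ≤ t →
    P.map (fun ω => ((fun u : Set.Iic s => η u ω), η t ω)) =
      (P.map fun ω => fun u : Set.Iic s => η u ω) ⊗ₘ
        ((irwKernel p (t - s)).comap (fun w : Set.Iic s → Config d => w ⟨s, Set.self_mem_Iic⟩)
          (measurable_pi_apply (⟨s, Set.self_mem_Iic⟩ : Set.Iic s)))

/-- Transition probability `p_t(ξ, ξ')` between finite configurations. -/
noncomputable def transProb {d : ℕ} (p : Site d → PMF (Site d)) (t : ℝ≥0)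
    (ξ ξ' : Site d →₀ ℕ) : ℝ :=
  (irwKernel p t ⇑ξ).real {⇑ξ'}

/-! ### Poisson measures and Charlier polynomials -/

/-- The product `ν_r` of Poisson measures with parameters `r x`. -/
noncomputable def poissonField {d : ℕ} (r : Site d → ℝ≥0) : Measure (Config d) :=
  Measure.infinitePi fun x => poissonMeasure (r x)

/-- Monic Charlier polynomial of degree `k`, orthogonal for the Poisson law with parameter `c`. -/
noncomputable def charlier (c : ℝ≥0) (k n : ℕ) : ℝ :=
  ∑ j ∈ Finset.range (k + 1), (k.choose j : ℝ) * (-(c : ℝ)) ^ (k - j) * (n.descFactorial j : ℝ)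

/-- The polynomial `𝒟_r(ξ, η) = ∏_x 𝒟_{r x}(ξ_x, η_x)`; the factors with `ξ_x = 0` are `1`. -/
noncomputable def charlierProd {d : ℕ} (r : Site d → ℝ≥0) (ξ : Site d →₀ ℕ) (η : Config d) : ℝ :=
  ∏ x ∈ ξ.support, charlier (r x) (ξ x) (η x)

/-- `‖𝒟_r(ξ, ·)‖²` in `L²(ν_r)`. -/
noncomputable def normSq {d : ℕ} (r : Site d → ℝ≥0) (ξ : Site d →₀ ℕ) : ℝ :=
  ∫ η, charlierProd r ξ η ^ 2 ∂(poissonField r)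

/-! ### Coordinates and fields -/

/-- The configuration `∑ i, δ_{x_i}`. -/
noncomputable def configOf {d k : ℕ} (x : Fin k → Site d) : Site d →₀ ℕ :=
  ∑ i, Finsupp.single (x i) 1

/-- The configuration `∑ i, δ_{z + x_i}`. -/
noncomputable def shiftedConfig {d k : ℕ} (x : Fin k → Site d) (z : Site d) : Site d →₀ ℕ :=
  configOf fun i => z + x i

/-- The number of classes of permutations of the `k` labels, where `σ` and `σ'` are equivalent
when `x_{σ i} = x_{σ' i}` for all `i`. -/
noncomputable def permCount {d k : ℕ} (x : Fin k → Site d) : ℕ :=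
  Nat.card (Quotient (Setoid.ker fun σ : Equiv.Perm (Fin k) => fun i => x (σ i)))

/-- The slowly varying lattice profile `z ↦ ρ (z / N)`. -/
noncomputable def latticeProfile {d : ℕ} (ρ : Space d → ℝ≥0) (N : ℕ) (z : Site d) : ℝ≥0 :=
  ρ (scaledSite N z)

/-- The summand at `z` of the `k`-th order field at macroscopic time `t`, as a function of the
configuration `η = η(N² t)`. -/
noncomputable def fieldTerm {d k : ℕ} (p : Site d → PMF (Site d)) (ρ : Space d → ℝ≥0)
    (φ : 𝓢(Space d, ℝ)) (x : Fin k → Site d) (N : ℕ) (t : ℝ≥0) (η : Config d) (z : Site d) : ℝ :=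
  φ (scaledSite N z) *
    charlierProd (evolve p ((N : ℝ≥0) ^ 2 * t) (latticeProfile ρ N)) (shiftedConfig x z) η

/-- The field `X_N(x, ρ, φ, t) = ∑_z φ(z/N) 𝒟_{ρ_{N² t}}(∑ i, δ_{z + x_i}, η(N² t))` of the
process `η` in microscopic time. -/
noncomputable def field {d k : ℕ} (p : Site d → PMF (Site d)) (ρ : Space d → ℝ≥0)
    (φ : 𝓢(Space d, ℝ)) (x : Fin k → Site d) (N : ℕ) {Ω : Type*} (η : ℝ≥0 → Ω → Config d)
    (t : ℝ≥0) (ω : Ω) : ℝ :=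
  ∑' z, fieldTerm p ρ φ x N t (η ((N : ℝ≥0) ^ 2 * t) ω) z

/-- The macroscopic density at time `s`: `ρ` evolved by the heat semigroup with covariance `Γ`. -/
noncomputable def macroDensity {d : ℕ} (p : Site d → PMF (Site d)) (ρ : Space d → ℝ≥0)
    (s : ℝ) (y : Space d) : ℝ≥0 :=
  Real.toNNReal (∫ u, gaussKernel (jumpCov p) s (y - u) * (ρ u : ℝ))

/-- `𝒦(x_1, …, x_k; c)`: number of distinct rearrangements of `x` times the squared norm of
`𝒟_c(∑ i, δ_{x_i}, ·)` for the homogeneous Poisson measure with density `c`. -/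
noncomputable def fieldConst {d k : ℕ} (x : Fin k → Site d) (c : ℝ≥0) : ℝ :=
  (permCount x : ℝ) * normSq (fun _ => c) (configOf x)

end IRW

namespace IRW

/-! ### Resampling a coordinate of a product measure -/

/-! The algebraic core is a permanent formula. If `(η_s, η_t)` is the process at two times, `r` is
the density at time `s` and `q = p_{t-s}`, then the Charlier polynomials of two labelled
`k`-particle configurations `a` and `b` satisfy E[D(a, η_s) D(b, η_t)] = ∏ r(a_i) · ∑_σ ∏ q(a_i,
b_{σ i}). It rests on a two-time Mecke formula (`IsMeckePair`): weighting by the number of particles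
at `x` at time `s` amounts to multiplying by `r x` and adding one particle, at `x` at time `s` and
at an independent `q(x, ·)`-distributed site at time `t`. The recurrence `D_{k+1}(n) = n D_k(n-1) -
c D_k(n)` brings the first polynomial into Mecke form, and the difference rule `D_k(n+1) - D_k(n) =
k D_{k-1}(n)` acts on the second. The undifferentiated terms cancel, and what is left is the
expansion of a permanent along its first row (`IsMeckePair.integral_charlierProd_mul`).

The Mecke formula also characterises Poisson fields, so the law at each time is Poisson with the
evolved density.

Without displacement the permanent counts the permutations fixing the labels, which gives the norm
of a Charlier polynomial. The transition probability times the same stabiliser count is the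
permanent of `p_t`. Hence norm times transition probability is exactly the covariance
(`normSq_mul_transProb`), and by orbit–stabiliser the constant `fieldConst x c` equals `k! c^k`.
Schwartz decay and uniform second moments make the fields converge in L² and allow the expectation
to be taken term by term.

For the scaling limit, the lattice double sum is an integral of step functions over cells of side
`1/N`. Each of the `k` transition probabilities absorbs a factor `N^d`, and a pair of cells has
volume `N^{-2d}`. The local limit theorem, proved by Fourier inversion, gives pointwise convergence
of the kernels; Scheffé's argument gives convergence of the densities. The offsets `x_i` disappear
macroscopically, so all `k!` permutations have the same limit. Dominated convergence concludes, with
a Gaussian bound on the characteristic function, supplied by irreducibility, providing the uniform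
heat kernel bound. -/

theorem measurable_update_prod {ι : Type*} [DecidableEq ι] {X : ι → Type*}
    [∀ i, MeasurableSpace (X i)] (i : ι) :
    Measurable (fun q : (∀ j, X j) × X i => Function.update q.1 i q.2) := by
  refine measurable_pi_lambda _ fun j => ?_
  by_cases h : j = i
  · subst h; simpa using measurable_snd
  · simp only [Function.update_of_ne h]
    exact (measurable_pi_apply j).comp measurable_fst

/-- It suffices to compare boxes: a box that constrains coordinate `i` has that constraint carried
by the fresh copy, and any other box ignores the update. One-site identities thereby pass to
infinite products. -/
theorem infinitePi_eq_map_update {ι : Type*} [DecidableEq ι] {X : ι → Type*}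
    [∀ i, MeasurableSpace (X i)] (μ : ∀ i, Measure (X i)) [∀ i, IsProbabilityMeasure (μ i)]
    (i : ι) :
    ((Measure.infinitePi μ).prod (μ i)).map (fun q => Function.update q.1 i q.2)
      = Measure.infinitePi μ := by
  have hm := measurable_update_prod (X := X) i
  refine Measure.eq_infinitePi μ fun s t ht => ?_
  rw [Measure.map_apply hm (MeasurableSet.pi s.countable_toSet fun j _ => ht j)]
  by_cases hi : i ∈ s
  · have : (fun q : (∀ j, X j) × X i => Function.update q.1 i q.2) ⁻¹' Set.pi s t
        = (Set.pi (s.erase i : Finset ι) t) ×ˢ t i := by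
      ext q
      simp only [Set.mem_preimage, Set.mem_pi, Set.mem_prod, Finset.mem_coe, Finset.mem_erase]
      constructor
      · intro h
        exact ⟨fun j hj => by simpa [Function.update_of_ne hj.1] using h j hj.2,
          by simpa using h i hi⟩
      · rintro ⟨h1, h2⟩ j hj
        by_cases hji : j = i
        · subst hji; simpa using h2
        · simpa [Function.update_of_ne hji] using h1 j ⟨hji, hj⟩
    rw [this, Measure.prod_prod, Measure.infinitePi_pi _ (fun j _ => ht j),
      Finset.prod_erase_mul _ _ hi]
  · have : (fun q : (∀ j, X j) × X i => Function.update q.1 i q.2) ⁻¹' Set.pi s t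
        = (Set.pi s t) ×ˢ Set.univ := by
      ext q
      simp only [Set.mem_preimage, Set.mem_pi, Set.mem_prod, Finset.mem_coe, Set.mem_univ,
        and_true]
      refine forall₂_congr fun j hj => ?_
      rw [Function.update_of_ne (by rintro rfl; exact hi hj)]
    rw [this, Measure.prod_prod, Measure.infinitePi_pi _ (fun j _ => ht j), measure_univ, mul_one]

theorem lintegral_infinitePi_update {ι : Type*} [DecidableEq ι] {X : ι → Type*}
    [∀ i, MeasurableSpace (X i)] (μ : ∀ i, Measure (X i)) [∀ i, IsProbabilityMeasure (μ i)]
    (i : ι) {f : (∀ j, X j) → ℝ≥0∞} (hf : Measurable f) :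
    ∫⁻ w, f w ∂(Measure.infinitePi μ)
      = ∫⁻ w, ∫⁻ y, f (Function.update w i y) ∂(μ i) ∂(Measure.infinitePi μ) := by
  conv_lhs => rw [← infinitePi_eq_map_update μ i]
  rw [lintegral_map hf (measurable_update_prod i), lintegral_prod]
  exact (hf.comp (measurable_update_prod i)).aemeasurable

/-! ### The Mecke formula for Poisson measures -/

/-- This relation between consecutive weights is the Mecke formula on atoms; read as a recursion, it
also determines the Poisson law up to total mass. -/
theorem poissonMeasure_singleton_succ (c : ℝ≥0) (n : ℕ) :
    ((n + 1 : ℕ) : ℝ≥0∞) * poissonMeasure c {n + 1} = c * poissonMeasure c {n} := by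
  rw [poissonMeasure_singleton, poissonMeasure_singleton, ← ENNReal.ofReal_natCast,
    ← ENNReal.ofReal_coe_nnreal, ← ENNReal.ofReal_mul (by positivity),
    ← ENNReal.ofReal_mul (by positivity)]
  congr 1
  rw [Nat.factorial_succ, pow_succ]
  push_cast
  have : (n.factorial : ℝ) ≠ 0 := by positivity
  field_simp

theorem mecke_poissonMeasure (c : ℝ≥0) (f : ℕ → ℝ≥0∞) :
    ∫⁻ n, (n : ℝ≥0∞) * f n ∂(poissonMeasure c) = c * ∫⁻ n, f (n + 1) ∂(poissonMeasure c) := by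
  rw [lintegral_countable', lintegral_countable', tsum_eq_zero_add' ENNReal.summable,
    ← ENNReal.tsum_mul_left]
  simp only [Nat.cast_zero, zero_mul, zero_add]
  refine tsum_congr fun n => ?_
  rw [mul_right_comm, poissonMeasure_singleton_succ]
  ring

theorem eq_smul_poissonMeasure (c : ℝ≥0) (m : Measure ℕ) [IsFiniteMeasure m]
    (h : ∀ n : ℕ, ((n + 1 : ℕ) : ℝ≥0∞) * m {n + 1} = c * m {n}) :
    m = m Set.univ • poissonMeasure c := by
  have key : ∀ n, m {n} = (m {0} * ENNReal.ofReal (Real.exp c)) * poissonMeasure c {n} := by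
    intro n
    induction n with
    | zero =>
      rw [poissonMeasure_singleton, mul_assoc, ← ENNReal.ofReal_mul (by positivity)]
      simp [← Real.exp_add]
    | succ n ih =>
      have h1 := h n
      have h2 := poissonMeasure_singleton_succ c n
      rw [ih, mul_left_comm, ← h2, mul_left_comm] at h1
      exact (ENNReal.mul_right_inj (by positivity) (by simp)).1 h1
  have e : m = (m {0} * ENNReal.ofReal (Real.exp c)) • poissonMeasure c := by
    refine Measure.ext_of_singleton fun n => ?_
    rw [key n]; simp
  have e2 : m Set.univ = m {0} * ENNReal.ofReal (Real.exp c) := by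
    conv_lhs => rw [e]
    simp
  rw [e2]; exact e

/-- The configuration with one more particle at `x`. -/
def addAt {d : ℕ} (η : Config d) (x : Site d) : Config d := Function.update η x (η x + 1)

theorem addAt_same {d : ℕ} (η : Config d) (x : Site d) : addAt η x x = η x + 1 := by
  simp [addAt]

theorem addAt_of_ne {d : ℕ} (η : Config d) {x y : Site d} (h : y ≠ x) : addAt η x y = η y := by
  simp [addAt, h]

theorem addAt_apply {d : ℕ} (η : Config d) (x y : Site d) :
    addAt η x y = η y + if y = x then 1 else 0 := by
  by_cases h : y = x
  · subst h; simp [addAt]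
  · simp [addAt, h]

theorem measurable_addAt {d : ℕ} : Measurable (fun q : Config d × Site d => addAt q.1 q.2) := by
  refine measurable_pi_lambda _ fun y => ?_
  simp_rw [addAt_apply]
  refine ((measurable_pi_apply y).comp measurable_fst).add ?_
  exact (measurable_of_countable (fun x : Site d => if y = x then 1 else 0)).comp measurable_snd

theorem measurable_addAt_left {d : ℕ} (x : Site d) :
    Measurable (fun η : Config d => addAt η x) :=
  measurable_addAt.comp (measurable_id.prodMk measurable_const)

instance {d : ℕ} (r : Site d → ℝ≥0) : IsProbabilityMeasure (poissonField r) := by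
  unfold poissonField; infer_instance

/-- The Mecke formula for a Poisson field. -/
theorem mecke_poissonField {d : ℕ} (r : Site d → ℝ≥0) (x : Site d) {G : Config d → ℝ≥0∞}
    (hG : Measurable G) :
    ∫⁻ η, (η x : ℝ≥0∞) * G η ∂(poissonField r)
      = r x * ∫⁻ η, G (addAt η x) ∂(poissonField r) := by
  have hcast : Measurable fun η : Config d => (η x : ℝ≥0∞) :=
    (measurable_of_countable (fun n : ℕ => (n : ℝ≥0∞))).comp (measurable_pi_apply x)
  unfold poissonField
  refine (lintegral_infinitePi_update _ x (hcast.mul hG)).trans ?_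
  refine Eq.trans ?_ (congrArg _
    (lintegral_infinitePi_update _ x (hG.comp (measurable_addAt_left x))).symm)
  rw [← lintegral_const_mul']
  · refine lintegral_congr fun η => ?_
    simp only [Pi.mul_apply, Function.update_self, Function.comp, addAt, Function.update_idem]
    exact mecke_poissonMeasure (r x) (fun n => G (Function.update η x n))
  · simp

/-- The Mecke formula characterises Poisson fields. -/
theorem eq_poissonField_of_mecke {d : ℕ} (r : Site d → ℝ≥0) (μ : Measure (Config d))
    [IsProbabilityMeasure μ]
    (h : ∀ (x : Site d) (G : Config d → ℝ≥0∞), Measurable G →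
      ∫⁻ η, (η x : ℝ≥0∞) * G η ∂μ = r x * ∫⁻ η, G (addAt η x) ∂μ) :
    μ = poissonField r := by
  classical
  unfold poissonField
  refine Measure.eq_infinitePi _ fun s t ht => ?_
  induction s using Finset.induction_on with
  | empty => simp
  | insert y s hy ih =>
    rw [Finset.prod_insert hy, ← ih]
    set A : Set (Config d) := Set.pi s t with hA
    have hAm : MeasurableSet A := MeasurableSet.pi s.countable_toSet fun j _ => ht j
    have hinv : ∀ η : Config d, addAt η y ∈ A ↔ η ∈ A := by
      intro η
      simp only [hA, Set.mem_pi, Finset.mem_coe]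
      refine forall₂_congr fun j hj => ?_
      rw [addAt_of_ne _ (by rintro rfl; exact hy hj)]
    -- On the box `A` over the other sites, the occupation number at `y` has law `m`. Adding a
    -- particle at `y` leaves `A` invariant, so the Mecke formula tested on `E (n + 1)` gives `m`
    -- the Poisson recursion, and `m` is `μ A` times a Poisson law.
    set m : Measure ℕ := (μ.restrict A).map (fun η => η y) with hm
    have hmy : Measurable fun η : Config d => η y := measurable_pi_apply y
    have hmn : ∀ B : Set ℕ, m B = μ ((fun η : Config d => η y) ⁻¹' B ∩ A) := by
      intro B
      rw [hm, Measure.map_apply hmy (.of_discrete), Measure.restrict_apply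
        (hmy (.of_discrete))]
    have hrec : ∀ n : ℕ, ((n + 1 : ℕ) : ℝ≥0∞) * m {n + 1} = r y * m {n} := by
      intro n
      set E : ℕ → Set (Config d) := fun n => (fun η : Config d => η y) ⁻¹' {n} ∩ A with hE
      have hEm : ∀ n, MeasurableSet (E n) := fun n => (hmy (.of_discrete)).inter hAm
      have h1 := h y ((E (n + 1)).indicator 1) (measurable_one.indicator (hEm _))
      have e1 : ∀ η : Config d, (η y : ℝ≥0∞) * (E (n + 1)).indicator 1 η
          = ((n + 1 : ℕ) : ℝ≥0∞) * (E (n + 1)).indicator 1 η := by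
        intro η
        by_cases hη : η ∈ E (n + 1)
        · have : η y = n + 1 := hη.1
          simp [this]
        · simp [hη]
      have e2 : ∀ η : Config d, (E (n + 1)).indicator (1 : Config d → ℝ≥0∞) (addAt η y)
          = (E n).indicator 1 η := by
        intro η
        have : addAt η y ∈ E (n + 1) ↔ η ∈ E n := by
          simp [hE, hinv, addAt_same]
        by_cases hη : η ∈ E n
        · simp [hη, this.2 hη]
        · simp [hη, mt this.1 hη]
      simp_rw [e1, e2] at h1
      rw [lintegral_const_mul _ (measurable_one.indicator (hEm _)),
        lintegral_indicator_one (hEm _), lintegral_indicator_one (hEm _)] at h1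
      rw [hmn, hmn]; exact h1
    have hfin : IsFiniteMeasure m := by rw [hm]; infer_instance
    have h2 := eq_smul_poissonMeasure (r y) m hrec
    have h3 : μ (Set.pi (insert y s : Finset (Site d)) t) = m (t y) := by
      rw [hmn]; congr 1
      ext η; simp [hA, Set.mem_pi]
    have h4 : m Set.univ = μ A := by rw [hmn]; simp
    rw [h3, h2, h4]
    simp [mul_comm]

/-! ### Symmetry of the walk -/

section Walk

variable {d : ℕ} {p : Site d → PMF (Site d)}

theorem IsJumpKernel.neg (hp : IsJumpKernel p) (x y : Site d) : p (-x) (-y) = p x y := by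
  rw [hp.transl, hp.symm x y, hp.transl y x]; congr 1; abel

theorem IsJumpKernel.add_left (hp : IsJumpKernel p) (z x y : Site d) :
    p (z + x) (z + y) = p x y := by
  rw [hp.transl, hp.transl x y]; congr 1; abel

theorem stepLaw_add_left (hp : IsJumpKernel p) (n : ℕ) (z x y : Site d) :
    stepLaw p n (z + x) (z + y) = stepLaw p n x y := by
  induction n generalizing y with
  | zero => simp [stepLaw, PMF.pure_apply]
  | succ n ih =>
    simp only [stepLaw, PMF.bind_apply]
    rw [← (Equiv.addLeft z).tsum_eq]
    refine tsum_congr fun w => ?_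
    simp [ih, hp.add_left]

theorem stepLaw_neg (hp : IsJumpKernel p) (n : ℕ) (x y : Site d) :
    stepLaw p n (-x) (-y) = stepLaw p n x y := by
  induction n generalizing y with
  | zero => simp [stepLaw, PMF.pure_apply]
  | succ n ih =>
    simp only [stepLaw, PMF.bind_apply]
    rw [← (Equiv.neg (Site d)).tsum_eq]
    refine tsum_congr fun w => ?_
    simp [ih, hp.neg]

theorem walkLaw_add_left (hp : IsJumpKernel p) (t : ℝ≥0) (z x y : Site d) :
    walkLaw p t (z + x) (z + y) = walkLaw p t x y := by
  simp [walkLaw, PMF.bind_apply, stepLaw_add_left hp]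

theorem walkLaw_neg (hp : IsJumpKernel p) (t : ℝ≥0) (x y : Site d) :
    walkLaw p t (-x) (-y) = walkLaw p t x y := by
  simp [walkLaw, PMF.bind_apply, stepLaw_neg hp]

theorem walkLaw_eq_sub (hp : IsJumpKernel p) (t : ℝ≥0) (x y : Site d) :
    walkLaw p t x y = walkLaw p t 0 (y - x) := by
  rw [← walkLaw_add_left hp t (-x)]; congr 1 <;> abel_nf

theorem walkLaw_symm (hp : IsJumpKernel p) (t : ℝ≥0) (x y : Site d) :
    walkLaw p t x y = walkLaw p t y x := by
  rw [← walkLaw_neg hp, ← walkLaw_add_left hp t (x + y)]; congr 1 <;> abel_nf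

theorem walkLaw_zero (x : Site d) : walkLaw p 0 x = PMF.pure x := by
  have : (poissonMeasure 0).toPMF = PMF.pure 0 := by
    ext n
    rw [Measure.toPMF_apply, poissonMeasure_singleton, PMF.pure_apply]
    cases n <;> simp
  rw [walkLaw, this, PMF.pure_bind, stepLaw]

/-- A divergent `tsum` in `ℝ≥0` would default to `0`; boundedness of `r` excludes this, and the
evolved profile can then be handled in `ℝ≥0∞`. -/
theorem coe_evolve (t : ℝ≥0) {r : Site d → ℝ≥0} {C : ℝ≥0} (hr : ∀ x, r x ≤ C) (x : Site d) :
    (evolve p t r x : ℝ≥0∞) = ∑' y, walkLaw p t x y * r y := by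
  have h1 : ∀ y, ((((walkLaw p t x y).toNNReal * r y : ℝ≥0)) : ℝ≥0∞) = walkLaw p t x y * r y := by
    intro y
    rw [ENNReal.coe_mul, ENNReal.coe_toNNReal (PMF.apply_ne_top _ _)]
  have h2 : ∑' y, walkLaw p t x y * r y ≠ ∞ := by
    refine ne_top_of_le_ne_top (b := (C : ℝ≥0∞)) (by simp) ?_
    calc ∑' y, walkLaw p t x y * r y ≤ ∑' y, walkLaw p t x y * C :=
          ENNReal.tsum_le_tsum fun y => by gcongr; exact hr y
      _ = C := by rw [ENNReal.tsum_mul_right, PMF.tsum_coe, one_mul]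
  rw [evolve, ENNReal.coe_tsum]
  · simp_rw [h1]
  · rw [← ENNReal.tsum_coe_ne_top_iff_summable]
    simp_rw [h1]; exact h2

theorem evolve_le (t : ℝ≥0) {r : Site d → ℝ≥0} {C : ℝ≥0} (hr : ∀ x, r x ≤ C) (x : Site d) :
    evolve p t r x ≤ C := by
  rw [← ENNReal.coe_le_coe, coe_evolve t hr]
  calc ∑' y, walkLaw p t x y * r y ≤ ∑' y, walkLaw p t x y * C :=
        ENNReal.tsum_le_tsum fun y => by gcongr; exact hr y
    _ = C := by rw [ENNReal.tsum_mul_right, PMF.tsum_coe, one_mul]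

theorem evolve_zero (r : Site d → ℝ≥0) : evolve p 0 r = r := by
  ext x
  rw [evolve, tsum_eq_single x]
  · simp [walkLaw_zero]
  · intro y hy
    simp [walkLaw_zero, PMF.pure_apply, hy]

end Walk

/-! ### Relocation of particles -/

/-- The labels of the particles of `η` that the displacement `w` sends to `y`. -/
def labelsAt {d : ℕ} (η : Config d) (w : Site d × ℕ → Site d) (y : Site d) :
    Set (Site d × ℕ) :=
  {l | l.2 < η l.1 ∧ w l = y}

theorem relocate_apply {d : ℕ} (η : Config d) (w : Site d × ℕ → Site d) (y : Site d) :
    relocate η w y = (labelsAt η w y).ncard := rfl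

/-- The new particle at `x` receives the first unused label `(x, η x)`, so the labels and
destinations of the old particles are unchanged. -/
theorem labelsAt_addAt {d : ℕ} (η : Config d) (x : Site d) (w : Site d × ℕ → Site d)
    (y : Site d) : labelsAt (addAt η x) w y
      = if y = w (x, η x) then insert (x, η x) (labelsAt η w y) else labelsAt η w y := by
  ext ⟨z, i⟩
  have h0 : (z, i) ∈ labelsAt (addAt η x) w y ↔
      ((z, i) ∈ labelsAt η w y ∨ (z, i) = (x, η x) ∧ w (z, i) = y) := by
    simp only [labelsAt, Set.mem_ofPred_eq, Prod.mk.injEq, addAt_apply]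
    by_cases hz : z = x
    · subst hz; simp only [if_true, true_and]; rw [Nat.lt_succ_iff_lt_or_eq]; tauto
    · simp [hz]
  rw [h0]
  split_ifs with h
  · rw [Set.mem_insert_iff]
    constructor
    · rintro (h | h)
      · exact Or.inr h
      · exact Or.inl h.1
    · rintro (h' | h')
      · exact Or.inr ⟨h', by rw [h', h]⟩
      · exact Or.inl h'
  · constructor
    · rintro (h' | h')
      · exact h'
      · exact absurd (by rw [← h'.1, h'.2]) h
    · exact Or.inl

/-- Local finiteness matters because `ncard` of an infinite set is `0` and would not see the added
particle. -/
theorem relocate_addAt {d : ℕ} {η : Config d} {w : Site d × ℕ → Site d}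
    (hf : ∀ y, (labelsAt η w y).Finite) (x : Site d) :
    relocate (addAt η x) w = addAt (relocate η w) (w (x, η x)) := by
  ext y
  rw [relocate_apply, labelsAt_addAt, addAt_apply, relocate_apply]
  split_ifs with h
  · rw [Set.ncard_insert_of_notMem _ (hf y)]
    simp [labelsAt]
  · simp

theorem relocate_update {d : ℕ} (η : Config d) (w : Site d × ℕ → Site d) {l : Site d × ℕ}
    (hl : ¬ l.2 < η l.1) (y : Site d) : relocate η (Function.update w l y) = relocate η w := by
  ext z
  rw [relocate_apply, relocate_apply]
  congr 1
  ext m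
  simp only [labelsAt, Set.mem_ofPred_eq]
  refine and_congr_right fun hm => ?_
  rw [Function.update_of_ne (by rintro rfl; exact hl hm)]

theorem relocate_comp_perm {d : ℕ} (η : Config d) (w : Site d × ℕ → Site d)
    (σ : Equiv.Perm (Site d × ℕ)) (hσ : ∀ l, (σ l).2 < η (σ l).1 ↔ l.2 < η l.1) :
    relocate η (w ∘ σ) = relocate η w := by
  ext z
  rw [relocate_apply, relocate_apply]
  have : labelsAt η w z = σ '' labelsAt η (w ∘ σ) z := by
    ext m
    rw [Equiv.image_eq_preimage_symm]
    simp only [labelsAt, Set.mem_ofPred_eq, Set.mem_preimage, Function.comp,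
      Equiv.apply_symm_apply]
    rw [← hσ (σ.symm m), Equiv.apply_symm_apply]
  rw [this, Set.ncard_image_of_injective _ σ.injective]

theorem measurable_relocate_right {d : ℕ} (η : Config d) :
    Measurable (fun w : Site d × ℕ → Site d => relocate η w) :=
  measurable_relocate.comp measurable_prodMk_left

theorem measurable_nat_cast_eval {d : ℕ} (x : Site d) :
    Measurable fun η : Config d => (η x : ℝ≥0∞) :=
  (measurable_of_countable (fun n : ℕ => (n : ℝ≥0∞))).comp (measurable_pi_apply x)

/-! ### Motion of a Poisson field: two-time Mecke formula and evolved intensity -/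

section Kernel

variable {d : ℕ} {p : Site d → PMF (Site d)}

theorem lintegral_irwKernel (t : ℝ≥0) (η : Config d) {H : Config d → ℝ≥0∞} (hH : Measurable H) :
    ∫⁻ η', H η' ∂(irwKernel p t η) = ∫⁻ w, H (relocate η w) ∂(destLaw p t) := by
  change ∫⁻ η', H η' ∂((destLaw p t).map (relocate η)) = _
  rw [lintegral_map hH (measurable_relocate_right η)]

/-- The displacement of an unused label is independent of the relocated configuration. -/
theorem lintegral_destLaw_unused (t : ℝ≥0) (η : Config d) {l : Site d × ℕ} (hl : ¬ l.2 < η l.1)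
    {F : Config d × Site d → ℝ≥0∞} (hF : Measurable F) :
    ∫⁻ w, F (relocate η w, w l) ∂(destLaw p t)
      = ∫⁻ w, ∫⁻ y, F (relocate η w, y) ∂(walkLaw p t l.1).toMeasure ∂(destLaw p t) := by
  classical
  unfold destLaw
  have hm : Measurable fun w : Site d × ℕ → Site d => F (relocate η w, w l) :=
    hF.comp ((measurable_relocate_right η).prodMk (measurable_pi_apply l))
  refine (lintegral_infinitePi_update _ l hm).trans ?_
  simp only [relocate_update η _ hl, Function.update_self]

theorem measurableSet_eval_eq (l : Site d × ℕ) (y : Site d) :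
    MeasurableSet {w : Site d × ℕ → Site d | w l = y} :=
  (measurable_pi_apply (X := fun _ => Site d) l) (measurableSet_singleton y)

theorem destLaw_eval (t : ℝ≥0) (l : Site d × ℕ) (y : Site d) :
    destLaw p t {w | w l = y} = walkLaw p t l.1 y := by
  have h := Measure.infinitePi_map_eval (fun l : Site d × ℕ => (walkLaw p t l.1).toMeasure) l
  have h2 := DFunLike.congr_fun h {y}
  rw [Measure.map_apply (measurable_pi_apply l) (measurableSet_singleton y),
    PMF.toMeasure_apply_singleton _ _ (measurableSet_singleton y)] at h2
  exact h2

/-- Walkers starting at the same site are identically distributed, so relabelling them site by site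
preserves the product law. -/
theorem destLaw_map_perm (t : ℝ≥0) (σ : Equiv.Perm (Site d × ℕ)) (hσ : ∀ l, (σ l).1 = l.1) :
    (destLaw p t).map (fun w => w ∘ σ) = destLaw p t := by
  classical
  refine Measure.eq_infinitePi _ fun s u hu => ?_
  have hm : Measurable fun w : Site d × ℕ → Site d => w ∘ σ :=
    measurable_pi_lambda _ fun l => measurable_pi_apply (σ l)
  rw [Measure.map_apply hm (MeasurableSet.pi s.countable_toSet fun j _ => hu j)]
  have : (fun w : Site d × ℕ → Site d => w ∘ σ) ⁻¹' Set.pi s u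
      = Set.pi (s.map σ.toEmbedding : Finset _) (fun l => u (σ.symm l)) := by
    ext w
    simp only [Set.mem_preimage, Set.mem_pi, Finset.mem_coe, Finset.mem_map_equiv]
    exact (σ.forall_congr fun l => by simp).symm.symm
  rw [this, destLaw, Measure.infinitePi_pi _ (fun l _ => hu _), Finset.prod_map]
  refine Finset.prod_congr rfl fun l _ => ?_
  simp [hσ]

theorem measurableSet_labelsAt (l : Site d × ℕ) (y : Site d) :
    MeasurableSet {q : Config d × (Site d × ℕ → Site d) | l ∈ labelsAt q.1 q.2 y} := by
  have h1 : Measurable fun q : Config d × (Site d × ℕ → Site d) => q.1 l.1 :=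
    (measurable_pi_apply _).comp measurable_fst
  have h2 : Measurable fun q : Config d × (Site d × ℕ → Site d) => q.2 l :=
    (measurable_pi_apply _).comp measurable_snd
  exact (measurableSet_lt measurable_const h1).inter (h2 (measurableSet_singleton y))

theorem tsum_indicator_lt (n : ℕ) (c : ℝ≥0∞) :
    ∑' i : ℕ, (if i < n then c else 0) = n * c := by
  rw [tsum_eq_sum (s := Finset.range n) (fun i hi => by simp [Finset.mem_range] at hi; simp [hi])]
  rw [Finset.sum_congr rfl (fun i hi => by rw [if_pos (Finset.mem_range.1 hi)])]
  simp

theorem tsum_walkLaw_mul_eq_evolve (hp : IsJumpKernel p) (t : ℝ≥0) {r : Site d → ℝ≥0} {C : ℝ≥0}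
    (hr : ∀ x, r x ≤ C) (y : Site d) :
    ∑' x, (r x : ℝ≥0∞) * walkLaw p t x y = evolve p t r y := by
  rw [coe_evolve t hr]
  exact tsum_congr fun x => by rw [mul_comm, walkLaw_symm hp]

/-- Started from a Poisson field of bounded intensity, the relocated configuration is locally
finite. -/
theorem ae_finite_labelsAt (hp : IsJumpKernel p) (t : ℝ≥0) {r : Site d → ℝ≥0} {C : ℝ≥0}
    (hr : ∀ x, r x ≤ C) :
    ∀ᵐ η ∂(poissonField r), ∀ᵐ w ∂(destLaw p t), ∀ y, (labelsAt η w y).Finite := by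
  classical
  have main : ∀ y, ∀ᵐ q ∂((poissonField r).prod (destLaw p t)),
      (labelsAt q.1 q.2 y).Finite := by
    intro y
    set f : Site d × ℕ → Config d × (Site d × ℕ → Site d) → ℝ≥0∞ := fun l q =>
      Set.indicator {q | l ∈ labelsAt q.1 q.2 y} 1 q with hf
    have hfm : ∀ l, Measurable (f l) := fun l =>
      measurable_one.indicator (measurableSet_labelsAt l y)
    -- The expected number of labels sent to `y` is `∑ x, r x * p_t(x, y)`. By symmetry of the walk
    -- this is the evolved density at `y`, which is finite.
    have hint : ∫⁻ q, ∑' l, f l q ∂((poissonField r).prod (destLaw p t)) ≠ ∞ := by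
      have e1 : ∫⁻ q, ∑' l, f l q ∂((poissonField r).prod (destLaw p t))
          = evolve p t r y := by
        rw [← tsum_walkLaw_mul_eq_evolve hp t hr, lintegral_tsum fun l => (hfm l).aemeasurable,
          ENNReal.tsum_prod']
        refine tsum_congr fun x => ?_
        have e2 : ∀ i : ℕ, ∫⁻ q, f (x, i) q ∂((poissonField r).prod (destLaw p t))
            = ∫⁻ η, (if i < η x then walkLaw p t x y else 0) ∂(poissonField r) := by
          intro i
          rw [lintegral_prod _ (hfm _).aemeasurable]
          refine lintegral_congr fun η => ?_
          by_cases h : i < η x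
          · rw [if_pos h, ← destLaw_eval t (x, i) y, ← lintegral_indicator_one]
            · refine lintegral_congr fun w => ?_
              simp [hf, labelsAt, h, Set.indicator_apply]
            · exact measurableSet_eval_eq (x, i) y
          · simp [hf, labelsAt, h, Set.indicator_apply]
        simp_rw [e2]
        rw [← lintegral_tsum]
        · simp_rw [tsum_indicator_lt]
          rw [mecke_poissonField r x measurable_const]
          simp
        · intro i
          exact (Measurable.ite (measurableSet_lt measurable_const (measurable_pi_apply x))
            measurable_const measurable_const).aemeasurable
      rw [e1]; simp
    filter_upwards [ae_lt_top (Measurable.tsum hfm) hint] with q hq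
    have e3 : ∑' l, f l q = ((labelsAt q.1 q.2 y).encard : ℝ≥0∞) := by
      rw [← ENNReal.tsum_set_one, tsum_subtype (labelsAt q.1 q.2 y) (fun _ => (1 : ℝ≥0∞))]
      refine tsum_congr fun l => ?_
      simp [hf, Set.indicator_apply]
    rw [e3] at hq
    rw [← Set.encard_lt_top_iff]
    simpa using hq
  exact Measure.ae_ae_of_ae_prod (ae_all_iff.2 main)

/-- A law `J` of pairs of configurations satisfies the Mecke formula with intensity `r` and
displacement laws `Q`. -/
def IsMeckePair (J : Measure (Config d × Config d)) (r : Site d → ℝ≥0)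
    (Q : Site d → PMF (Site d)) : Prop :=
  ∀ (x : Site d) (H : Config d × Config d → ℝ≥0∞), Measurable H →
    ∫⁻ q, (q.1 x : ℝ≥0∞) * H q ∂J
      = r x * ∫⁻ q, ∫⁻ y, H (addAt q.1 x, addAt q.2 y) ∂(Q x).toMeasure ∂J

theorem measurable_addAt_pair (x : Site d) :
    Measurable fun u : (Config d × Config d) × Site d => (addAt u.1.1 x, addAt u.1.2 u.2) :=
  ((measurable_addAt_left x).comp (measurable_fst.comp measurable_fst)).prodMk
    (measurable_addAt.comp ((measurable_snd.comp measurable_fst).prodMk measurable_snd))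

/-- The Mecke formula for the initial field adds a particle at `x`. It carries a label unused by the
other particles, so its destination is independent of their relocated configuration and has law
`walkLaw p t x`. -/
theorem isMeckePair_irw (hp : IsJumpKernel p) (t : ℝ≥0) {r : Site d → ℝ≥0} {C : ℝ≥0}
    (hr : ∀ x, r x ≤ C) :
    IsMeckePair (poissonField r ⊗ₘ irwKernel p t) r (walkLaw p t) := by
  intro x H hH
  have hH2 : Measurable fun u : (Config d × Config d) × Site d =>
      H (addAt u.1.1 x, addAt u.1.2 u.2) := hH.comp (measurable_addAt_pair x)
  have hL : Measurable fun q : Config d × Config d => (q.1 x : ℝ≥0∞) * H q :=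
    ((measurable_nat_cast_eval x).comp measurable_fst).mul hH
  rw [Measure.lintegral_compProd hL, Measure.lintegral_compProd hH2.lintegral_prod_right']
  have hG : Measurable fun η : Config d => ∫⁻ η', H (η, η') ∂(irwKernel p t η) :=
    hH.lintegral_kernel_prod_right'
  have e1 : ∀ η : Config d, ∫⁻ η', (η x : ℝ≥0∞) * H (η, η') ∂(irwKernel p t η)
      = (η x : ℝ≥0∞) * ∫⁻ η', H (η, η') ∂(irwKernel p t η) := fun η =>
    lintegral_const_mul _ (hH.comp measurable_prodMk_left)
  simp_rw [e1]
  rw [mecke_poissonField r x hG]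
  congr 1
  refine lintegral_congr_ae ?_
  filter_upwards [ae_finite_labelsAt hp t hr] with η hη
  rw [lintegral_irwKernel t _ (H := fun η' => H (addAt η x, η')) (hH.comp measurable_prodMk_left),
    lintegral_irwKernel t η
      (H := fun η' => ∫⁻ y, H (addAt η x, addAt η' y) ∂(walkLaw p t x).toMeasure)
      (hH2.comp ((measurable_prodMk_left.comp measurable_fst).prodMk measurable_snd) :
        Measurable fun u : Config d × Site d =>
          H (addAt η x, addAt u.1 u.2)).lintegral_prod_right']
  have hF : Measurable fun u : Config d × Site d => H (addAt η x, addAt u.1 u.2) :=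
    hH.comp (measurable_const.prodMk measurable_addAt)
  rw [← lintegral_destLaw_unused t η (l := (x, η x)) (by simp) hF]
  refine lintegral_congr_ae ?_
  filter_upwards [hη] with w hw
  simp only [relocate_addAt hw]

/-- A Poisson field is invariant in form under the motion of the particles: its intensity is
evolved. -/
theorem snd_poissonField_compProd_irwKernel (hp : IsJumpKernel p) (t : ℝ≥0) {r : Site d → ℝ≥0}
    {C : ℝ≥0} (hr : ∀ x, r x ≤ C) :
    (poissonField r ⊗ₘ irwKernel p t).snd = poissonField (evolve p t r) := by
  classical
  refine eq_poissonField_of_mecke _ _ fun y G hG => ?_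
  have hsnd : ∀ F : Config d → ℝ≥0∞, Measurable F →
      ∫⁻ η, F η ∂(poissonField r ⊗ₘ irwKernel p t).snd
        = ∫⁻ η, ∫⁻ w, F (relocate η w) ∂(destLaw p t) ∂(poissonField r) := by
    intro F hF
    rw [Measure.snd, lintegral_map hF measurable_snd,
      Measure.lintegral_compProd (f := fun q : Config d × Config d => F q.2)
        (hF.comp measurable_snd)]
    exact lintegral_congr fun η => lintegral_irwKernel t η hF
  rw [hsnd (fun η => (η y : ℝ≥0∞) * G η) ((measurable_nat_cast_eval y).mul hG),
    hsnd (fun η => G (addAt η y)) (hG.comp (measurable_addAt_left y))]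
  -- `η x - 1` is the last occupied label at `x`. The truncated value at `η x = 0` is harmless,
  -- since `Φ x η` only appears multiplied by `η x`; after `addAt` this label is that of the added
  -- particle.
  set Φ : Site d → Config d → ℝ≥0∞ := fun x η =>
    ∫⁻ w, (if w (x, η x - 1) = y then G (relocate η w) else 0) ∂(destLaw p t) with hΦ
  have hΦm : ∀ x, Measurable (Φ x) := by
    intro x
    have hset : MeasurableSet {q : Config d × (Site d × ℕ → Site d) |
        q.2 (x, q.1 x - 1) = y} := by
      have : {q : Config d × (Site d × ℕ → Site d) | q.2 (x, q.1 x - 1) = y}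
          = ⋃ n : ℕ, {q | q.1 x = n} ∩ {q | q.2 (x, n - 1) = y} := by
        ext q; simp
      rw [this]
      refine MeasurableSet.iUnion fun n => ?_
      exact (measurable_fst (measurable_pi_apply (X := fun _ : Site d => ℕ) x (measurableSet_singleton n))).inter
        (measurable_snd (measurableSet_eval_eq (x, n - 1) y))
    exact (Measurable.ite hset (hG.comp measurable_relocate) measurable_const
      : Measurable fun q : Config d × (Site d × ℕ → Site d) =>
        if q.2 (x, q.1 x - 1) = y then G (relocate q.1 q.2) else 0).lintegral_prod_right'
  have hsplit : ∀ᵐ η ∂(poissonField r),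
      ∫⁻ w, (relocate η w y : ℝ≥0∞) * G (relocate η w) ∂(destLaw p t)
        = ∑' x, (η x : ℝ≥0∞) * Φ x η := by
    filter_upwards [ae_finite_labelsAt hp t hr] with η hη
    have e1 : ∫⁻ w, (relocate η w y : ℝ≥0∞) * G (relocate η w) ∂(destLaw p t)
        = ∫⁻ w, ∑' l : Site d × ℕ, (if l.2 < η l.1 ∧ w l = y then G (relocate η w) else 0)
          ∂(destLaw p t) := by
      refine lintegral_congr_ae ?_
      filter_upwards [hη] with w hw
      have e2 : (relocate η w y : ℝ≥0∞) = ((labelsAt η w y).encard : ℝ≥0∞) := by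
        rw [relocate_apply, ← (hw y).cast_ncard_eq]; simp
      rw [e2, ← ENNReal.tsum_set_one,
        tsum_subtype (labelsAt η w y) (fun _ => (1 : ℝ≥0∞)), ← ENNReal.tsum_mul_right]
      refine tsum_congr fun l => ?_
      by_cases h : l.2 < η l.1 ∧ w l = y
      · simp [labelsAt, h]
      · rw [if_neg h]; simp [labelsAt, h]
    rw [e1, lintegral_tsum]
    · rw [ENNReal.tsum_prod']
      refine tsum_congr fun x => ?_
      rw [← tsum_indicator_lt]
      refine tsum_congr fun i => ?_
      split_ifs with hi
      · simp only [hi, true_and]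
        -- The occupied labels at `x` are exchangeable: swapping label `i` with the last one makes
        -- all `η x` contributions equal to `Φ x η`.
        set σ : Equiv.Perm (Site d × ℕ) := Equiv.swap (x, i) (x, η x - 1) with hσ
        have hσ1 : ∀ l, (σ l).1 = l.1 := by
          intro l
          rw [hσ, Equiv.swap_apply_def]
          split_ifs with h1 h2
          · rw [h1]
          · rw [h2]
          · rfl
        have hσ2 : ∀ l, (σ l).2 < η (σ l).1 ↔ l.2 < η l.1 := by
          intro l
          rw [hσ, Equiv.swap_apply_def]
          split_ifs with h1 h2
          · rw [h1]; simp only; omega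
          · rw [h2]; simp only; omega
          · rfl
        have hmeas : ∀ j, Measurable fun w : Site d × ℕ → Site d =>
            if w (x, j) = y then G (relocate η w) else 0 := fun j =>
          Measurable.ite (measurableSet_eval_eq (x, j) y)
            (hG.comp (measurable_relocate_right η)) measurable_const
        conv_lhs => rw [← destLaw_map_perm t σ hσ1]
        rw [lintegral_map (hmeas i)
          (measurable_pi_lambda _ fun l => measurable_pi_apply (σ l))]
        refine lintegral_congr fun w => ?_
        rw [relocate_comp_perm η w σ hσ2]
        simp [hσ]
      · simp [hi]
    · intro l
      by_cases hl : l.2 < η l.1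
      · simp only [hl, true_and]
        exact (Measurable.ite (measurableSet_eval_eq l y)
            (hG.comp (measurable_relocate_right η)) measurable_const).aemeasurable
      · simp [hl]
  rw [lintegral_congr_ae hsplit, lintegral_tsum (f := fun x (η : Config d) => (η x : ℝ≥0∞) * Φ x η)
    fun x => ((measurable_nat_cast_eval x).mul (hΦm x)).aemeasurable]
  rw [← tsum_walkLaw_mul_eq_evolve hp t hr, ← ENNReal.tsum_mul_right]
  refine tsum_congr fun x => ?_
  rw [mecke_poissonField r x (hΦm x), mul_assoc]
  congr 1
  rw [← lintegral_const_mul' _ _ (PMF.apply_ne_top _ _)]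
  refine lintegral_congr_ae ?_
  filter_upwards [ae_finite_labelsAt hp t hr] with η hη
  have hF : Measurable fun u : Config d × Site d =>
      if u.2 = y then G (addAt u.1 y) else 0 :=
    Measurable.ite (measurable_snd (measurableSet_singleton y))
      (hG.comp ((measurable_addAt_left y).comp measurable_fst)) measurable_const
  have e3 : Φ x (addAt η x) = ∫⁻ w, (fun u : Config d × Site d =>
      if u.2 = y then G (addAt u.1 y) else 0) (relocate η w, w (x, η x)) ∂(destLaw p t) := by
    refine lintegral_congr_ae ?_
    filter_upwards [hη] with w hw
    simp only [addAt_same, Nat.add_sub_cancel, relocate_addAt hw]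
    split_ifs with h
    · rw [h]
    · rfl
  rw [e3, lintegral_destLaw_unused t η (l := (x, η x)) (by simp) hF,
    ← lintegral_const_mul' _ _ (PMF.apply_ne_top _ _)]
  refine lintegral_congr fun w => ?_
  rw [lintegral_countable', tsum_eq_single y]
  · rw [PMF.toMeasure_apply_singleton _ _ (measurableSet_singleton y)]
    simp [mul_comm]
  · intro z hz
    simp [hz]

end Kernel

/-! ### The laws of the process -/

section Laws

variable {d : ℕ} {p : Site d → PMF (Site d)} {Ω : Type*} [MeasurableSpace Ω] {P : Measure Ω}
  [IsProbabilityMeasure P] {η : ℝ≥0 → Ω → Config d} {ν : Measure (Config d)}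

/-- The kernel in the Markov property depends on the past only through its endpoint, so the past can
be projected onto its value at time `s`. -/
theorem IsIRW.map_pair (h : IsIRW p ν P η) {s t : ℝ≥0} (hst : s ≤ t) :
    P.map (fun ω => (η s ω, η t ω)) = P.map (η s) ⊗ₘ irwKernel p (t - s) := by
  have hpast : Measurable fun ω => fun u : Set.Iic s => η u ω :=
    measurable_pi_lambda _ fun u => h.measurable u
  set ev : (Set.Iic s → Config d) → Config d := fun w => w ⟨s, Set.self_mem_Iic⟩ with hev
  have hevm : Measurable ev := measurable_pi_apply _
  have h1 := congrArg (Measure.map (Prod.map ev id)) (h.markov s t hst)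
  rw [Measure.map_map (hevm.prodMap measurable_id) (hpast.prodMk (h.measurable t))] at h1
  have : IsProbabilityMeasure (P.map fun ω => fun u : Set.Iic s => η u ω) :=
    Measure.isProbabilityMeasure_map hpast.aemeasurable
  have : IsProbabilityMeasure (P.map (η s)) :=
    Measure.isProbabilityMeasure_map (h.measurable s).aemeasurable
  refine h1.trans ?_
  ext A hA
  rw [Measure.map_apply (hevm.prodMap measurable_id) hA,
    Measure.compProd_apply ((hevm.prodMap measurable_id) hA), Measure.compProd_apply hA]
  have e : P.map (η s) = (P.map fun ω => fun u : Set.Iic s => η u ω).map ev := by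
    rw [Measure.map_map hevm hpast]; rfl
  rw [e, lintegral_map (Kernel.measurable_kernel_prodMk_left hA) hevm]
  rfl

theorem IsIRW.map_eq (hp : IsJumpKernel p) {r : Site d → ℝ≥0} {C : ℝ≥0} (hr : ∀ x, r x ≤ C)
    (h : IsIRW p (poissonField r) P η) (t : ℝ≥0) :
    P.map (η t) = poissonField (evolve p t r) := by
  have h1 := h.map_pair (zero_le (a := t))
  rw [h.initial, tsub_zero] at h1
  rw [← snd_poissonField_compProd_irwKernel hp t hr, ← h1, Measure.snd,
    Measure.map_map measurable_snd ((h.measurable 0).prodMk (h.measurable t))]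
  rfl

theorem IsIRW.isMeckePair (hp : IsJumpKernel p) {r : Site d → ℝ≥0} {C : ℝ≥0} (hr : ∀ x, r x ≤ C)
    (h : IsIRW p (poissonField r) P η) {s t : ℝ≥0} (hst : s ≤ t) :
    IsMeckePair (P.map fun ω => (η s ω, η t ω)) (evolve p s r) (walkLaw p (t - s)) := by
  rw [h.map_pair hst, h.map_eq hp hr s]
  exact isMeckePair_irw hp _ (evolve_le s hr)

end Laws

/-! ### Charlier polynomials -/

theorem charlier_zero (c : ℝ≥0) (n : ℕ) : charlier c 0 n = 1 := by simp [charlier]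

/-- Pascal's rule splits the sum, and one factor `n` is extracted from each falling factorial. The
truncated `n - 1` at `n = 0` is multiplied by `0`. The term `n * f (n - 1)` is the form to which the
Mecke formula applies. -/
theorem charlier_succ (c : ℝ≥0) (k n : ℕ) :
    charlier c (k + 1) n = n * charlier c k (n - 1) - c * charlier c k n := by
  have h := Finset.sum_choose_succ_mul
    (fun j e => (-(c : ℝ)) ^ e * (n.descFactorial j : ℝ)) k
  have hd : ∀ j, (n.descFactorial (j + 1) : ℝ) = n * ((n - 1).descFactorial j : ℝ) := by
    intro j
    cases n with
    | zero => simp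
    | succ m => rw [Nat.succ_descFactorial_succ]; push_cast; simp
  simp only [charlier]
  simp only [← mul_assoc] at h
  rw [h, Finset.mul_sum, Finset.mul_sum, add_comm, sub_eq_add_neg, ← Finset.sum_neg_distrib]
  congr 1
  · refine Finset.sum_congr rfl fun j _ => ?_
    rw [hd]; ring
  · refine Finset.sum_congr rfl fun j hj => ?_
    rw [Nat.succ_sub (Nat.lt_succ_iff.1 (Finset.mem_range.1 hj)), pow_succ]; ring

/-- Lowering rule: the discrete derivative reduces the degree, as for monomials. It follows from the
raising recurrence by induction on the degree, and `k - 1` at `k = 0` has coefficient `0`. -/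
theorem charlier_add_one (c : ℝ≥0) (k n : ℕ) :
    charlier c k (n + 1) = charlier c k n + k * charlier c (k - 1) n := by
  induction k generalizing n with
  | zero => simp [charlier_zero]
  | succ k ih =>
    rw [charlier_succ c k (n + 1), charlier_succ c k n, ih n]
    simp only [Nat.add_sub_cancel]
    have h1 : (n : ℝ) * charlier c k n
        = n * (charlier c k (n - 1) + k * charlier c (k - 1) (n - 1)) := by
      cases n with
      | zero => simp
      | succ m => rw [ih m]; simp
    have h2 : (k : ℝ) * charlier c k n
        = k * (n * charlier c (k - 1) (n - 1) - c * charlier c (k - 1) n) := by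
      cases k with
      | zero => simp
      | succ l => rw [charlier_succ c l n]; simp
    push_cast
    linear_combination h1 - h2

theorem abs_charlier_le (c : ℝ≥0) (k n : ℕ) : |charlier c k n| ≤ ((c : ℝ) + n) ^ k := by
  have : ((c : ℝ) + n) ^ k = ((n : ℝ) + c) ^ k := by rw [add_comm]
  rw [this, add_pow, charlier]
  refine (Finset.abs_sum_le_sum_abs _ _).trans (Finset.sum_le_sum fun j _ => ?_)
  rw [abs_mul, abs_mul, abs_pow, abs_neg, Nat.abs_cast, Nat.abs_cast, abs_of_nonneg (NNReal.coe_nonneg c)]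
  have : (n.descFactorial j : ℝ) ≤ (n : ℝ) ^ j := by exact_mod_cast Nat.descFactorial_le_pow n j
  calc (k.choose j : ℝ) * (c : ℝ) ^ (k - j) * (n.descFactorial j : ℝ)
      ≤ (k.choose j : ℝ) * (c : ℝ) ^ (k - j) * (n : ℝ) ^ j := by gcongr
    _ = _ := by ring

section Prod

variable {d : ℕ}

theorem charlierProd_eq_mul (r : Site d → ℝ≥0) (ξ : Site d →₀ ℕ) (η : Config d) (x : Site d) :
    charlierProd r ξ η = charlier (r x) (ξ x) (η x) *
      ∏ z ∈ ξ.support.erase x, charlier (r z) (ξ z) (η z) := by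
  by_cases h : x ∈ ξ.support
  · rw [charlierProd, Finset.mul_prod_erase _ (fun z => charlier (r z) (ξ z) (η z)) h]
  · rw [Finset.erase_eq_of_notMem h, Finsupp.notMem_support_iff.1 h, charlier_zero, one_mul,
      charlierProd]

/-- The configuration with one particle removed at `x`. -/
def subAt (η : Config d) (x : Site d) : Config d := Function.update η x (η x - 1)

theorem subAt_addAt (η : Config d) (x : Site d) : subAt (addAt η x) x = η := by
  simp [subAt, addAt]

theorem measurable_subAt (x : Site d) : Measurable fun η : Config d => subAt η x := by
  unfold subAt
  exact measurable_pi_lambda _ fun y => by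
    by_cases h : y = x
    · subst h
      simp only [Function.update_self]
      exact (measurable_of_countable (fun n : ℕ => n - 1)).comp (measurable_pi_apply y)
    · simpa [h] using measurable_pi_apply y

theorem measurable_charlierProd (r : Site d → ℝ≥0) (ξ : Site d →₀ ℕ) :
    Measurable (charlierProd r ξ) := by
  unfold charlierProd
  exact Finset.measurable_fun_prod _ fun x _ =>
    (measurable_of_countable (charlier (r x) (ξ x))).comp (measurable_pi_apply x)

/-- Raising recurrence at the single site `x`. The removal `subAt η x` will be undone by the
particle that the Mecke formula adds. -/
theorem charlierProd_add_single (r : Site d → ℝ≥0) (ξ : Site d →₀ ℕ) (η : Config d) (x : Site d) :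
    charlierProd r (ξ + Finsupp.single x 1) η
      = η x * charlierProd r ξ (subAt η x) - r x * charlierProd r ξ η := by
  have hs : (ξ + Finsupp.single x 1).support.erase x = ξ.support.erase x := by
    ext z
    simp only [Finset.mem_erase, Finsupp.mem_support_iff, Finsupp.add_apply]
    refine and_congr_right fun hz => ?_
    rw [Finsupp.single_eq_of_ne hz]; simp
  rw [charlierProd_eq_mul _ _ _ x, charlierProd_eq_mul r ξ (subAt η x) x,
    charlierProd_eq_mul r ξ η x, hs]
  have h1 : ∏ z ∈ ξ.support.erase x, charlier (r z) ((ξ + Finsupp.single x 1 : Site d →₀ ℕ) z) (η z)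
      = ∏ z ∈ ξ.support.erase x, charlier (r z) (ξ z) (η z) := by
    refine Finset.prod_congr rfl fun z hz => ?_
    rw [Finsupp.add_apply, Finsupp.single_eq_of_ne (Finset.ne_of_mem_erase hz), add_zero]
  have h2 : ∏ z ∈ ξ.support.erase x, charlier (r z) (ξ z) (subAt η x z)
      = ∏ z ∈ ξ.support.erase x, charlier (r z) (ξ z) (η z) := by
    refine Finset.prod_congr rfl fun z hz => ?_
    rw [subAt, Function.update_of_ne (Finset.ne_of_mem_erase hz)]
  rw [h1, h2, Finsupp.add_apply, Finsupp.single_eq_same, charlier_succ, subAt,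
    Function.update_self]
  ring

theorem charlierProd_addAt (r : Site d → ℝ≥0) (ξ : Site d →₀ ℕ) (η : Config d) (y : Site d) :
    charlierProd r ξ (addAt η y)
      = charlierProd r ξ η + ξ y * charlierProd r (ξ - Finsupp.single y 1) η := by
  have hs : (ξ - Finsupp.single y 1).support.erase y = ξ.support.erase y := by
    ext z
    simp only [Finset.mem_erase, Finsupp.mem_support_iff, Finsupp.tsub_apply]
    refine and_congr_right fun hz => ?_
    rw [Finsupp.single_eq_of_ne hz]; simp
  rw [charlierProd_eq_mul _ _ _ y, charlierProd_eq_mul r ξ η y,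
    charlierProd_eq_mul r (ξ - Finsupp.single y 1) η y, hs]
  have h1 : ∏ z ∈ ξ.support.erase y, charlier (r z) ((ξ - Finsupp.single y 1 : Site d →₀ ℕ) z) (η z)
      = ∏ z ∈ ξ.support.erase y, charlier (r z) (ξ z) (η z) := by
    refine Finset.prod_congr rfl fun z hz => ?_
    rw [Finsupp.tsub_apply, Finsupp.single_eq_of_ne (Finset.ne_of_mem_erase hz), tsub_zero]
  have h2 : ∏ z ∈ ξ.support.erase y, charlier (r z) (ξ z) (addAt η y z)
      = ∏ z ∈ ξ.support.erase y, charlier (r z) (ξ z) (η z) := by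
    refine Finset.prod_congr rfl fun z hz => ?_
    rw [addAt_of_ne _ (Finset.ne_of_mem_erase hz)]
  rw [h1, h2, Finsupp.tsub_apply, Finsupp.single_eq_same, addAt_same, charlier_add_one]
  ring

/-! ### Labelled configurations -/

theorem configOf_apply {k : ℕ} (x : Fin k → Site d) (z : Site d) :
    configOf x z = Fintype.card {i // x i = z} := by
  classical
  rw [configOf, Finsupp.finsetSum_apply, Fintype.card_subtype, Finset.card_filter]
  exact Finset.sum_congr rfl fun i _ => by rw [Finsupp.single_apply]

theorem configOf_comp_perm {k : ℕ} (x : Fin k → Site d) (σ : Equiv.Perm (Fin k)) :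
    configOf (x ∘ σ) = configOf x :=
  Equiv.sum_comp σ fun i => Finsupp.single (x i) 1

/-- Equal occupation numbers mean equinumerous fibres of the two labellings; bijections between the
fibres glue to a permutation of the labels. -/
theorem configOf_eq_iff {k : ℕ} (x y : Fin k → Site d) :
    configOf x = configOf y ↔ ∃ σ : Equiv.Perm (Fin k), x = y ∘ σ := by
  constructor
  · intro h
    have h' : ∀ z, Nonempty ({i // x i = z} ≃ {i // y i = z}) := fun z =>
      Fintype.card_eq.1 (by rw [← configOf_apply, ← configOf_apply, h])
    refine ⟨Equiv.ofFiberEquiv fun z => (h' z).some, funext fun i => ?_⟩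
    exact (Equiv.ofFiberEquiv_map (fun z => (h' z).some) i).symm
  · rintro ⟨σ, rfl⟩
    exact configOf_comp_perm y σ

theorem configOf_succ {k : ℕ} (x : Fin (k + 1) → Site d) :
    configOf x = configOf (fun i => x i.succ) + Finsupp.single (x 0) 1 := by
  rw [configOf, Fin.sum_univ_succ, add_comm]; rfl

/-- The labelled configuration with the `j`-th particle removed. -/
def dropLabel {k : ℕ} (b : Fin (k + 1) → Site d) (j : Fin (k + 1)) : Fin k → Site d :=
  fun i => b (Equiv.swap 0 j i.succ)

theorem configOf_dropLabel {k : ℕ} (b : Fin (k + 1) → Site d) (j : Fin (k + 1)) :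
    configOf (dropLabel b j) + Finsupp.single (b j) 1 = configOf b := by
  rw [← configOf_comp_perm b (Equiv.swap 0 j), configOf_succ (b ∘ Equiv.swap 0 j)]
  simp only [Function.comp, Equiv.swap_apply_left]
  rfl

/-- The coefficient in the lowering rule counts the labels located at `y`. As a sum over labels, the
dependence on `y` is only through indicators, which integrate to point probabilities. -/
theorem charlierProd_configOf_addAt {k : ℕ} (r : Site d → ℝ≥0) (b : Fin (k + 1) → Site d)
    (η : Config d) (y : Site d) :
    charlierProd r (configOf b) (addAt η y) = charlierProd r (configOf b) η
      + ∑ j, charlierProd r (configOf (dropLabel b j)) η * Set.indicator {b j} 1 y := by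
  classical
  rw [charlierProd_addAt, configOf_apply, Fintype.card_subtype, Finset.card_filter]
  congr 1
  push_cast
  rw [Finset.sum_mul]
  refine Finset.sum_congr rfl fun j _ => ?_
  by_cases h : b j = y
  · subst h
    rw [← configOf_dropLabel b j]
    simp
  · simp [h, Ne.symm h]

/-- Expansion of a permanent along its first row. The minors are indexed through `Equiv.swap 0 j`,
the convention of `Equiv.Perm.decomposeFin` that `dropLabel` follows. -/
theorem sum_perm_prod_succ {k : ℕ} {α : Type*} (q : α → α → ℝ) (a b : Fin (k + 1) → α) :
    ∑ σ : Equiv.Perm (Fin (k + 1)), ∏ i, q (a i) (b (σ i))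
      = ∑ j, q (a 0) (b j) * ∑ σ : Equiv.Perm (Fin k),
          ∏ i, q (a i.succ) (b (Equiv.swap 0 j (σ i).succ)) := by
  rw [← Equiv.Perm.decomposeFin.symm.sum_comp, Fintype.sum_prod_type]
  refine Finset.sum_congr rfl fun j _ => ?_
  rw [Finset.mul_sum]
  refine Finset.sum_congr rfl fun σ _ => ?_
  rw [Fin.prod_univ_succ, Equiv.Perm.decomposeFin_symm_apply_zero]
  simp only [Equiv.Perm.decomposeFin_symm_apply_succ]

end Prod

/-! ### Orthogonality and duality -/

section Duality

variable {d : ℕ} {J : Measure (Config d × Config d)}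
  {r : Site d → ℝ≥0} {Q : Site d → PMF (Site d)}

/-- The Mecke formula on indicators is an equality of measures, one with density `q.1 x` and the
other an image measure. It therefore transfers to signed `H` with no integrability condition. -/
theorem IsMeckePair.integral_mul (hJ : IsMeckePair J r Q) (x : Site d)
    {H : Config d × Config d → ℝ} (hH : Measurable H) :
    ∫ q, (q.1 x : ℝ) * H q ∂J
      = r x * ∫ u, H (addAt u.1.1 x, addAt u.1.2 u.2) ∂(J.prod (Q x).toMeasure) := by
  have hcast : Measurable fun q : Config d × Config d => (q.1 x : ℝ≥0) :=
    (measurable_of_countable (fun n : ℕ => (n : ℝ≥0))).comp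
      ((measurable_pi_apply x).comp measurable_fst)
  have hmeas : J.withDensity (fun q => ((q.1 x : ℝ≥0) : ℝ≥0∞))
      = (r x) • (J.prod (Q x).toMeasure).map
          (fun u => (addAt u.1.1 x, addAt u.1.2 u.2)) := by
    ext A hA
    have h := hJ x (A.indicator 1) (measurable_one.indicator hA)
    have hA2 : Measurable fun u : (Config d × Config d) × Site d =>
        A.indicator (1 : Config d × Config d → ℝ≥0∞) (addAt u.1.1 x, addAt u.1.2 u.2) :=
      (measurable_one.indicator hA).comp (measurable_addAt_pair x)
    rw [withDensity_apply _ hA, ← lintegral_indicator hA, Measure.smul_apply,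
      Measure.map_apply (measurable_addAt_pair x) hA,
      ← lintegral_indicator_one ((measurable_addAt_pair x) hA)]
    refine Eq.trans (lintegral_congr fun q => ?_) (h.trans ?_)
    · by_cases hq : q ∈ A <;> simp [hq]
    · rw [ENNReal.smul_def, smul_eq_mul]
      congr 1
      exact (lintegral_prod _ hA2.aemeasurable).symm
  calc ∫ q, (q.1 x : ℝ) * H q ∂J
      = ∫ q, H q ∂(J.withDensity (fun q => ((q.1 x : ℝ≥0) : ℝ≥0∞))) := by
        rw [integral_withDensity_eq_integral_smul hcast]
        simp [NNReal.smul_def]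
    _ = _ := by
        rw [hmeas, integral_smul_nnreal_measure,
          integral_map (measurable_addAt_pair x).aemeasurable hH.aestronglyMeasurable]
        simp [NNReal.smul_def]

/-- The covariance of Charlier polynomials of a Mecke pair is a permanent. -/
theorem IsMeckePair.integral_charlierProd_mul [IsProbabilityMeasure J] (hJ : IsMeckePair J r Q) {r' : Site d → ℝ≥0}
    (h1 : ∀ ξ, MemLp (fun q : Config d × Config d => charlierProd r ξ q.1) 2 J)
    (h2 : ∀ ξ, MemLp (fun q : Config d × Config d => charlierProd r' ξ q.2) 2 J)
    {k : ℕ} (a b : Fin k → Site d) :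
    ∫ q, charlierProd r (configOf a) q.1 * charlierProd r' (configOf b) q.2 ∂J
      = (∏ i, (r (a i) : ℝ)) * ∑ σ : Equiv.Perm (Fin k), ∏ i, (Q (a i) (b (σ i))).toReal := by
  induction k with
  | zero => simp [configOf, charlierProd]
  | succ k ih =>
    set x := a 0 with hx
    set a' : Fin k → Site d := fun i => a i.succ with ha'
    set F : Config d → ℝ := charlierProd r (configOf a') with hF
    set G : Config d → ℝ := charlierProd r' (configOf b) with hG
    have hint : ∀ ξ ξ', Integrable (fun q : Config d × Config d =>
        charlierProd r ξ q.1 * charlierProd r' ξ' q.2) J := fun ξ ξ' =>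
      (h1 ξ).integrable_mul (h2 ξ')
    have hFm : Measurable F := measurable_charlierProd _ _
    have hGm : Measurable G := measurable_charlierProd _ _
    -- The raising recurrence isolates the first label `x`. Under the Mecke formula `subAt` is
    -- cancelled by the added particle, so only `G` is evaluated at an enlarged configuration.
    have e1 : ∀ q : Config d × Config d, (q.1 x : ℝ) * (F (subAt q.1 x) * G q.2)
        = charlierProd r (configOf a) q.1 * G q.2 + r x * (F q.1 * G q.2) := by
      intro q
      rw [configOf_succ a, charlierProd_add_single]; ring
    have e2 := hJ.integral_mul x (H := fun q => F (subAt q.1 x) * G q.2)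
      ((hFm.comp ((measurable_subAt x).comp measurable_fst)).mul (hGm.comp measurable_snd))
    simp only [subAt_addAt] at e2
    simp_rw [e1] at e2
    rw [integral_add (hint _ _) ((hint _ _).const_mul _), integral_const_mul] at e2
    have e3 : ∀ u : (Config d × Config d) × Site d, F u.1.1 * G (addAt u.1.2 u.2)
        = F u.1.1 * G u.1.2 * 1 + ∑ j, (F u.1.1 * charlierProd r' (configOf (dropLabel b j)) u.1.2)
            * Set.indicator {b j} (1 : Site d → ℝ) u.2 := by
      intro u
      rw [hG, charlierProd_configOf_addAt, mul_add, Finset.mul_sum, mul_one]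
      simp only [mul_assoc]
    have hind : ∀ j, Integrable (Set.indicator {b j} (1 : Site d → ℝ)) (Q x).toMeasure := fun j =>
      (integrable_const (1 : ℝ)).indicator (measurableSet_singleton _)
    simp_rw [e3] at e2
    rw [integral_add, integral_finsetSum,
      integral_prod_mul (fun q : Config d × Config d => F q.1 * G q.2) (fun _ : Site d => (1 : ℝ))]
      at e2
    · have e4 : ∀ j, ∫ u : (Config d × Config d) × Site d,
          (F u.1.1 * charlierProd r' (configOf (dropLabel b j)) u.1.2)
            * Set.indicator {b j} (1 : Site d → ℝ) u.2 ∂(J.prod (Q x).toMeasure)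
          = ((∏ i, (r (a' i) : ℝ)) * ∑ σ : Equiv.Perm (Fin k),
              ∏ i, (Q (a' i) (dropLabel b j (σ i))).toReal) * (Q x (b j)).toReal := by
        intro j
        rw [integral_prod_mul (fun q : Config d × Config d =>
          F q.1 * charlierProd r' (configOf (dropLabel b j)) q.2), ih]
        congr 1
        rw [integral_indicator_one (measurableSet_singleton _), measureReal_def,
          PMF.toMeasure_apply_singleton _ _ (measurableSet_singleton _)]
      simp_rw [e4] at e2
      rw [sum_perm_prod_succ (fun x y => (Q x y).toReal), Fin.prod_univ_succ]
      simp only [integral_const, probReal_univ, smul_eq_mul, mul_one] at e2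
      -- The term `r x * ∫ F G` arises on both sides, from the raising recurrence and from the
      -- undifferentiated part of `G`, and cancels.
      have e5 : ∫ q, charlierProd r (configOf a) q.1 * G q.2 ∂J
          = r x * ∑ j, ((∏ i, (r (a' i) : ℝ)) * ∑ σ : Equiv.Perm (Fin k),
              ∏ i, (Q (a' i) (dropLabel b j (σ i))).toReal) * (Q x (b j)).toReal := by
        linarith
      rw [e5, mul_assoc]
      congr 1
      rw [Finset.mul_sum]
      refine Finset.sum_congr rfl fun j _ => ?_
      simp only [ha', dropLabel, hx]
      ring
    · exact fun j _ => (hint _ _).mul_prod (hind j)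
    · exact (hint _ _).mul_prod (integrable_const (1 : ℝ))
    · exact integrable_finsetSum _ fun j _ => (hint _ _).mul_prod (hind j)

end Duality

/-! ### Moments of Charlier polynomials -/

theorem integrable_exp_poissonMeasure (c : ℝ≥0) :
    Integrable (fun n : ℕ => Real.exp n) (poissonMeasure c) := by
  rw [integrable_poissonMeasure_iff]
  have := (Real.summable_pow_div_factorial (c * Real.exp 1)).mul_left (Real.exp (-c))
  refine this.congr fun n => ?_
  rw [Real.norm_of_nonneg (Real.exp_nonneg _), mul_pow, ← Real.exp_nat_mul]
  simp; ring

theorem memLp_charlier (c c' : ℝ≥0) (k m : ℕ) (hm : m ≠ 0) :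
    MemLp (charlier c k) m (poissonMeasure c') := by
  have hmeas : AEStronglyMeasurable (charlier c k) (poissonMeasure c') :=
    (measurable_of_countable _).aestronglyMeasurable
  rw [← integrable_norm_rpow_iff hmeas (by exact_mod_cast hm) (by simp)]
  refine ((integrable_exp_poissonMeasure c').const_mul
    (((k * m).factorial : ℝ) * Real.exp c)).mono' (measurable_of_countable _).aestronglyMeasurable
    (ae_of_all _ fun n => ?_)
  have h0 : (0 : ℝ) ≤ c + n := by positivity
  rw [ENNReal.toReal_natCast, Real.rpow_natCast, Real.norm_of_nonneg (by positivity),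
    Real.norm_eq_abs]
  calc |charlier c k n| ^ m ≤ (((c : ℝ) + n) ^ k) ^ m := by gcongr; exact abs_charlier_le c k n
    _ = ((c : ℝ) + n) ^ (k * m) := by rw [pow_mul]
    _ ≤ (k * m).factorial * Real.exp ((c : ℝ) + n) := by
        have := Real.pow_div_factorial_le_exp _ h0 (k * m)
        rwa [div_le_iff₀' (by positivity)] at this
    _ = _ := by rw [Real.exp_add]; ring

/-- Hölder's inequality: with `n` factors, each lying in `L^{2n}`, the product is in `L²`. The empty
product is treated separately. -/
theorem memLp_charlierProd {d : ℕ} (r r' : Site d → ℝ≥0) (ξ : Site d →₀ ℕ) :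
    MemLp (charlierProd r ξ) 2 (poissonField r') := by
  have h : ∀ x ∈ ξ.support, MemLp (fun η : Config d => charlier (r x) (ξ x) (η x))
      ((2 * ξ.support.card : ℕ) : ℝ≥0∞) (poissonField r') := by
    intro x hx
    refine (memLp_charlier (r x) (r' x) (ξ x) _ ?_).comp_measurePreserving
      (measurePreserving_eval_infinitePi (fun x => poissonMeasure (r' x)) x)
    have := Finset.card_pos.2 ⟨x, hx⟩
    omega
  rcases Finset.eq_empty_or_nonempty ξ.support with h0 | h0
  · have : charlierProd r ξ = fun _ => 1 := by ext η; simp [charlierProd, h0]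
    rw [this]; exact memLp_const 1
  · have h2 := MemLp.prod' h
    convert! h2 using 1
    have hc : (ξ.support.card : ℝ≥0∞) ≠ 0 := by exact_mod_cast h0.card_pos.ne'
    rw [Finset.sum_const, nsmul_eq_mul]
    push_cast
    rw [ENNReal.mul_inv (a := 2) (by simp) (by simp), mul_left_comm,
      ENNReal.mul_inv_cancel hc (by simp), mul_one, inv_inv]

/-! ### Stabilisers of labellings, norms and transition probabilities -/

section Stab

variable {d k : ℕ}

/-- The number of permutations of the labels that fix the labelled configuration. -/
def stabCard (x : Fin k → Site d) : ℕ :=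
  Fintype.card {σ : Equiv.Perm (Fin k) // x ∘ σ = x}

/-- The fibres of `σ ↦ x ∘ σ` are cosets of the stabiliser of `x`, hence all of the same size. -/
theorem card_filter_comp_eq (x : Fin k → Site d) (τ : Equiv.Perm (Fin k)) :
    (Finset.univ.filter fun σ : Equiv.Perm (Fin k) => x ∘ σ = x ∘ τ).card = stabCard x := by
  classical
  rw [stabCard, Fintype.card_subtype]
  refine Finset.card_equiv (Equiv.mulRight τ⁻¹) fun σ => ?_
  simp only [Finset.mem_filter, Finset.mem_univ, true_and, Equiv.coe_mulRight, Equiv.Perm.coe_mul,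
    ← Function.comp_assoc]
  constructor
  · intro h
    rw [h, Function.comp_assoc, ← Equiv.Perm.coe_mul]; simp
  · intro h
    have := congrArg (· ∘ τ) h
    simp only [Function.comp_assoc, ← Equiv.Perm.coe_mul] at this
    simpa using this

theorem sum_comp_perm (x : Fin k → Site d) (f : (Fin k → Site d) → ℝ) :
    ∑ σ : Equiv.Perm (Fin k), f (x ∘ σ)
      = stabCard x * ∑ c ∈ Finset.univ.image (fun σ : Equiv.Perm (Fin k) => x ∘ σ), f c := by
  classical
  rw [Finset.sum_comp f (fun σ : Equiv.Perm (Fin k) => x ∘ σ), Finset.mul_sum]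
  refine Finset.sum_congr rfl fun c hc => ?_
  obtain ⟨τ, -, rfl⟩ := Finset.mem_image.1 hc
  rw [card_filter_comp_eq, nsmul_eq_mul]

/-- Orbit–stabiliser for the action of the permutations on labellings. -/
theorem permCount_mul_stabCard (x : Fin k → Site d) :
    permCount x * stabCard x = k.factorial := by
  classical
  have h := sum_comp_perm x (fun _ => 1)
  have h2 : permCount x
      = (Finset.univ.image (fun σ : Equiv.Perm (Fin k) => x ∘ σ)).card := by
    rw [permCount, Nat.card_congr (Setoid.quotientKerEquivRange
      (fun σ : Equiv.Perm (Fin k) => fun i => x (σ i))), Nat.card_coe_set_eq,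
      ← Set.ncard_coe_finset]
    congr 1
    ext c
    simp [Function.comp_def]
  simp only [Finset.sum_const, nsmul_eq_mul, mul_one, Finset.card_univ, Fintype.card_perm,
    Fintype.card_fin] at h
  rw [h2, mul_comm]; exact_mod_cast h.symm

theorem stabCard_shift (x : Fin k → Site d) (z : Site d) :
    stabCard (fun i => z + x i) = stabCard x := by
  unfold stabCard
  refine Fintype.card_congr (Equiv.subtypeEquivRight fun σ => ?_)
  simp [funext_iff]

/-- Version of `IsMeckePair.integral_charlierProd_mul` for a pair of random configurations. -/
theorem integral_charlierProd_mul_of_isMeckePair {Ω : Type*} [MeasurableSpace Ω] {P : Measure Ω}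
    [IsProbabilityMeasure P] {X Y : Ω → Config d} (hX : Measurable X) (hY : Measurable Y)
    {r r' : Site d → ℝ≥0} {Q : Site d → PMF (Site d)}
    (hJ : IsMeckePair (P.map fun ω => (X ω, Y ω)) r Q)
    (h1 : ∀ ξ, MemLp (fun ω => charlierProd r ξ (X ω)) 2 P)
    (h2 : ∀ ξ, MemLp (fun ω => charlierProd r' ξ (Y ω)) 2 P) (a b : Fin k → Site d) :
    ∫ ω, charlierProd r (configOf a) (X ω) * charlierProd r' (configOf b) (Y ω) ∂P
      = (∏ i, (r (a i) : ℝ)) * ∑ σ : Equiv.Perm (Fin k), ∏ i, (Q (a i) (b (σ i))).toReal := by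
  have hpair : Measurable fun ω => (X ω, Y ω) := hX.prodMk hY
  have : IsProbabilityMeasure (P.map fun ω => (X ω, Y ω)) :=
    Measure.isProbabilityMeasure_map hpair.aemeasurable
  have m1 : ∀ r ξ, Measurable fun q : Config d × Config d => charlierProd r ξ q.1 := fun r ξ =>
    (measurable_charlierProd r ξ).comp measurable_fst
  have m2 : ∀ r ξ, Measurable fun q : Config d × Config d => charlierProd r ξ q.2 := fun r ξ =>
    (measurable_charlierProd r ξ).comp measurable_snd
  rw [← hJ.integral_charlierProd_mul (r' := r')
    (fun ξ => (memLp_map_measure_iff (m1 r ξ).aestronglyMeasurable hpair.aemeasurable).2 (h1 ξ))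
    (fun ξ => (memLp_map_measure_iff (m2 r' ξ).aestronglyMeasurable hpair.aemeasurable).2 (h2 ξ))]
  exact (integral_map hpair.aemeasurable
    ((m1 r _).mul (m2 r' _)).aestronglyMeasurable).symm

/-- The diagonal pair of a Poisson field satisfies the Mecke formula without displacement. -/
theorem isMeckePair_diag (r : Site d → ℝ≥0) :
    IsMeckePair ((poissonField r).map fun η => (η, η)) r PMF.pure := by
  intro x H hH
  have hd : Measurable fun η : Config d => (η, η) := measurable_id.prodMk measurable_id
  have hL : Measurable fun q : Config d × Config d => (q.1 x : ℝ≥0∞) * H q :=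
    ((measurable_nat_cast_eval x).comp measurable_fst).mul hH
  have hR := (hH.comp (measurable_addAt_pair x)).lintegral_prod_right'
    (ν := (PMF.pure x).toMeasure)
  simp only [Function.comp] at hR
  rw [lintegral_map hL hd, lintegral_map hR hd,
    mecke_poissonField r x (G := fun η => H (η, η)) (hH.comp hd)]
  congr 1
  refine lintegral_congr fun η => ?_
  rw [PMF.toMeasure_pure, lintegral_dirac]

/-- Take the permanent formula on the diagonal pair: with identity transitions a permutation
contributes `1` exactly when it fixes the labelling. -/
theorem normSq_configOf (r : Site d → ℝ≥0) (x : Fin k → Site d) :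
    normSq r (configOf x) = (∏ i, (r (x i) : ℝ)) * stabCard x := by
  classical
  have h := integral_charlierProd_mul_of_isMeckePair measurable_id measurable_id
    (isMeckePair_diag r) (memLp_charlierProd r r) (memLp_charlierProd r r) x x
  rw [normSq]
  simp_rw [pow_two]
  refine h.trans ?_
  rw [stabCard, Fintype.card_subtype, Finset.card_filter]
  congr 1
  push_cast
  refine Finset.sum_congr rfl fun σ _ => ?_
  split_ifs with hσ
  · refine Finset.prod_eq_one fun i _ => ?_
    rw [PMF.pure_apply, if_pos (show x (σ i) = x i from congrFun hσ i)]; simp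
  · obtain ⟨i, hi⟩ := Function.ne_iff.1 hσ
    refine Finset.prod_eq_zero (Finset.mem_univ i) ?_
    rw [PMF.pure_apply, if_neg (show ¬ x (σ i) = x i from hi)]; simp

/-- The rearrangement count and the stabiliser factor in the norm multiply to `k!`, so the constant
does not depend on `x`. -/
theorem fieldConst_eq (x : Fin k → Site d) (c : ℝ≥0) :
    fieldConst x c = k.factorial * (c : ℝ) ^ k := by
  rw [fieldConst, normSq_configOf, ← permCount_mul_stabCard x]
  push_cast
  simp; ring

variable {p : Site d → PMF (Site d)}

/-- A labelling of the particles of `configOf a`. -/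
theorem exists_labelling (a : Fin k → Site d) :
    ∃ e : Fin k → Site d × ℕ, Function.Injective e ∧ (∀ i, (e i).1 = a i) ∧
      Set.range e = {l | l.2 < configOf a l.1} := by
  have h : ∀ z, Nonempty ({i // a i = z} ≃
      {l : {l : Site d × ℕ // l.2 < configOf a l.1} // l.1.1 = z}) := by
    intro z
    refine ⟨(Fintype.equivFinOfCardEq (configOf_apply a z).symm).trans
      ⟨fun j => ⟨⟨(z, j), j.2⟩, rfl⟩, fun l => ⟨l.1.1.2, by
        have := l.1.2; rwa [l.2] at this⟩, fun j => rfl, ?_⟩⟩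
    rintro ⟨⟨⟨z', j⟩, h1⟩, h2⟩
    simp only at h2
    subst h2
    rfl
  set E := Equiv.ofFiberEquiv (fun z => (h z).some) with hE
  refine ⟨fun i => (E i).1, Subtype.val_injective.comp E.injective,
    fun i => Equiv.ofFiberEquiv_map (fun z => (h z).some) i, ?_⟩
  ext l
  constructor
  · rintro ⟨i, rfl⟩; exact (E i).2
  · intro hl
    exact ⟨E.symm ⟨l, hl⟩, by simp⟩

/-- Reaching `configOf b` is the disjoint union, over the distinct rearrangements `c` of `b`, of the
events that the labelled particles end at `c`. The sum over all permutations counts each such event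
`stabCard b` times. -/
theorem transProb_mul_stabCard (t : ℝ≥0) (a b : Fin k → Site d) :
    transProb p t (configOf a) (configOf b) * stabCard b
      = ∑ σ : Equiv.Perm (Fin k), ∏ i, (walkLaw p t (a i) (b (σ i))).toReal := by
  classical
  obtain ⟨e, he, hea, her⟩ := exists_labelling a
  have hrel : ∀ w : Site d × ℕ → Site d, relocate (configOf a) w = configOf (w ∘ e) := by
    intro w
    ext y
    rw [relocate_apply, configOf_apply, ← Nat.card_eq_fintype_card]
    have : labelsAt (configOf a) w y = e '' {i | w (e i) = y} := by
      ext l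
      have hl : l.2 < configOf a l.1 ↔ l ∈ Set.range e := by rw [her]; rfl
      simp only [labelsAt, Set.mem_ofPred_eq, hl, Set.mem_image, Set.mem_range]
      constructor
      · rintro ⟨⟨i, rfl⟩, h⟩; exact ⟨i, h, rfl⟩
      · rintro ⟨i, h, rfl⟩; exact ⟨⟨i, rfl⟩, h⟩
    rw [this, Set.ncard_image_of_injective _ he]
    rfl
  -- `B c` is the cylinder event that the `i`-th labelled particle moves to `c i`.
  set B : (Fin k → Site d) → Set (Site d × ℕ → Site d) := fun c =>
    Set.pi (Finset.univ.image e : Finset _) fun l => {z | ∀ i, e i = l → z = c i} with hB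
  have hBm : ∀ c w, w ∈ B c ↔ w ∘ e = c := by
    intro c w
    simp only [hB, Set.mem_pi, Finset.coe_image, Finset.coe_univ, Set.image_univ, Set.mem_range,
      Set.mem_ofPred_eq, funext_iff, Function.comp]
    constructor
    · intro h i; exact h (e i) ⟨i, rfl⟩ i rfl
    · rintro h l ⟨j, rfl⟩ i hi; rw [← hi]; exact h i
  have hBP : ∀ c, (destLaw p t).real (B c) = ∏ i, (walkLaw p t (a i) (c i)).toReal := by
    intro c
    rw [measureReal_def, destLaw, Measure.infinitePi_pi _ (fun l _ => .of_discrete),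
      Finset.prod_image he.injOn, ENNReal.toReal_prod]
    refine Finset.prod_congr rfl fun i _ => ?_
    have : {z | ∀ j, e j = e i → z = c j} = {c i} := by
      ext z
      simp only [Set.mem_ofPred_eq, Set.mem_singleton_iff]
      exact ⟨fun h => h i rfl, fun h j hj => by rw [he hj]; exact h⟩
    rw [this, PMF.toMeasure_apply_singleton _ _ (measurableSet_singleton _), hea]
  have hBmeas : ∀ c, MeasurableSet (B c) := fun c =>
    MeasurableSet.pi (Finset.countable_toSet _) fun _ _ => .of_discrete
  have hset : relocate (configOf a) ⁻¹' {⇑(configOf b)}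
      = ⋃ c ∈ Finset.univ.image (fun σ : Equiv.Perm (Fin k) => b ∘ σ), B c := by
    ext w
    simp only [Set.mem_preimage, Set.mem_singleton_iff, hrel, DFunLike.coe_fn_eq, configOf_eq_iff,
      Set.mem_iUnion, hBm, Finset.mem_image, Finset.mem_univ, true_and, exists_prop]
    constructor
    · rintro ⟨σ, h⟩; exact ⟨_, ⟨σ, rfl⟩, h⟩
    · rintro ⟨c, ⟨σ, rfl⟩, h⟩; exact ⟨σ, h⟩
  have htp : transProb p t (configOf a) (configOf b)
      = (destLaw p t).real (relocate (configOf a) ⁻¹' {⇑(configOf b)}) := by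
    change ((destLaw p t).map (relocate ⇑(configOf a))).real {⇑(configOf b)} = _
    rw [map_measureReal_apply (measurable_relocate_right _) (measurableSet_singleton _)]
  rw [htp, hset, measureReal_biUnion_finset _ (fun c _ => hBmeas c),
    mul_comm]
  · simp_rw [hBP]
    exact (sum_comp_perm b (fun c => ∏ i, (walkLaw p t (a i) (c i)).toReal)).symm
  · intro c _ c' _ hne
    refine Set.disjoint_left.2 fun w h1 h2 => hne ?_
    rw [← (hBm c w).1 h1, (hBm c' w).1 h2]

/-- The two stabiliser factors cancel, which identifies the summand of the exact covariance formula
with the permanent produced by duality. -/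
theorem normSq_mul_transProb (r : Site d → ℝ≥0) (t : ℝ≥0) (a b : Fin k → Site d) :
    normSq r (configOf b) * transProb p t (configOf a) (configOf b)
      = (∏ i, (r (b i) : ℝ)) *
        ∑ σ : Equiv.Perm (Fin k), ∏ i, (walkLaw p t (a i) (b (σ i))).toReal := by
  rw [normSq_configOf, ← transProb_mul_stabCard]; ring

end Stab

/-! ### Two-time moments of Charlier polynomials along the process -/

section Covariance

variable {d k : ℕ} {p : Site d → PMF (Site d)} {Ω : Type*} [MeasurableSpace Ω] {P : Measure Ω}
  [IsProbabilityMeasure P] {η : ℝ≥0 → Ω → Config d} {r : Site d → ℝ≥0} {C : ℝ≥0}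

theorem IsIRW.memLp_charlierProd (hp : IsJumpKernel p) (hr : ∀ x, r x ≤ C)
    (h : IsIRW p (poissonField r) P η) (t : ℝ≥0) (r' : Site d → ℝ≥0) (ξ : Site d →₀ ℕ) :
    MemLp (fun ω => charlierProd r' ξ (η t ω)) 2 P := by
  have h1 := IRW.memLp_charlierProd r' (evolve p t r) ξ
  rw [← h.map_eq hp hr t] at h1
  exact h1.comp_of_map (h.measurable t).aemeasurable

theorem IsIRW.integral_sq (hp : IsJumpKernel p) (hr : ∀ x, r x ≤ C)
    (h : IsIRW p (poissonField r) P η) (t : ℝ≥0) (x : Fin k → Site d) :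
    ∫ ω, charlierProd (evolve p t r) (configOf x) (η t ω) ^ 2 ∂P
      = (∏ i, (evolve p t r (x i) : ℝ)) * stabCard x := by
  rw [← normSq_configOf, normSq, ← h.map_eq hp hr t,
    integral_map (h.measurable t).aemeasurable
      ((measurable_charlierProd _ _).pow_const 2).aestronglyMeasurable]

theorem IsIRW.integral_mul (hp : IsJumpKernel p) (hr : ∀ x, r x ≤ C)
    (h : IsIRW p (poissonField r) P η) {s t : ℝ≥0} (hst : s ≤ t) (a b : Fin k → Site d) :
    ∫ ω, charlierProd (evolve p t r) (configOf a) (η t ω)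
        * charlierProd (evolve p s r) (configOf b) (η s ω) ∂P
      = (∏ i, (evolve p s r (b i) : ℝ)) *
        ∑ σ : Equiv.Perm (Fin k), ∏ i, (walkLaw p (t - s) (a i) (b (σ i))).toReal := by
  have key := integral_charlierProd_mul_of_isMeckePair (h.measurable s) (h.measurable t)
    (h.isMeckePair hp hr hst) (h.memLp_charlierProd hp hr s _)
    (h.memLp_charlierProd hp hr t (evolve p t r)) b a
  simp_rw [mul_comm (charlierProd (evolve p t r) (configOf a) _)]
  rw [key]
  congr 1
  -- Duality runs from time `s` to time `t`, hence from `b` to `a`; inverting the permutation and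
  -- using symmetry of the walk reverses the direction.
  rw [← Equiv.sum_comp (Equiv.inv _)]
  refine Finset.sum_congr rfl fun σ _ => ?_
  rw [← Equiv.prod_comp σ]
  refine Finset.prod_congr rfl fun i _ => ?_
  rw [walkLaw_symm hp]; simp

end Covariance

/-! ### Lattice sums as integrals -/

section Cells

variable {d : ℕ}

/-- The lattice site whose cell of side `1 / N` contains the macroscopic point `u`. -/
noncomputable def cell (N : ℕ) (u : Space d) : Site d := fun i => ⌊(N : ℝ) * u i⌋

theorem measurable_cell (N : ℕ) : Measurable (cell (d := d) N) := by
  unfold cell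
  refine measurable_pi_lambda _ fun i => Int.measurable_floor.comp ?_
  fun_prop

theorem volume_cell_preimage {N : ℕ} (hN : 1 ≤ N) (z : Site d) :
    (volume : Measure (Space d)) (cell N ⁻¹' {z}) = ((N : ℝ≥0∞) ^ d)⁻¹ := by
  have hN' : (0 : ℝ) < N := by exact_mod_cast hN
  have : cell N ⁻¹' {z} = (WithLp.ofLp : Space d → (Fin d → ℝ)) ⁻¹'
      (Set.univ.pi fun i => Set.Ico ((z i : ℝ) / N) (((z i : ℝ) + 1) / N)) := by
    ext u
    simp only [cell, Set.mem_preimage, Set.mem_singleton_iff, funext_iff, Int.floor_eq_iff,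
      Set.mem_pi, Set.mem_univ, true_imp_iff, Set.mem_Ico]
    refine forall_congr' fun i => ?_
    rw [div_le_iff₀' hN', lt_div_iff₀' hN']
  rw [this, (PiLp.volume_preserving_ofLp (Fin d)).measure_preimage
    (MeasurableSet.univ_pi fun i => measurableSet_Ico).nullMeasurableSet, Real.volume_pi_Ico]
  have h2 : ∀ i : Fin d, ENNReal.ofReal (((z i : ℝ) + 1) / N - (z i : ℝ) / N)
      = (N : ℝ≥0∞)⁻¹ := by
    intro i
    rw [← sub_div, add_sub_cancel_left, one_div, ENNReal.ofReal_inv_of_pos hN',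
      ENNReal.ofReal_natCast]
  simp_rw [h2]
  simp [ENNReal.inv_pow]

/-- Every cell has volume `N^{-d}`, so a lattice sum is `N^d` times the integral of the
corresponding step function. -/
theorem map_cell {N : ℕ} (hN : 1 ≤ N) :
    (volume : Measure (Space d)).map (cell N) = ((N : ℝ≥0∞) ^ d)⁻¹ • Measure.count := by
  refine Measure.ext_of_singleton fun z => ?_
  rw [Measure.map_apply (measurable_cell N) (measurableSet_singleton z), volume_cell_preimage hN]
  simp

theorem map_cell_prod {N : ℕ} (hN : 1 ≤ N) :
    (volume : Measure (Space d × Space d)).map (Prod.map (cell N) (cell N))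
      = (((N : ℝ≥0∞) ^ d)⁻¹ * ((N : ℝ≥0∞) ^ d)⁻¹) • Measure.count := by
  refine Measure.ext_of_singleton fun z => ?_
  rw [Measure.map_apply ((measurable_cell N).prodMap (measurable_cell N))
    (measurableSet_singleton z)]
  have : Prod.map (cell N) (cell N) ⁻¹' {z}
      = (cell (d := d) N ⁻¹' {z.1}) ×ˢ (cell N ⁻¹' {z.2}) := by
    ext q; simp [Prod.ext_iff]
  rw [this, Measure.volume_eq_prod, Measure.prod_prod, volume_cell_preimage hN,
    volume_cell_preimage hN]
  simp

theorem integrable_comp_iff_summable {X ι : Type*} [MeasurableSpace X] {μ : Measure X}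
    [MeasurableSpace ι] [Countable ι] [MeasurableSingletonClass ι] {T : X → ι}
    (hT : Measurable T) {c : ℝ≥0∞} (hc : c ≠ 0) (hc' : c ≠ ∞) (h : μ.map T = c • Measure.count)
    (f : ι → ℝ) : Integrable (fun x => f (T x)) μ ↔ Summable f := by
  rw [← Function.comp_def, ← integrable_map_measure (measurable_of_countable f).aestronglyMeasurable
    hT.aemeasurable, h, integrable_smul_measure hc hc', integrable_count_iff, summable_norm_iff]

theorem integral_comp_eq_tsum {X ι : Type*} [MeasurableSpace X] {μ : Measure X}
    [MeasurableSpace ι] [Countable ι] [MeasurableSingletonClass ι] {T : X → ι}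
    (hT : Measurable T) {c : ℝ≥0∞} (h : μ.map T = c • Measure.count)
    {f : ι → ℝ} (hf : Summable f) : ∫ x, f (T x) ∂μ = c.toReal * ∑' i, f i := by
  rw [← integral_map hT.aemeasurable (measurable_of_countable f).aestronglyMeasurable, h,
    integral_smul_measure, integral_countable (integrable_count_iff.2 hf.norm)]
  simp [measureReal_def]

theorem norm_scaledSite_cell_sub_le {N : ℕ} (hN : 1 ≤ N) (u : Space d) :
    ‖scaledSite N (cell N u) - u‖ ≤ Real.sqrt d / N := by
  have hN' : (0 : ℝ) < N := by exact_mod_cast hN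
  rw [EuclideanSpace.norm_eq]
  have h : ∀ i, ‖(scaledSite N (cell N u) - u) i‖ ^ 2 ≤ (1 / (N : ℝ)) ^ 2 := by
    intro i
    have e : (scaledSite N (cell N u) - u) i = -(Int.fract ((N : ℝ) * u i) / N) := by
      simp only [scaledSite, cell, PiLp.sub_apply, Int.fract]
      field_simp
      ring
    rw [e, norm_neg, Real.norm_of_nonneg (div_nonneg (Int.fract_nonneg _) hN'.le)]
    gcongr
    exact (Int.fract_lt_one _).le
  calc Real.sqrt (∑ i, ‖(scaledSite N (cell N u) - u) i‖ ^ 2)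
      ≤ Real.sqrt (∑ _i : Fin d, (1 / (N : ℝ)) ^ 2) :=
        Real.sqrt_le_sqrt (Finset.sum_le_sum fun i _ => h i)
    _ = Real.sqrt d / N := by
        rw [Finset.sum_const, nsmul_eq_mul, Finset.card_univ, Fintype.card_fin,
          Real.sqrt_mul (by positivity), Real.sqrt_sq (by positivity)]
        ring

theorem tendsto_scaledSite_cell (u : Space d) :
    Tendsto (fun N : ℕ => scaledSite N (cell N u)) atTop (𝓝 u) := by
  rw [tendsto_iff_norm_sub_tendsto_zero]
  refine squeeze_zero' (Eventually.of_forall fun _ => norm_nonneg _)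
    ((eventually_ge_atTop 1).mono fun N hN => norm_scaledSite_cell_sub_le hN u) ?_
  exact tendsto_const_nhds.div_atTop tendsto_natCast_atTop_atTop

/-- Schwartz functions sampled on the lattice are dominated uniformly in the mesh. -/
theorem exists_schwartz_cell_bound (φ : 𝓢(Space d, ℝ)) :
    ∃ K : ℝ, 0 ≤ K ∧ ∀ N : ℕ, 1 ≤ N → ∀ u : Space d,
      |φ (scaledSite N (cell N u))| ≤ K * (1 + ‖u‖) ^ (-((d : ℝ) + 1)) := by
  set S : ℝ := 2 ^ (d + 1) * (Finset.Iic (d + 1, 0)).sup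
    (fun m => SchwartzMap.seminorm ℝ m.1 m.2) φ with hS
  have hS0 : 0 ≤ S := by positivity
  have hφ : ∀ w, (1 + ‖w‖) ^ (d + 1) * |φ w| ≤ S := by
    intro w
    have := SchwartzMap.one_add_le_sup_seminorm_apply (𝕜 := ℝ) (m := (d + 1, 0)) (k := d + 1)
      (n := 0) le_rfl le_rfl φ w
    rwa [norm_iteratedFDeriv_zero] at this
  refine ⟨S * (1 + Real.sqrt d) ^ (d + 1), by positivity, fun N hN u => ?_⟩
  set w := scaledSite N (cell N u) with hw
  -- Passing from `u` to the corner of its cell moves it by at most `√d` for every `N ≥ 1`, so the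
  -- decay weights at the two points are comparable uniformly in `N`.
  have h1 : 1 + ‖u‖ ≤ (1 + Real.sqrt d) * (1 + ‖w‖) := by
    have h2 : ‖w - u‖ ≤ Real.sqrt d := (norm_scaledSite_cell_sub_le hN u).trans
      (div_le_self (Real.sqrt_nonneg _) (by exact_mod_cast hN))
    have h3 : ‖u‖ ≤ ‖w‖ + ‖w - u‖ := by
      have := norm_sub_le w (w - u); simpa using this
    nlinarith [Real.sqrt_nonneg (d : ℝ), norm_nonneg w]
  have hu : 0 < 1 + ‖u‖ := by positivity
  have hpow : (1 + ‖u‖) ^ (-((d : ℝ) + 1)) = ((1 + ‖u‖) ^ (d + 1))⁻¹ := by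
    rw [Real.rpow_neg hu.le]
    congr 1
    rw [← Real.rpow_natCast]; push_cast; rfl
  rw [hpow, ← div_eq_mul_inv, le_div_iff₀ (by positivity)]
  calc |φ w| * (1 + ‖u‖) ^ (d + 1)
      ≤ |φ w| * ((1 + Real.sqrt d) * (1 + ‖w‖)) ^ (d + 1) := by gcongr
    _ = ((1 + ‖w‖) ^ (d + 1) * |φ w|) * (1 + Real.sqrt d) ^ (d + 1) := by rw [mul_pow]; ring
    _ ≤ S * (1 + Real.sqrt d) ^ (d + 1) := by gcongr; exact hφ w

theorem integrable_japanese :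
    Integrable fun u : Space d => (1 + ‖u‖) ^ (-((d : ℝ) + 1)) :=
  integrable_one_add_norm (by simp)

theorem summable_schwartz_lattice (φ : 𝓢(Space d, ℝ)) {N : ℕ} (hN : 1 ≤ N) :
    Summable fun z : Site d => |φ (scaledSite N z)| := by
  obtain ⟨K, -, hK⟩ := exists_schwartz_cell_bound φ
  have hN0 : (N : ℝ≥0∞) ≠ 0 := by exact_mod_cast (by omega : N ≠ 0)
  refine (integrable_comp_iff_summable (measurable_cell N) (by simp)
    (by simp [hN0]) (map_cell hN) _).1 ?_
  refine (integrable_japanese.const_mul K).mono'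
    ((measurable_of_countable fun z : Site d => |φ (scaledSite N z)|).comp
      (measurable_cell N)).aestronglyMeasurable (ae_of_all _ fun u => ?_)
  rw [Real.norm_of_nonneg (abs_nonneg _)]
  exact hK N hN u

end Cells

/-! ### Series in `L²` -/

section Series

variable {Ω ι : Type*} [MeasurableSpace Ω] {P : Measure Ω} {T S : ι → Ω → ℝ}
  {A B : ι → ℝ}

theorem eLpNorm_two_le_of_integral_sq_le {f : Ω → ℝ} (hf : MemLp f 2 P) {a : ℝ} (ha : 0 ≤ a)
    (h : ∫ ω, f ω ^ 2 ∂P ≤ a ^ 2) : eLpNorm f 2 P ≤ ENNReal.ofReal a := by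
  rw [hf.eLpNorm_eq_integral_rpow_norm (by simp) (by simp)]
  refine ENNReal.ofReal_le_ofReal ?_
  have e : ∫ ω, ‖f ω‖ ^ (2 : ℝ≥0∞).toReal ∂P = ∫ ω, f ω ^ 2 ∂P := by
    simp
  rw [e, ENNReal.toReal_ofNat, ← one_div, ← Real.sqrt_eq_rpow]
  exact Real.sqrt_le_iff.2 ⟨ha, h⟩

theorem integral_norm_mul_le {f g : Ω → ℝ} (hf : MemLp f 2 P) (hg : MemLp g 2 P) {a b : ℝ}
    (ha : 0 ≤ a) (hb : 0 ≤ b) (h : ∫ ω, f ω ^ 2 ∂P ≤ a ^ 2) (h' : ∫ ω, g ω ^ 2 ∂P ≤ b ^ 2) :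
    ∫ ω, ‖f ω * g ω‖ ∂P ≤ a * b := by
  have key := integral_mul_norm_le_Lp_mul_Lq (μ := P) Real.HolderConjugate.two_two
    (f := f) (g := g) (by simpa using hf) (by simpa using hg)
  simp only [Real.rpow_two, Real.norm_eq_abs, sq_abs, ← Real.sqrt_eq_rpow] at key
  simp only [norm_mul, Real.norm_eq_abs]
  refine key.trans (mul_le_mul ?_ ?_ (Real.sqrt_nonneg _) ha)
  · exact Real.sqrt_le_iff.2 ⟨ha, h⟩
  · exact Real.sqrt_le_iff.2 ⟨hb, h'⟩

theorem tsum_eLpNorm_ne_top (hT : ∀ z, MemLp (T z) 2 P) (hA0 : ∀ z, 0 ≤ A z) (hA : Summable A)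
    (hTA : ∀ z, ∫ ω, T z ω ^ 2 ∂P ≤ A z ^ 2) : ∑' z, eLpNorm (T z) 2 P ≠ ∞ := by
  refine ne_top_of_le_ne_top ?_ (ENNReal.tsum_le_tsum fun z =>
    eLpNorm_two_le_of_integral_sq_le (hT z) (hA0 z) (hTA z))
  rw [← ENNReal.ofReal_tsum_of_nonneg hA0 hA]
  simp

theorem ae_summable_of_integral_sq_le [Countable ι] (hT : ∀ z, MemLp (T z) 2 P) (hA0 : ∀ z, 0 ≤ A z)
    (hA : Summable A) (hTA : ∀ z, ∫ ω, T z ω ^ 2 ∂P ≤ A z ^ 2) :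
    ∀ᵐ ω ∂P, Summable fun z => T z ω := by
  filter_upwards [summable_norm_of_tsum_eLpNorm_ne_top (by simp) (fun z => (hT z).1)
    (tsum_eLpNorm_ne_top hT hA0 hA hTA)] with ω hω
  exact hω.of_norm

theorem memLp_tsum_of_integral_sq_le [Countable ι] (hT : ∀ z, MemLp (T z) 2 P) (hA0 : ∀ z, 0 ≤ A z)
    (hA : Summable A) (hTA : ∀ z, ∫ ω, T z ω ^ 2 ∂P ≤ A z ^ 2) :
    MemLp (fun ω => ∑' z, T z ω) 2 P := by
  have h := Lp.hasSum_coeFn_tsum (f := fun z => (hT z).toLp (T z)) (by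
    simpa [Lp.enorm_toLp] using tsum_eLpNorm_ne_top hT hA0 hA hTA)
  refine (Lp.memLp (∑' z, (hT z).toLp (T z))).ae_eq ?_
  filter_upwards [h, ae_all_iff.2 fun z => (hT z).coeFn_toLp] with ω h1 h2
  rw [← h1.tsum_eq]
  exact tsum_congr h2

/-- Cauchy–Schwarz bounds the L¹ norm of each product by `A z * B z'`, which is summable over pairs;
this justifies exchanging sum and integral. -/
theorem hasSum_integral_tsum_mul_tsum [Countable ι] (hT : ∀ z, MemLp (T z) 2 P) (hA0 : ∀ z, 0 ≤ A z)
    (hA : Summable A) (hTA : ∀ z, ∫ ω, T z ω ^ 2 ∂P ≤ A z ^ 2) (hS : ∀ z, MemLp (S z) 2 P)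
    (hB0 : ∀ z, 0 ≤ B z) (hB : Summable B) (hSB : ∀ z, ∫ ω, S z ω ^ 2 ∂P ≤ B z ^ 2) :
    HasSum (fun q : ι × ι => ∫ ω, T q.1 ω * S q.2 ω ∂P)
      (∫ ω, (∑' z, T z ω) * ∑' z, S z ω ∂P) := by
  have h := hasSum_integral_of_summable_integral_norm (μ := P)
    (F := fun (q : ι × ι) ω => T q.1 ω * S q.2 ω) (fun q => (hT q.1).integrable_mul (hS q.2))
    (Summable.of_nonneg_of_le (fun q => integral_nonneg fun ω => norm_nonneg _)
      (fun q => integral_norm_mul_le (hT q.1) (hS q.2) (hA0 _) (hB0 _) (hTA _) (hSB _))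
      (hA.mul_of_nonneg hB hA0 hB0))
  have e : ∫ ω, (∑' z, T z ω) * ∑' z, S z ω ∂P
      = ∫ ω, ∑' q : ι × ι, T q.1 ω * S q.2 ω ∂P := by
    refine integral_congr_ae ?_
    filter_upwards [ae_summable_of_integral_sq_le hT hA0 hA hTA,
      ae_summable_of_integral_sq_le hS hB0 hB hSB] with ω h1 h2
    exact tsum_mul_tsum_of_summable_norm h1.norm h2.norm
  rw [e]
  exact h

end Series

/-! ### The fields -/

section Field

theorem latticeProfile_le {d : ℕ} {ρ : Space d → ℝ≥0} {C : ℝ≥0} (hC : ∀ u, ρ u ≤ C) (N : ℕ)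
    (z : Site d) : latticeProfile ρ N z ≤ C := hC _

variable {d k : ℕ} {p : Site d → PMF (Site d)} {ρ : Space d → ℝ≥0} {C : ℝ≥0}
  {φ : 𝓢(Space d, ℝ)} {x : Fin k → Site d} {N : ℕ} {Ω : Type*} [MeasurableSpace Ω]
  {P : Measure Ω} [IsProbabilityMeasure P] {η : ℝ≥0 → Ω → Config d}

theorem memLp_fieldTerm (hp : IsJumpKernel p) (hC : ∀ u, ρ u ≤ C)
    (h : IsIRW p (poissonField (latticeProfile ρ N)) P η) (t : ℝ≥0) (z : Site d) :
    MemLp (fun ω => fieldTerm p ρ φ x N t (η ((N : ℝ≥0) ^ 2 * t) ω) z) 2 P :=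
  (h.memLp_charlierProd hp (latticeProfile_le hC N) _ _ _).const_mul _

/-- The stabiliser is translation invariant and the evolved density never exceeds `C`, so apart from
the test function the bound does not depend on `z`. -/
theorem integral_fieldTerm_sq_le (hp : IsJumpKernel p) (hC : ∀ u, ρ u ≤ C)
    (h : IsIRW p (poissonField (latticeProfile ρ N)) P η) (t : ℝ≥0) (z : Site d) :
    ∫ ω, fieldTerm p ρ φ x N t (η ((N : ℝ≥0) ^ 2 * t) ω) z ^ 2 ∂P
      ≤ (|φ (scaledSite N z)| * Real.sqrt ((C : ℝ) ^ k * stabCard x)) ^ 2 := by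
  simp only [fieldTerm, mul_pow, sq_abs]
  rw [integral_const_mul, Real.sq_sqrt (by positivity), shiftedConfig,
    h.integral_sq hp (latticeProfile_le hC N), stabCard_shift]
  gcongr
  calc ∏ i : Fin k, (evolve p ((N : ℝ≥0) ^ 2 * t) (latticeProfile ρ N) (z + x i) : ℝ)
      ≤ ∏ _i : Fin k, (C : ℝ) := Finset.prod_le_prod (fun _ _ => NNReal.coe_nonneg _)
        fun i _ => NNReal.coe_le_coe.2 (evolve_le _ (latticeProfile_le hC N) _)
    _ = (C : ℝ) ^ k := by simp

theorem field_summable_memLp (hp : IsJumpKernel p) (hC : ∀ u, ρ u ≤ C) (hN : 1 ≤ N)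
    (h : IsIRW p (poissonField (latticeProfile ρ N)) P η) (t : ℝ≥0) :
    (∀ᵐ ω ∂P, Summable (fieldTerm p ρ φ x N t (η ((N : ℝ≥0) ^ 2 * t) ω))) ∧
      MemLp (field p ρ φ x N η t) 2 P :=
  ⟨ae_summable_of_integral_sq_le (memLp_fieldTerm hp hC h t) (fun _ => by positivity)
      ((summable_schwartz_lattice φ hN).mul_right _) (integral_fieldTerm_sq_le hp hC h t),
    memLp_tsum_of_integral_sq_le (memLp_fieldTerm hp hC h t) (fun _ => by positivity)
      ((summable_schwartz_lattice φ hN).mul_right _) (integral_fieldTerm_sq_le hp hC h t)⟩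

/-- The two-time covariance of the fields. -/
theorem hasSum_integral_field_mul (hp : IsJumpKernel p) (hC : ∀ u, ρ u ≤ C) (hN : 1 ≤ N)
    (h : IsIRW p (poissonField (latticeProfile ρ N)) P η) {s t : ℝ≥0} (hst : s ≤ t) :
    HasSum (fun q : Site d × Site d => φ (scaledSite N q.1) * φ (scaledSite N q.2) *
        ((∏ i, (evolve p ((N : ℝ≥0) ^ 2 * s) (latticeProfile ρ N) (q.2 + x i) : ℝ)) *
          ∑ σ : Equiv.Perm (Fin k), ∏ i,
            (walkLaw p ((N : ℝ≥0) ^ 2 * (t - s)) (q.1 + x i) (q.2 + x (σ i))).toReal))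
      (∫ ω, field p ρ φ x N η t ω * field p ρ φ x N η s ω ∂P) := by
  have key := hasSum_integral_tsum_mul_tsum (memLp_fieldTerm (φ := φ) (x := x) hp hC h t)
    (fun _ => by positivity)
    ((summable_schwartz_lattice φ hN).mul_right _) (integral_fieldTerm_sq_le hp hC h t)
    (memLp_fieldTerm (φ := φ) (x := x) hp hC h s) (fun _ => by positivity)
    ((summable_schwartz_lattice φ hN).mul_right _) (integral_fieldTerm_sq_le hp hC h s)
  refine Eq.mp (congrArg (fun f => HasSum f _) (funext fun q => ?_)) key
  have h2 := h.integral_mul hp (latticeProfile_le hC N) (mul_le_mul_right hst ((N : ℝ≥0) ^ 2))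
    (fun i => q.1 + x i) (fun i => q.2 + x i)
  rw [← mul_tsub] at h2
  rw [← h2, ← integral_const_mul]
  refine integral_congr_ae (ae_of_all _ fun ω => ?_)
  simp only [fieldTerm, shiftedConfig]
  ring

end Field

/-! ### The characteristic function of a jump -/

section CharFun

variable {d : ℕ} {p : Site d → PMF (Site d)}

/-- The pairing of a frequency with a lattice site. -/
def pair (θ : Fin d → ℝ) (z : Site d) : ℝ := ∑ i, θ i * (z i : ℝ)

theorem pair_add (θ : Fin d → ℝ) (y z : Site d) : pair θ (y + z) = pair θ y + pair θ z := by
  simp [pair, mul_add, Finset.sum_add_distrib]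

theorem pair_neg (θ : Fin d → ℝ) (z : Site d) : pair θ (-z) = -pair θ z := by
  simp [pair]

theorem pair_sub (θ : Fin d → ℝ) (y z : Site d) : pair θ (y - z) = pair θ y - pair θ z := by
  rw [sub_eq_add_neg, pair_add, pair_neg, sub_eq_add_neg]

theorem pair_smul (c : ℝ) (θ : Fin d → ℝ) (z : Site d) : pair (c • θ) z = c * pair θ z := by
  simp [pair, Finset.mul_sum, mul_assoc]

theorem continuous_pair (z : Site d) : Continuous fun θ : Fin d → ℝ => pair θ z := by
  unfold pair; fun_prop

/-- The characteristic function of a single jump. -/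
noncomputable def jumpChar (p : Site d → PMF (Site d)) (θ : Fin d → ℝ) : ℝ :=
  ∑' z, (p 0 z).toReal * Real.cos (pair θ z)

theorem IsJumpKernel.exists_support (hp : IsJumpKernel p) :
    ∃ s : Finset (Site d), (∀ z ∉ s, p 0 z = 0) ∧ ∀ z ∈ s, -z ∈ s := by
  obtain ⟨R, hR, h⟩ := hp.finite_range
  refine ⟨Finset.Icc (fun _ => -⌈R⌉) (fun _ => ⌈R⌉), fun z hz => ?_, fun z hz => ?_⟩
  · refine h 0 z ?_
    by_contra hle
    push Not at hle
    refine hz (Finset.mem_Icc.2 ?_)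
    have h1 : ∀ i, |z i| ≤ ⌈R⌉ := by
      intro i
      have h2 : ‖z i‖ ≤ R := (norm_le_pi_norm z i).trans (by simpa using hle)
      rw [Int.norm_eq_abs] at h2
      have := h2.trans (Int.le_ceil R)
      exact_mod_cast this
    exact ⟨fun i => (abs_le.1 (h1 i)).1, fun i => (abs_le.1 (h1 i)).2⟩
  · rw [Finset.mem_Icc] at hz ⊢
    exact ⟨fun i => by have : z i ≤ ⌈R⌉ := hz.2 i; simp only [Pi.neg_apply]; omega,
      fun i => by have : -⌈R⌉ ≤ z i := hz.1 i; simp only [Pi.neg_apply]; omega⟩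

theorem sum_jump_eq_one {s : Finset (Site d)} (hs : ∀ z ∉ s, p 0 z = 0) :
    ∑ z ∈ s, (p 0 z).toReal = 1 := by
  have h := PMF.tsum_coe (p 0)
  rw [tsum_eq_sum (s := s) hs] at h
  rw [← ENNReal.toReal_sum (fun z _ => PMF.apply_ne_top _ _), h, ENNReal.toReal_one]

theorem jumpChar_eq_sum {s : Finset (Site d)} (hs : ∀ z ∉ s, p 0 z = 0) (θ : Fin d → ℝ) :
    jumpChar p θ = ∑ z ∈ s, (p 0 z).toReal * Real.cos (pair θ z) :=
  tsum_eq_sum fun z hz => by simp [hs z hz]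

theorem one_sub_jumpChar {s : Finset (Site d)} (hs : ∀ z ∉ s, p 0 z = 0) (θ : Fin d → ℝ) :
    1 - jumpChar p θ = ∑ z ∈ s, (p 0 z).toReal * (1 - Real.cos (pair θ z)) := by
  rw [jumpChar_eq_sum hs]
  simp_rw [mul_sub, mul_one, Finset.sum_sub_distrib, sum_jump_eq_one hs]

theorem abs_jumpChar_le_one (hp : IsJumpKernel p) (θ : Fin d → ℝ) : |jumpChar p θ| ≤ 1 := by
  obtain ⟨s, hs, -⟩ := hp.exists_support
  rw [jumpChar_eq_sum hs]
  refine (Finset.abs_sum_le_sum_abs _ _).trans ?_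
  rw [← sum_jump_eq_one hs]
  refine Finset.sum_le_sum fun z _ => ?_
  rw [abs_mul, abs_of_nonneg ENNReal.toReal_nonneg]
  exact mul_le_of_le_one_right ENNReal.toReal_nonneg (Real.abs_cos_le_one _)

theorem continuous_jumpChar (hp : IsJumpKernel p) : Continuous (jumpChar p) := by
  obtain ⟨s, hs, -⟩ := hp.exists_support
  rw [funext (jumpChar_eq_sum hs)]
  exact continuous_finsetSum _ fun z _ =>
    continuous_const.mul (Real.continuous_cos.comp (continuous_pair z))

/-- Symmetry of `p` kills the sine part, so cosines are eigenfunctions of convolution with the jump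
law. -/
theorem sum_jump_mul_cos_sub (hp : IsJumpKernel p) {s : Finset (Site d)}
    (hs : ∀ z ∉ s, p 0 z = 0) (hs' : ∀ z ∈ s, -z ∈ s) (θ : Fin d → ℝ) (z : Site d) :
    ∑ y ∈ s, (p 0 y).toReal * Real.cos (pair θ (z - y)) = jumpChar p θ * Real.cos (pair θ z) := by
  have hsin : ∑ y ∈ s, (p 0 y).toReal * Real.sin (pair θ y) = 0 := by
    have h1 : ∑ y ∈ s, (p 0 y).toReal * Real.sin (pair θ y)
        = ∑ y ∈ s, (p 0 (-y)).toReal * Real.sin (pair θ (-y)) :=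
      Finset.sum_nbij' (fun y => -y) (fun y => -y) hs' hs' (by simp) (by simp) (by simp)
    have h2 : ∀ y, (p 0 (-y)).toReal * Real.sin (pair θ (-y))
        = -((p 0 y).toReal * Real.sin (pair θ y)) := by
      intro y
      rw [pair_neg, Real.sin_neg, ← hp.neg 0 (-y), neg_zero, neg_neg]; ring
    simp_rw [h2, Finset.sum_neg_distrib] at h1
    linarith
  have : ∀ y, (p 0 y).toReal * Real.cos (pair θ (z - y))
      = ((p 0 y).toReal * Real.cos (pair θ y)) * Real.cos (pair θ z)
        + ((p 0 y).toReal * Real.sin (pair θ y)) * Real.sin (pair θ z) := by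
    intro y; rw [pair_sub, Real.cos_sub]; ring
  simp_rw [this, Finset.sum_add_distrib, ← Finset.sum_mul, hsin, ← jumpChar_eq_sum hs]
  ring

/-- With `1 - cos x = 2 sin²(x/2)` this is `|sin(u + v)| ≤ |sin u| + |sin v|` combined with `(u +
v)² ≤ 2u² + 2v²`. -/
theorem one_sub_cos_add_le (a b : ℝ) :
    1 - Real.cos (a + b) ≤ 2 * (1 - Real.cos a) + 2 * (1 - Real.cos b) := by
  have h : ∀ x : ℝ, 1 - Real.cos x = 2 * Real.sin (x / 2) ^ 2 := by
    intro x
    have := Real.cos_sq' (x / 2)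
    have h2 := Real.cos_two_mul (x / 2)
    rw [mul_div_cancel₀ x two_ne_zero] at h2
    nlinarith
  rw [h, h a, h b, add_div, Real.sin_add]
  have h1 := Real.sin_sq_add_cos_sq (a / 2)
  have h2 := Real.sin_sq_add_cos_sq (b / 2)
  nlinarith [sq_nonneg (Real.sin (a / 2) * Real.cos (b / 2) - Real.cos (a / 2) * Real.sin (b / 2)),
    sq_nonneg (Real.sin (a / 2) * Real.sin (b / 2))]

/-- Irreducibility controls every lattice direction by the characteristic function. -/
theorem IsJumpKernel.exists_one_sub_cos_le (hp : IsJumpKernel p) (y : Site d) :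
    ∃ C : ℝ, 0 ≤ C ∧ ∀ θ, 1 - Real.cos (pair θ y) ≤ C * (1 - jumpChar p θ) := by
  obtain ⟨s, hs, -⟩ := hp.exists_support
  have hnn : ∀ θ, 0 ≤ 1 - jumpChar p θ := fun θ => by
    have := (abs_le.1 (abs_jumpChar_le_one hp θ)).2; linarith
  have hstep : ∀ z, 0 < p 0 z → ∀ θ, 1 - Real.cos (pair θ z)
      ≤ ((p 0 z).toReal)⁻¹ * (1 - jumpChar p θ) := by
    intro z hz θ
    have hz' : 0 < (p 0 z).toReal := ENNReal.toReal_pos hz.ne' (PMF.apply_ne_top _ _)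
    rw [← div_eq_inv_mul, le_div_iff₀' hz', one_sub_jumpChar hs]
    exact Finset.single_le_sum (f := fun z => (p 0 z).toReal * (1 - Real.cos (pair θ z)))
      (fun w _ => mul_nonneg ENNReal.toReal_nonneg (by linarith [Real.cos_le_one (pair θ w)]))
      (by by_contra h; exact hz.ne' (hs z h))
  -- Induction along a chain of possible jumps from `0` to `y`; each jump is controlled by its own
  -- term in `1 - jumpChar p θ`.
  induction hp.irreducible 0 y with
  | refl => exact ⟨0, le_rfl, fun θ => by simp [pair]⟩
  | @tail b c _ hbc ih =>
    obtain ⟨C, hC, h⟩ := ih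
    rw [hp.transl] at hbc
    refine ⟨2 * C + 2 * ((p 0 (c - b)).toReal)⁻¹, by positivity, fun θ => ?_⟩
    have h1 := one_sub_cos_add_le (pair θ b) (pair θ (c - b))
    rw [← pair_add, add_sub_cancel] at h1
    have h2 := h θ
    have h3 := hstep _ hbc θ
    linarith

/-- The fundamental cube of frequencies. -/
def freqCube (d : ℕ) : Set (Fin d → ℝ) := Set.univ.pi fun _ => Set.Ioc (-Real.pi) Real.pi

theorem measurableSet_freqCube : MeasurableSet (freqCube d) :=
  MeasurableSet.univ_pi fun _ => measurableSet_Ioc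

/-- Irreducibility reaches each unit vector, so every `1 - cos θ_i` is controlled, and on the cube
it is at least `2 θ_i² / π²`. The `+ 1` in `S` only ensures positivity. -/
theorem IsJumpKernel.exists_quadratic_lower_bound (hp : IsJumpKernel p) :
    ∃ c : ℝ, 0 < c ∧ ∀ θ ∈ freqCube d, c * ∑ i, θ i ^ 2 ≤ 1 - jumpChar p θ := by
  choose C hC0 hC using fun i : Fin d => hp.exists_one_sub_cos_le (Pi.single i 1)
  have hpair : ∀ (θ : Fin d → ℝ) i, pair θ (Pi.single i 1) = θ i := by
    intro θ i
    rw [pair, Finset.sum_eq_single i]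
    · simp
    · intro j _ hj; simp [hj]
    · simp
  have hnn : ∀ θ, 0 ≤ 1 - jumpChar p θ := fun θ => by
    have := (abs_le.1 (abs_jumpChar_le_one hp θ)).2; linarith
  set S : ℝ := ∑ i, C i + 1 with hS
  have hS0 : 0 < S := by have := Finset.sum_nonneg fun i (_ : i ∈ Finset.univ) => hC0 i; linarith
  have hπ := Real.pi_pos
  refine ⟨2 / Real.pi ^ 2 / S, by positivity, fun θ hθ => ?_⟩
  rw [div_mul_eq_mul_div, div_le_iff₀ hS0, Finset.mul_sum]
  calc ∑ i, 2 / Real.pi ^ 2 * θ i ^ 2 ≤ ∑ i, C i * (1 - jumpChar p θ) := by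
        refine Finset.sum_le_sum fun i _ => ?_
        have h1 := hC i θ
        rw [hpair] at h1
        have h2 := Real.cos_le_one_sub_mul_cos_sq (x := θ i)
          (abs_le.2 ⟨(hθ i trivial).1.le, (hθ i trivial).2⟩)
        linarith
    _ ≤ (1 - jumpChar p θ) * S := by
        rw [← Finset.sum_mul, hS]; nlinarith [hnn θ]

end CharFun

/-! ### Fourier inversion for the walk -/

section Inversion

variable {d : ℕ} {p : Site d → PMF (Site d)}

instance : IsFiniteMeasure ((volume : Measure (Fin d → ℝ)).restrict (freqCube d)) := by
  constructor
  rw [Measure.restrict_apply_univ, freqCube, Real.volume_pi_Ioc]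
  exact ENNReal.prod_lt_top fun _ _ => ENNReal.ofReal_lt_top

theorem integral_cexp_int (n : ℤ) :
    ∫ x in Set.Ioc (-Real.pi) Real.pi, Complex.exp ((x * n : ℝ) * Complex.I)
      = if n = 0 then (2 * Real.pi : ℂ) else 0 := by
  rw [← intervalIntegral.integral_of_le (by linarith [Real.pi_pos])]
  split_ifs with h
  · subst h; simp; ring
  · have hc : (n * Complex.I : ℂ) ≠ 0 := by simp [h]
    have h1 : ∀ x : ℝ, Complex.exp ((x * n : ℝ) * Complex.I)
        = Complex.exp ((n * Complex.I : ℂ) * x) := by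
      intro x; congr 1; push_cast; ring
    simp_rw [h1]
    rw [integral_exp_mul_complex hc, div_eq_zero_iff]
    left
    have h2 : ((n : ℂ) * Complex.I * ((Real.pi : ℝ) : ℂ))
        = (n * Complex.I * ((-Real.pi : ℝ) : ℂ)) + n * (2 * Real.pi * Complex.I) := by
      push_cast; ring
    rw [h2, Complex.exp_add, Complex.exp_int_mul_two_pi_mul_I, mul_one, sub_self]

theorem integral_cos_pair (z : Site d) :
    ∫ θ in freqCube d, Real.cos (pair θ z) = if z = 0 then (2 * Real.pi) ^ d else 0 := by
  have h1 : ∀ θ : Fin d → ℝ, (Real.cos (pair θ z) : ℝ)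
      = (∏ i, Complex.exp ((θ i * z i : ℝ) * Complex.I)).re := by
    intro θ
    rw [← Complex.exp_sum, ← Finset.sum_mul, ← Complex.ofReal_sum, Complex.exp_ofReal_mul_I_re]
    rfl
  have hint : Integrable (fun θ : Fin d → ℝ => ∏ i, Complex.exp ((θ i * z i : ℝ) * Complex.I))
      (volume.restrict (freqCube d)) := by
    refine Integrable.of_bound (C := 1) (by
      refine Continuous.aestronglyMeasurable ?_
      fun_prop) (ae_of_all _ fun θ => ?_)
    rw [norm_prod]
    refine (Finset.prod_eq_one fun i _ => ?_).le
    exact Complex.norm_exp_ofReal_mul_I _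
  simp_rw [h1]
  refine (integral_re hint).trans ?_
  have h2 : ∫ θ in freqCube d, ∏ i, Complex.exp ((θ i * z i : ℝ) * Complex.I)
      = ∏ i, ∫ x in Set.Ioc (-Real.pi) Real.pi, Complex.exp ((x * z i : ℝ) * Complex.I) := by
    rw [freqCube, volume_pi, Measure.restrict_pi_pi]
    exact integral_fintype_prod_eq_prod (fun i (x : ℝ) => Complex.exp ((x * z i : ℝ) * Complex.I))
  rw [h2]
  simp_rw [integral_cexp_int]
  split_ifs with h
  · subst h
    simp only [Pi.zero_apply, if_true, Finset.prod_const, Finset.card_univ, Fintype.card_fin]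
    norm_cast
  · obtain ⟨i, hi⟩ := Function.ne_iff.1 h
    rw [Finset.prod_eq_zero (Finset.mem_univ i) (by simpa using hi)]
    simp

theorem integrable_jumpChar_pow (hp : IsJumpKernel p) (n : ℕ) (z : Site d) :
    Integrable (fun θ => jumpChar p θ ^ n * Real.cos (pair θ z))
      (volume.restrict (freqCube d)) := by
  refine Integrable.of_bound (C := 1) ((((continuous_jumpChar hp).pow n).mul
    (Real.continuous_cos.comp (continuous_pair z))).aestronglyMeasurable)
    (ae_of_all _ fun θ => ?_)
  rw [norm_mul, norm_pow, Real.norm_eq_abs, Real.norm_eq_abs]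
  exact mul_le_one₀ (pow_le_one₀ (abs_nonneg _) (abs_jumpChar_le_one hp θ)) (abs_nonneg _)
    (Real.abs_cos_le_one _)

theorem stepLaw_eq_integral (hp : IsJumpKernel p) (n : ℕ) (z : Site d) :
    (2 * Real.pi) ^ d * (stepLaw p n 0 z).toReal
      = ∫ θ in freqCube d, jumpChar p θ ^ n * Real.cos (pair θ z) := by
  induction n generalizing z with
  | zero =>
    simp only [pow_zero, one_mul]
    rw [integral_cos_pair, stepLaw, PMF.pure_apply]
    split_ifs <;> simp
  | succ n ih =>
    obtain ⟨s, hs, hs'⟩ := hp.exists_support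
    have h1 : (stepLaw p (n + 1) 0 z).toReal
        = ∑ y ∈ s, (p 0 y).toReal * (stepLaw p n 0 (z - y)).toReal := by
      rw [stepLaw, PMF.bind_apply, ← (Equiv.subLeft z).tsum_eq, tsum_eq_sum (s := s),
        ENNReal.toReal_sum]
      · refine Finset.sum_congr rfl fun y _ => ?_
        rw [ENNReal.toReal_mul, mul_comm, hp.transl]
        simp
      · exact fun y _ => ENNReal.mul_ne_top (PMF.apply_ne_top _ _) (PMF.apply_ne_top _ _)
      · intro y hy
        rw [hp.transl]
        simp [hs y hy]
    rw [h1, Finset.mul_sum]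
    have h2 : ∀ y, (2 * Real.pi) ^ d * ((p 0 y).toReal * (stepLaw p n 0 (z - y)).toReal)
        = ∫ θ in freqCube d, (p 0 y).toReal
            * (jumpChar p θ ^ n * Real.cos (pair θ (z - y))) := by
      intro y; rw [integral_const_mul, ← ih]; ring
    simp_rw [h2]
    rw [← integral_finsetSum _ fun y _ => (integrable_jumpChar_pow hp n _).const_mul _]
    refine integral_congr_ae (ae_of_all _ fun θ => ?_)
    simp only
    rw [pow_succ, mul_assoc, ← sum_jump_mul_cos_sub hp hs hs' θ z, Finset.mul_sum]
    exact Finset.sum_congr rfl fun y _ => by ring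

/-- Averaging the powers of the characteristic function over the Poisson number of jumps gives an
exponential. It is small even where `jumpChar` is near `-1`, so periodicity of the jump chain is
harmless. -/
theorem walkLaw_eq_integral (hp : IsJumpKernel p) (t : ℝ≥0) (z : Site d) :
    (2 * Real.pi) ^ d * (walkLaw p t 0 z).toReal
      = ∫ θ in freqCube d, Real.exp (-(t * (1 - jumpChar p θ))) * Real.cos (pair θ z) := by
  set w : ℕ → ℝ := fun n => Real.exp (-t) * (t : ℝ) ^ n / n.factorial with hw
  have hw0 : ∀ n, 0 ≤ w n := fun n => by positivity
  have hws : Summable w := (hasSum_one_poissonMeasure t).summable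
  have h1 : (walkLaw p t 0 z).toReal = ∑' n, w n * (stepLaw p n 0 z).toReal := by
    rw [walkLaw, PMF.bind_apply, ENNReal.tsum_toReal_eq]
    · refine tsum_congr fun n => ?_
      rw [ENNReal.toReal_mul, Measure.toPMF_apply, poissonMeasure_singleton,
        ENNReal.toReal_ofReal (hw0 n)]
    · exact fun n => ENNReal.mul_ne_top (PMF.apply_ne_top _ _) (PMF.apply_ne_top _ _)
  have hbound : ∀ n θ, ‖w n * (jumpChar p θ ^ n * Real.cos (pair θ z))‖ ≤ w n := by
    intro n θ
    rw [norm_mul, norm_mul, norm_pow, Real.norm_of_nonneg (hw0 n), Real.norm_eq_abs,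
      Real.norm_eq_abs]
    exact mul_le_of_le_one_right (hw0 n) (mul_le_one₀ (pow_le_one₀ (abs_nonneg _)
      (abs_jumpChar_le_one hp θ)) (abs_nonneg _) (Real.abs_cos_le_one _))
  have h2 := hasSum_integral_of_summable_integral_norm
    (μ := (volume : Measure (Fin d → ℝ)).restrict (freqCube d))
    (F := fun n θ => w n * (jumpChar p θ ^ n * Real.cos (pair θ z)))
    (fun n => (integrable_jumpChar_pow hp n z).const_mul _)
    (Summable.of_nonneg_of_le (fun n => integral_nonneg fun _ => norm_nonneg _)
      (fun n => (integral_mono ((integrable_jumpChar_pow hp n z).const_mul _).norm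
        (integrable_const (w n)) (hbound n)))
      (by simpa using hws.mul_left _))
  have h3 : ∀ θ, ∑' n, w n * (jumpChar p θ ^ n * Real.cos (pair θ z))
      = Real.exp (-(t * (1 - jumpChar p θ))) * Real.cos (pair θ z) := by
    intro θ
    have h4 : HasSum (fun n : ℕ => Real.exp (-t) * ((t * jumpChar p θ) ^ n / n.factorial))
        (Real.exp (-t) * Real.exp (t * jumpChar p θ)) := by
      have := NormedSpace.expSeries_div_hasSum_exp (t * jumpChar p θ : ℝ)
      rw [← Real.exp_eq_exp_ℝ] at this
      exact this.mul_left _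
    rw [← Real.exp_add] at h4
    have h5 := (h4.mul_right (Real.cos (pair θ z))).tsum_eq
    rw [show -(t : ℝ) + t * jumpChar p θ = -(t * (1 - jumpChar p θ)) by ring] at h5
    rw [← h5]
    refine tsum_congr fun n => ?_
    rw [mul_pow, hw]; ring
  simp_rw [h3] at h2
  rw [← h2.tsum_eq, h1, ← tsum_mul_left]
  refine tsum_congr fun n => ?_
  rw [integral_const_mul, ← stepLaw_eq_integral hp]; ring

end Inversion

/-! ### Gaussian integrals -/

section Gaussian

variable {d : ℕ}

theorem integrable_exp_neg_mul_sum_sq {b : ℝ} (hb : 0 < b) :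
    Integrable fun w : Fin d → ℝ => Real.exp (-b * ∑ i, w i ^ 2) := by
  have h := (GaussianFourier.integrable_cexp_neg_mul_sum_add (ι := Fin d) (b := (b : ℂ))
    (by simpa using hb) 0).norm
  refine h.congr (ae_of_all _ fun w => ?_)
  simp only [Pi.zero_apply, zero_mul, Finset.sum_const_zero, add_zero]
  rw [Complex.norm_exp]
  norm_cast

theorem integral_exp_neg_mul_sum_sq_mul_cos {b : ℝ} (hb : 0 < b) (a : Fin d → ℝ) :
    ∫ w : Fin d → ℝ, Real.exp (-b * ∑ i, w i ^ 2) * Real.cos (∑ i, a i * w i)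
      = Real.sqrt ((Real.pi / b) ^ d) * Real.exp (-(∑ i, a i ^ 2) / (4 * b)) := by
  have hb' : 0 < (b : ℂ).re := by simpa using hb
  have h := GaussianFourier.integral_cexp_neg_mul_sum_add (ι := Fin d) hb'
    (fun i => (a i : ℂ) * Complex.I)
  have hi := GaussianFourier.integrable_cexp_neg_mul_sum_add (ι := Fin d) hb'
    (fun i => (a i : ℂ) * Complex.I)
  have hre : ∀ w : Fin d → ℝ, Real.exp (-b * ∑ i, w i ^ 2) * Real.cos (∑ i, a i * w i)
      = (Complex.exp (-(b : ℂ) * ∑ i, (w i : ℂ) ^ 2 + ∑ i, (a i : ℂ) * Complex.I * w i)).re := by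
    intro w
    have : -(b : ℂ) * ∑ i, (w i : ℂ) ^ 2 + ∑ i, (a i : ℂ) * Complex.I * w i
        = ((-b * ∑ i, w i ^ 2 : ℝ) : ℂ) + ((∑ i, a i * w i : ℝ) : ℂ) * Complex.I := by
      push_cast
      rw [Finset.sum_mul]
      congr 1
      exact Finset.sum_congr rfl fun i _ => by ring
    rw [this, Complex.exp_add, ← Complex.ofReal_exp, Complex.re_ofReal_mul,
      Complex.exp_ofReal_mul_I_re]
  simp_rw [hre]
  refine (integral_re hi).trans ?_
  rw [h]
  have h1 : ((Real.pi : ℂ) / b) ^ ((Fintype.card (Fin d) : ℂ) / 2)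
      = ((Real.sqrt ((Real.pi / b) ^ d) : ℝ) : ℂ) := by
    have hpos : 0 ≤ Real.pi / b := by positivity
    rw [Real.sqrt_eq_rpow, ← Real.rpow_natCast, ← Real.rpow_mul hpos,
      Complex.ofReal_cpow hpos]
    push_cast
    rw [Fintype.card_fin, mul_one_div]
  have h2 : (∑ i, ((a i : ℂ) * Complex.I) ^ 2) / (4 * b)
      = ((-(∑ i, a i ^ 2) / (4 * b) : ℝ) : ℂ) := by
    push_cast
    rw [← Finset.sum_neg_distrib]
    congr 1
    exact Finset.sum_congr rfl fun i _ => by rw [mul_pow, Complex.I_sq]; ring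
  rw [h1, h2, ← Complex.ofReal_exp, ← Complex.ofReal_mul]
  rfl

theorem integral_comp_mulVec {M : Matrix (Fin d) (Fin d) ℝ} (hM : M.det ≠ 0)
    {f : (Fin d → ℝ) → ℝ} (hf : Continuous f) :
    ∫ u : Fin d → ℝ, f (M.mulVec u) = |M.det|⁻¹ * ∫ w, f w := by
  have h := Real.map_matrix_volume_pi_eq_smul_volume_pi hM
  have h2 := integral_map (μ := volume) (φ := Matrix.toLin' M)
    (LinearMap.continuous_of_finiteDimensional _).aemeasurable
    (f := f) hf.aestronglyMeasurable
  rw [h, integral_smul_measure, ENNReal.toReal_ofReal (abs_nonneg _)] at h2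
  simp only [Matrix.toLin'_apply] at h2
  rw [← h2, abs_inv, smul_eq_mul]

variable {B : Matrix (Fin d) (Fin d) ℝ} {τ : ℝ}

theorem dotProduct_transpose_mul_self_mulVec (u : Fin d → ℝ) :
    u ⬝ᵥ (B.transpose * B).mulVec u = ∑ i, (B.mulVec u) i ^ 2 := by
  rw [← Matrix.mulVec_mulVec, Matrix.dotProduct_mulVec, Matrix.vecMul_transpose, dotProduct]
  exact Finset.sum_congr rfl fun i _ => (sq _).symm

theorem dotProduct_inv_mulVec (v : Fin d → ℝ) :
    v ⬝ᵥ (B.transpose * B)⁻¹.mulVec v = ∑ i, (B⁻¹.transpose.mulVec v) i ^ 2 := by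
  rw [Matrix.mul_inv_rev, ← Matrix.transpose_nonsing_inv]
  have := dotProduct_transpose_mul_self_mulVec (B := B⁻¹.transpose) v
  rwa [Matrix.transpose_transpose] at this

theorem gaussKernel_eq (v : Space d) :
    gaussKernel (B.transpose * B) τ v = |B.det|⁻¹ * ((Real.sqrt ((2 * Real.pi * τ) ^ d))⁻¹ *
      Real.exp (-(∑ i, (B⁻¹.transpose.mulVec v.ofLp) i ^ 2) / (2 * τ))) := by
  rw [gaussKernel, dotProduct_inv_mulVec, Matrix.det_mul, Matrix.det_transpose, ← sq,
    Real.sqrt_mul' _ (sq_nonneg _), Real.sqrt_sq_eq_abs, mul_inv]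
  ring

theorem gaussKernel_nonneg (Γ : Matrix (Fin d) (Fin d) ℝ) (τ : ℝ) (v : Space d) :
    0 ≤ gaussKernel Γ τ v := by
  unfold gaussKernel; positivity

theorem continuous_gaussKernel (Γ : Matrix (Fin d) (Fin d) ℝ) (τ : ℝ) :
    Continuous (gaussKernel Γ τ) := by
  unfold gaussKernel dotProduct Matrix.mulVec dotProduct
  fun_prop

theorem gaussKernel_neg (Γ : Matrix (Fin d) (Fin d) ℝ) (τ : ℝ) (v : Space d) :
    gaussKernel Γ τ (-v) = gaussKernel Γ τ v := by
  simp [gaussKernel, Matrix.mulVec_neg]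

/-- The Gaussian kernel as the inverse Fourier transform of its characteristic function. -/
theorem integral_exp_quadratic_mul_cos (hB : B.det ≠ 0) (hτ : 0 < τ) (v : Space d) :
    ∫ u : Fin d → ℝ, Real.exp (-(τ / 2) * (u ⬝ᵥ (B.transpose * B).mulVec u)) *
        Real.cos (∑ i, u i * v i)
      = (2 * Real.pi) ^ d * gaussKernel (B.transpose * B) τ v := by
  set a : Fin d → ℝ := B⁻¹.transpose.mulVec v.ofLp with ha
  have hlin : ∀ u : Fin d → ℝ, ∑ i, u i * v i = ∑ i, a i * (B.mulVec u) i := by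
    intro u
    change u ⬝ᵥ v.ofLp = a ⬝ᵥ B.mulVec u
    rw [ha, Matrix.mulVec_transpose, Matrix.dotProduct_mulVec, Matrix.vecMul_vecMul,
      Matrix.nonsing_inv_mul _ (isUnit_iff_ne_zero.2 hB), Matrix.vecMul_one, dotProduct_comm]
  simp_rw [dotProduct_transpose_mul_self_mulVec, hlin]
  rw [integral_comp_mulVec hB (f := fun w => Real.exp (-(τ / 2) * ∑ i, w i ^ 2) *
      Real.cos (∑ i, a i * w i)) (by fun_prop),
    integral_exp_neg_mul_sum_sq_mul_cos (by positivity), gaussKernel_eq, ← ha]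
  have h1 : Real.sqrt ((Real.pi / (τ / 2)) ^ d)
      = (2 * Real.pi) ^ d * (Real.sqrt ((2 * Real.pi * τ) ^ d))⁻¹ := by
    have hπ := Real.pi_pos
    rw [← Real.sqrt_inv, ← Real.sqrt_sq (show 0 ≤ (2 * Real.pi) ^ d by positivity),
      ← Real.sqrt_mul (by positivity), ← pow_mul, mul_comm d 2, pow_mul, ← inv_pow, ← mul_pow]
    congr 2
    field_simp
  rw [h1, show (4 * (τ / 2)) = 2 * τ by ring]
  ring

theorem integrable_gaussKernel_and_integral (hB : B.det ≠ 0) (hτ : 0 < τ) :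
    Integrable (gaussKernel (B.transpose * B) τ) ∧
      ∫ v, gaussKernel (B.transpose * B) τ v = 1 := by
  have hM : B⁻¹.transpose.det ≠ 0 := by
    rw [Matrix.det_transpose, Matrix.det_nonsing_inv, Ring.inverse_eq_inv']
    exact inv_ne_zero hB
  have hint : ∫ v, gaussKernel (B.transpose * B) τ v = 1 := by
    have h0 := (PiLp.volume_preserving_toLp (Fin d)).integral_comp
      (MeasurableEquiv.toLp 2 (Fin d → ℝ)).measurableEmbedding (gaussKernel (B.transpose * B) τ)
    rw [← h0]
    simp_rw [gaussKernel_eq]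
    rw [integral_const_mul, integral_const_mul,
      integral_comp_mulVec hM (f := fun w => Real.exp (-(∑ i, w i ^ 2) / (2 * τ))) (by fun_prop)]
    have h1 := integral_exp_neg_mul_sum_sq_mul_cos (d := d) (b := 1 / (2 * τ)) (by positivity) 0
    simp only [Pi.zero_apply, zero_mul, Finset.sum_const_zero, Real.cos_zero, mul_one, ne_eq,
      OfNat.ofNat_ne_zero, not_false_eq_true, zero_pow, neg_zero, zero_div, Real.exp_zero] at h1
    have h2 : ∀ w : Fin d → ℝ, -(∑ i, w i ^ 2) / (2 * τ) = -(1 / (2 * τ)) * ∑ i, w i ^ 2 := by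
      intro w; ring
    simp_rw [h2]
    rw [h1, Matrix.det_transpose, Matrix.det_nonsing_inv, Ring.inverse_eq_inv', abs_inv, inv_inv,
      show Real.pi / (1 / (2 * τ)) = 2 * Real.pi * τ by field_simp]
    have h3 : Real.sqrt ((2 * Real.pi * τ) ^ d) ≠ 0 := by positivity
    have h4 : |B.det| ≠ 0 := abs_ne_zero.2 hB
    field_simp
  -- The integral of a non-integrable function is `0` by convention, so the value `1` already proves
  -- integrability.
  exact ⟨not_imp_comm.1 integral_undef (by rw [hint]; exact one_ne_zero), hint⟩

end Gaussian

/-! ### The covariance of a jump -/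

section Covariance

variable {d : ℕ} {p : Site d → PMF (Site d)}

theorem dotProduct_jumpCov_mulVec {s : Finset (Site d)} (hs : ∀ z ∉ s, p 0 z = 0)
    (u : Fin d → ℝ) :
    u ⬝ᵥ (jumpCov p).mulVec u = ∑ z ∈ s, (p 0 z).toReal * pair u z ^ 2 := by
  have h1 : ∀ i j, jumpCov p i j = ∑ z ∈ s, (p 0 z).toReal * ((z i : ℝ) * (z j : ℝ)) :=
    fun i j => tsum_eq_sum fun z hz => by simp [hs z hz]
  simp only [dotProduct, Matrix.mulVec, h1, pair, sq, Finset.mul_sum,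
    Finset.sum_mul]
  rw [Finset.sum_comm' (t' := Finset.univ) (s' := fun _ => Finset.univ) (by simp)]
  rw [Finset.sum_comm]
  refine (Finset.sum_congr rfl fun i _ => Finset.sum_comm).trans ?_
  rw [Finset.sum_comm]
  refine Finset.sum_congr rfl fun z _ => Finset.sum_congr rfl fun i _ =>
    Finset.sum_congr rfl fun j _ => by ring

theorem tendsto_sq_mul_one_sub_cos (a : ℝ) :
    Tendsto (fun N : ℕ => (N : ℝ) ^ 2 * (1 - Real.cos ((N : ℝ)⁻¹ * a))) atTop
      (𝓝 (a ^ 2 / 2)) := by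
  have hN : Tendsto (fun N : ℕ => (N : ℝ)⁻¹) atTop (𝓝 0) := tendsto_inv_atTop_nhds_zero_nat
  rw [tendsto_iff_norm_sub_tendsto_zero]
  -- `5 / 96` is the constant of `Real.cos_bound`.
  have hlim : Tendsto (fun N : ℕ => |a| ^ 4 * (5 / 96) * ((N : ℝ)⁻¹) ^ 2) atTop (𝓝 0) := by
    simpa using (hN.pow 2).const_mul (|a| ^ 4 * (5 / 96))
  refine squeeze_zero' (Eventually.of_forall fun N => norm_nonneg _) ?_ hlim
  have hsmall : ∀ᶠ N : ℕ in atTop, |(N : ℝ)⁻¹ * a| ≤ 1 := by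
    have : Tendsto (fun N : ℕ => |(N : ℝ)⁻¹ * a|) atTop (𝓝 0) := by
      simpa using (hN.mul_const a).abs
    exact (this.eventually_lt_const one_pos).mono fun _ => le_of_lt
  filter_upwards [hsmall, eventually_ge_atTop 1] with N h1 h2
  have hN0 : (0 : ℝ) < N := by exact_mod_cast h2
  have h3 := Real.cos_bound h1
  have h4 : (N : ℝ) ^ 2 * (1 - Real.cos ((N : ℝ)⁻¹ * a)) - a ^ 2 / 2
      = -((N : ℝ) ^ 2 * (Real.cos ((N : ℝ)⁻¹ * a) - (1 - ((N : ℝ)⁻¹ * a) ^ 2 / 2))) := by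
    field_simp; ring
  rw [h4, norm_neg, norm_mul, Real.norm_eq_abs, Real.norm_eq_abs, abs_of_nonneg (by positivity)]
  calc _ ≤ (N : ℝ) ^ 2 * (|(N : ℝ)⁻¹ * a| ^ 4 * (5 / 96)) := by gcongr
    _ = _ := by rw [abs_mul, abs_of_nonneg (by positivity)]; field_simp

theorem tendsto_sq_mul_one_sub_jumpChar (hp : IsJumpKernel p) (u : Fin d → ℝ) :
    Tendsto (fun N : ℕ => (N : ℝ) ^ 2 * (1 - jumpChar p ((N : ℝ)⁻¹ • u))) atTop
      (𝓝 ((u ⬝ᵥ (jumpCov p).mulVec u) / 2)) := by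
  obtain ⟨s, hs, -⟩ := hp.exists_support
  simp_rw [one_sub_jumpChar hs, dotProduct_jumpCov_mulVec hs, Finset.mul_sum, Finset.sum_div,
    pair_smul]
  refine tendsto_finsetSum _ fun z _ => ?_
  have := (tendsto_sq_mul_one_sub_cos (pair u z)).const_mul (p 0 z).toReal
  rw [← mul_div_assoc] at this
  exact this.congr fun N => by ring

theorem eventually_inv_smul_mem_freqCube (u : Fin d → ℝ) :
    ∀ᶠ N : ℕ in atTop, (N : ℝ)⁻¹ • u ∈ freqCube d := by
  have hN : Tendsto (fun N : ℕ => (N : ℝ)⁻¹) atTop (𝓝 0) := tendsto_inv_atTop_nhds_zero_nat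
  have h : Tendsto (fun N : ℕ => (N : ℝ)⁻¹ • u) atTop (𝓝 0) := by simpa using hN.smul_const u
  refine h.eventually (set_pi_mem_nhds Set.finite_univ fun i _ => ?_)
  exact Ioc_mem_nhds (by simpa using Real.pi_pos) (by simpa using Real.pi_pos)

/-- Rescaling the quadratic lower bound and letting `N → ∞` shows that the covariance is positive
definite. Its factor `B` reduces Gaussian integrals to the isotropic case. -/
theorem exists_jumpCov_eq (hp : IsJumpKernel p) :
    ∃ B : Matrix (Fin d) (Fin d) ℝ, B.det ≠ 0 ∧ jumpCov p = B.transpose * B := by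
  obtain ⟨c, hc, hlow⟩ := hp.exists_quadratic_lower_bound
  have hle : ∀ u : Fin d → ℝ, c * ∑ i, u i ^ 2 ≤ (u ⬝ᵥ (jumpCov p).mulVec u) / 2 := by
    intro u
    refine ge_of_tendsto (tendsto_sq_mul_one_sub_jumpChar hp u) ?_
    filter_upwards [eventually_inv_smul_mem_freqCube u, eventually_ge_atTop 1] with N h1 h2
    have hN0 : (0 : ℝ) < N := by exact_mod_cast h2
    have h3 := mul_le_mul_of_nonneg_left (hlow _ h1) (sq_nonneg (N : ℝ))
    simp only [Pi.smul_apply, smul_eq_mul, mul_pow, ← Finset.mul_sum] at h3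
    refine le_trans (le_of_eq ?_) h3
    field_simp
  have hpos : (jumpCov p).PosDef := by
    refine Matrix.PosDef.of_dotProduct_mulVec_pos ?_ fun u hu => ?_
    · ext i j
      simp [jumpCov, Matrix.conjTranspose_apply, mul_comm]
    · have h1 := hle u
      have h2 : 0 < ∑ i, u i ^ 2 := by
        obtain ⟨i, hi⟩ := Function.ne_iff.1 hu
        exact Finset.sum_pos' (fun _ _ => sq_nonneg _) ⟨i, Finset.mem_univ _, by
          have : u i ≠ 0 := hi
          positivity⟩
      have h3 : 0 < c * ∑ i, u i ^ 2 := mul_pos hc h2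
      rw [star_trivial]
      linarith
  open scoped MatrixOrder ComplexOrder in
  obtain ⟨B, hB⟩ := CStarAlgebra.nonneg_iff_eq_star_mul_self.mp hpos.posSemidef.nonneg
  have hB' : jumpCov p = B.transpose * B := by
    rw [hB, Matrix.star_eq_conjTranspose, Matrix.conjTranspose_eq_transpose_of_trivial]
  refine ⟨B, fun h => ?_, hB'⟩
  have := hpos.det_pos
  rw [hB', Matrix.det_mul, h, mul_zero] at this
  exact this.false

end Covariance

/-! ### The local central limit theorem -/

section LocalLimit

variable {d : ℕ} {p : Site d → PMF (Site d)} {τ : ℝ≥0}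

/-- The diffusively rescaled transition probability `N ^ d * p_{N² τ}(0, z)`. -/
noncomputable def scaledHeat (p : Site d → PMF (Site d)) (N : ℕ) (τ : ℝ≥0) (z : Site d) : ℝ :=
  (N : ℝ) ^ d * (walkLaw p ((N : ℝ≥0) ^ 2 * τ) 0 z).toReal

theorem scaledHeat_nonneg (N : ℕ) (z : Site d) : 0 ≤ scaledHeat p N τ z := by
  unfold scaledHeat; positivity

/-- The rescaled characteristic function of the walk, cut off outside the fundamental cube. -/
noncomputable def scaledChar (p : Site d → PMF (Site d)) (N : ℕ) (τ : ℝ≥0) (u : Fin d → ℝ) : ℝ :=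
  (freqCube d).indicator (fun θ => Real.exp (-(τ * ((N : ℝ) ^ 2 * (1 - jumpChar p θ)))))
    ((N : ℝ)⁻¹ • u)

theorem scaledHeat_eq_integral (hp : IsJumpKernel p) {N : ℕ} (hN : 1 ≤ N) (z : Site d) :
    (2 * Real.pi) ^ d * scaledHeat p N τ z
      = ∫ u, scaledChar p N τ u * Real.cos (∑ i, u i * scaledSite N z i) := by
  have hN0 : (N : ℝ) ≠ 0 := by positivity
  rw [scaledHeat, mul_left_comm, walkLaw_eq_integral hp,
    ← integral_indicator measurableSet_freqCube]
  have h := Measure.integral_comp_inv_smul_of_nonneg (volume : Measure (Fin d → ℝ))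
    ((freqCube d).indicator fun θ =>
      Real.exp (-(((N : ℝ≥0) ^ 2 * τ : ℝ≥0) * (1 - jumpChar p θ))) * Real.cos (pair θ z))
    (Nat.cast_nonneg N)
  rw [Module.finrank_fin_fun, smul_eq_mul] at h
  rw [← h]
  refine integral_congr_ae (ae_of_all _ fun u => ?_)
  simp only [scaledChar]
  have hc : pair ((N : ℝ)⁻¹ • u) z = ∑ i, u i * scaledSite N z i := by
    rw [pair_smul, pair, Finset.mul_sum]
    refine Finset.sum_congr rfl fun i _ => ?_
    simp only [scaledSite]
    ring
  by_cases hu : (N : ℝ)⁻¹ • u ∈ freqCube d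
  · rw [Set.indicator_of_mem hu, Set.indicator_of_mem hu, hc]
    push_cast
    congr 2
    ring
  · rw [Set.indicator_of_notMem hu, Set.indicator_of_notMem hu, zero_mul]

theorem measurable_scaledChar (hp : IsJumpKernel p) (N : ℕ) :
    Measurable (scaledChar p N τ) := by
  have h1 := (continuous_jumpChar hp).measurable
  have h2 : Measurable fun θ => Real.exp (-(τ * ((N : ℝ) ^ 2 * (1 - jumpChar p θ)))) := by
    fun_prop
  exact (h2.indicator measurableSet_freqCube).comp (measurable_const_smul _)

/-- The quadratic lower bound is invariant under diffusive scaling, so it yields a Gaussian majorant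
valid for all `N ≥ 1`; the cut-off handles frequencies outside the cube. -/
theorem exists_scaledChar_bound (hp : IsJumpKernel p) (hτ : 0 < τ) :
    ∃ b : ℝ, 0 < b ∧ ∀ N : ℕ, 1 ≤ N → ∀ u, |scaledChar p N τ u| ≤ Real.exp (-b * ∑ i, u i ^ 2) := by
  obtain ⟨c, hc, hlow⟩ := hp.exists_quadratic_lower_bound
  refine ⟨τ * c, mul_pos (by exact_mod_cast hτ) hc, fun N hN u => ?_⟩
  have hN0 : (0 : ℝ) < N := by exact_mod_cast hN
  unfold scaledChar
  by_cases hu : (N : ℝ)⁻¹ • u ∈ freqCube d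
  · rw [Set.indicator_of_mem hu, abs_of_pos (Real.exp_pos _), Real.exp_le_exp, neg_mul,
      neg_le_neg_iff, mul_assoc]
    refine mul_le_mul_of_nonneg_left ?_ τ.coe_nonneg
    have h3 := mul_le_mul_of_nonneg_left (hlow _ hu) (sq_nonneg (N : ℝ))
    simp only [Pi.smul_apply, smul_eq_mul, mul_pow, ← Finset.mul_sum] at h3
    refine le_trans (le_of_eq ?_) h3
    field_simp
  · rw [Set.indicator_of_notMem hu, abs_zero]
    exact (Real.exp_pos _).le

theorem exists_scaledHeat_bound (hp : IsJumpKernel p) (hτ : 0 < τ) :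
    ∃ K : ℝ, ∀ N : ℕ, 1 ≤ N → ∀ z, scaledHeat p N τ z ≤ K := by
  obtain ⟨b, hb, hbound⟩ := exists_scaledChar_bound hp hτ
  refine ⟨((2 * Real.pi) ^ d)⁻¹ * ∫ u : Fin d → ℝ, Real.exp (-b * ∑ i, u i ^ 2),
    fun N hN z => ?_⟩
  rw [← div_eq_inv_mul, le_div_iff₀' (by positivity), scaledHeat_eq_integral hp hN]
  refine (Real.le_norm_self _).trans (norm_integral_le_of_norm_le (integrable_exp_neg_mul_sum_sq hb)
    (ae_of_all _ fun u => ?_))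
  rw [norm_mul]
  exact (mul_le_of_le_one_right (norm_nonneg _) (Real.abs_cos_le_one _)).trans (hbound N hN u)

/-- Dominated convergence in the Fourier integral. Allowing any lattice sequence with `z N / N → v`
absorbs both the rounding to cells and the fixed offsets `x_i`. -/
theorem tendsto_scaledHeat (hp : IsJumpKernel p) (hτ : 0 < τ) {z : ℕ → Site d} {v : Space d}
    (hz : Tendsto (fun N => scaledSite N (z N)) atTop (𝓝 v)) :
    Tendsto (fun N => scaledHeat p N τ (z N)) atTop (𝓝 (gaussKernel (jumpCov p) τ v)) := by
  obtain ⟨b, hb, hbound⟩ := exists_scaledChar_bound hp hτ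
  obtain ⟨B, hB, hBcov⟩ := exists_jumpCov_eq hp
  have hτ' : (0 : ℝ) < τ := by exact_mod_cast hτ
  have hlim : Tendsto (fun N => ∫ u, scaledChar p N τ u *
      Real.cos (∑ i, u i * scaledSite N (z N) i)) atTop
      (𝓝 ((2 * Real.pi) ^ d * gaussKernel (jumpCov p) τ v)) := by
    rw [hBcov, ← integral_exp_quadratic_mul_cos hB hτ', ← hBcov]
    refine tendsto_integral_filter_of_dominated_convergence
      (fun u : Fin d → ℝ => Real.exp (-b * ∑ i, u i ^ 2)) (Eventually.of_forall fun N => ?_) ?_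
      (integrable_exp_neg_mul_sum_sq hb) (ae_of_all _ fun u => ?_)
    · refine ((measurable_scaledChar hp N).mul ?_).aestronglyMeasurable
      fun_prop
    · filter_upwards [eventually_ge_atTop 1] with N hN
      refine ae_of_all _ fun u => ?_
      rw [norm_mul]
      exact (mul_le_of_le_one_right (norm_nonneg _) (Real.abs_cos_le_one _)).trans (hbound N hN u)
    · refine Tendsto.mul ?_ ?_
      · have h1 : Tendsto (fun N : ℕ =>
            Real.exp (-(τ * ((N : ℝ) ^ 2 * (1 - jumpChar p ((N : ℝ)⁻¹ • u)))))) atTop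
            (𝓝 (Real.exp (-(τ * ((u ⬝ᵥ (jumpCov p).mulVec u) / 2))))) :=
          (Real.continuous_exp.tendsto _).comp
            ((tendsto_sq_mul_one_sub_jumpChar hp u).const_mul _).neg
        rw [show -((τ : ℝ) / 2) * (u ⬝ᵥ (jumpCov p).mulVec u)
          = -(τ * ((u ⬝ᵥ (jumpCov p).mulVec u) / 2)) by ring]
        refine h1.congr' ?_
        filter_upwards [eventually_inv_smul_mem_freqCube u] with N hN
        rw [scaledChar, Set.indicator_of_mem hN]
      · refine (Real.continuous_cos.tendsto _).comp (tendsto_finsetSum _ fun i _ => ?_)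
        exact (((PiLp.continuous_apply 2 _ i).tendsto v).comp hz).const_mul _
  have h2 := hlim.const_mul ((2 * Real.pi) ^ d)⁻¹
  rw [inv_mul_cancel_left₀ (by positivity)] at h2
  refine h2.congr' ?_
  filter_upwards [eventually_ge_atTop 1] with N hN
  rw [← scaledHeat_eq_integral hp hN, inv_mul_cancel_left₀ (by positivity)]

end LocalLimit

/-! ### Convergence of the evolved profile -/

section Evolve

variable {d : ℕ} {p : Site d → PMF (Site d)} {τ : ℝ≥0} {ρ : Space d → ℝ≥0} {C : ℝ≥0}

theorem scaledSite_add (N : ℕ) (y z : Site d) :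
    scaledSite N (y + z) = scaledSite N y + scaledSite N z := by
  ext i; simp [scaledSite, add_div]

theorem scaledSite_sub (N : ℕ) (y z : Site d) :
    scaledSite N (y - z) = scaledSite N y - scaledSite N z := by
  ext i; simp [scaledSite, sub_div]

theorem tendsto_scaledSite_const (y : Site d) :
    Tendsto (fun N => scaledSite N y) atTop (𝓝 0) := by
  have h : ∀ N, scaledSite N y = (N : ℝ)⁻¹ • scaledSite 1 y := by
    intro N; ext i; simp [scaledSite, div_eq_inv_mul]
  refine Tendsto.congr (fun N => (h N).symm) ?_
  simpa using (tendsto_inv_atTop_nhds_zero_nat (𝕜 := ℝ)).smul_const (scaledSite 1 y)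

theorem tendsto_scaledSite_cell_add (u : Space d) (y : Site d) :
    Tendsto (fun N => scaledSite N (cell N u + y)) atTop (𝓝 u) := by
  simp_rw [scaledSite_add]
  simpa using (tendsto_scaledSite_cell u).add (tendsto_scaledSite_const y)

theorem inv_natCast_pow_ne_top {N : ℕ} (hN : 1 ≤ N) : ((N : ℝ≥0∞) ^ d)⁻¹ ≠ ∞ := by
  refine ENNReal.inv_ne_top.2 (pow_ne_zero _ ?_)
  exact_mod_cast (show N ≠ 0 by omega)

theorem inv_natCast_pow_ne_zero (N : ℕ) : ((N : ℝ≥0∞) ^ d)⁻¹ ≠ 0 :=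
  ENNReal.inv_ne_zero.2 (ENNReal.pow_ne_top (ENNReal.natCast_ne_top N))

theorem summable_walkLaw_toReal (t : ℝ≥0) (x : Site d) :
    Summable fun z => (walkLaw p t x z).toReal :=
  ENNReal.summable_toReal (by rw [PMF.tsum_coe]; exact ENNReal.one_ne_top)

/-- Averages under the rescaled walk as integrals over the continuum. -/
theorem integral_scaledHeat_mul {N : ℕ} (hN : 1 ≤ N) {f : Site d → ℝ} {c : ℝ}
    (hf : ∀ z, |f z| ≤ c) :
    Integrable (fun w => scaledHeat p N τ (cell N w) * f (cell N w)) ∧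
      ∫ w, scaledHeat p N τ (cell N w) * f (cell N w)
        = ∑' z, (walkLaw p ((N : ℝ≥0) ^ 2 * τ) 0 z).toReal * f z := by
  have hN0 : (N : ℝ) ≠ 0 := by positivity
  have hs : Summable fun z => scaledHeat p N τ z * f z := by
    refine Summable.of_norm_bounded
      ((summable_walkLaw_toReal (p := p) ((N : ℝ≥0) ^ 2 * τ) 0).mul_left ((N : ℝ) ^ d) |>.mul_right c)
      fun z => ?_
    rw [norm_mul, Real.norm_of_nonneg (scaledHeat_nonneg _ _)]
    exact mul_le_mul_of_nonneg_left (hf z) (scaledHeat_nonneg _ _)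
  refine ⟨(integrable_comp_iff_summable (measurable_cell N) (inv_natCast_pow_ne_zero N)
    (inv_natCast_pow_ne_top hN) (map_cell hN) _).2 hs, ?_⟩
  rw [integral_comp_eq_tsum (measurable_cell N) (map_cell hN) hs, ← tsum_mul_left]
  refine tsum_congr fun z => ?_
  simp only [scaledHeat, ENNReal.toReal_inv, ENNReal.toReal_pow, ENNReal.toReal_natCast]
  field_simp

theorem evolve_eq_integral (hp : IsJumpKernel p) (hC : ∀ u, ρ u ≤ C) {N : ℕ} (hN : 1 ≤ N)
    (y : Site d) :
    (evolve p ((N : ℝ≥0) ^ 2 * τ) (latticeProfile ρ N) y : ℝ)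
      = ∫ w, scaledHeat p N τ (cell N w) * (ρ (scaledSite N (cell N w + y)) : ℝ) := by
  rw [(integral_scaledHeat_mul hN (f := fun z => (ρ (scaledSite N (z + y)) : ℝ)) (c := C)
    fun z => by rw [NNReal.abs_eq]; exact_mod_cast hC _).2, evolve, NNReal.coe_tsum,
    ← (Equiv.addRight y).tsum_eq]
  refine tsum_congr fun z => ?_
  rw [walkLaw_eq_sub hp _ y]
  simp [latticeProfile, ENNReal.coe_toNNReal_eq_toReal]

/-- Scheffé's argument: the rescaled walk converges to the Gaussian in total variation. -/
theorem tendsto_integral_abs_scaledHeat_sub (hp : IsJumpKernel p) (hτ : 0 < τ) :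
    Tendsto (fun N : ℕ => ∫ w, |scaledHeat p N τ (cell N w) - gaussKernel (jumpCov p) τ w|)
      atTop (𝓝 0) := by
  obtain ⟨B, hB, hBcov⟩ := exists_jumpCov_eq hp
  have hτ' : (0 : ℝ) < τ := by exact_mod_cast hτ
  obtain ⟨hgi, hg1⟩ := integrable_gaussKernel_and_integral hB hτ'
  rw [← hBcov] at hgi hg1
  set g := gaussKernel (jumpCov p) τ with hg
  have hq : ∀ N : ℕ, 1 ≤ N → Integrable (fun w => scaledHeat p N τ (cell N w)) ∧
      ∫ w, scaledHeat p N τ (cell N w) = 1 := by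
    intro N hN
    have h := integral_scaledHeat_mul (p := p) (τ := τ) hN (f := fun _ => 1) (c := 1) (by simp)
    simp only [mul_one] at h
    refine ⟨h.1, h.2.trans ?_⟩
    rw [← ENNReal.tsum_toReal_eq fun z => PMF.apply_ne_top _ _, PMF.tsum_coe, ENNReal.toReal_one]
  have hmeas : ∀ N, Measurable fun w : Space d => scaledHeat p N τ (cell N w) := fun N =>
    (measurable_of_countable (scaledHeat p N τ)).comp (measurable_cell N)
  -- Since `|q - g| = q + g - 2 min q g` and both densities have mass `1`, only the integral of the
  -- minimum is needed, and `g` dominates it.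
  have hmin : Tendsto (fun N : ℕ => ∫ w, min (scaledHeat p N τ (cell N w)) (g w)) atTop
      (𝓝 (∫ w, min (g w) (g w))) := by
    refine tendsto_integral_of_dominated_convergence g
      (fun N => ((hmeas N).min (continuous_gaussKernel _ _).measurable).aestronglyMeasurable) hgi
      (fun N => ae_of_all _ fun w => ?_) (ae_of_all _ fun w => ?_)
    · rw [Real.norm_of_nonneg (le_min (scaledHeat_nonneg _ _) (gaussKernel_nonneg _ _ _))]
      exact min_le_right _ _
    · exact (tendsto_scaledHeat hp hτ (tendsto_scaledSite_cell w)).min tendsto_const_nhds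
  simp only [min_self, hg1] at hmin
  have h2 : Tendsto (fun N : ℕ => 2 - 2 * ∫ w, min (scaledHeat p N τ (cell N w)) (g w)) atTop
      (𝓝 0) := by
    have := (hmin.const_mul 2).const_sub 2
    rwa [mul_one, sub_self] at this
  refine h2.congr' ?_
  filter_upwards [eventually_ge_atTop 1] with N hN
  have h3 : ∀ w, |scaledHeat p N τ (cell N w) - g w|
      = scaledHeat p N τ (cell N w) + g w - 2 * min (scaledHeat p N τ (cell N w)) (g w) := by
    intro w
    rcases le_total (scaledHeat p N τ (cell N w)) (g w) with h | h
    · rw [min_eq_left h, abs_of_nonpos (by linarith)]; ring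
    · rw [min_eq_right h, abs_of_nonneg (by linarith)]; ring
  simp_rw [h3]
  have h4 : Integrable fun w => scaledHeat p N τ (cell N w) + g w := (hq N hN).1.add hgi
  have h5 : Integrable fun w => 2 * min (scaledHeat p N τ (cell N w)) (g w) :=
    ((hq N hN).1.inf hgi).const_mul 2
  rw [integral_sub h4 h5, integral_add (hq N hN).1 hgi, (hq N hN).2, hg1, integral_const_mul]
  norm_num

theorem coe_macroDensity (s : ℝ) (y : Space d) :
    (macroDensity p ρ s y : ℝ) = ∫ w, gaussKernel (jumpCov p) s w * (ρ (w + y) : ℝ) := by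
  rw [macroDensity, Real.coe_toNNReal _ (integral_nonneg fun u =>
    mul_nonneg (gaussKernel_nonneg _ _ _) (NNReal.coe_nonneg _)),
    ← integral_add_right_eq_self _ y]
  refine integral_congr_ae (ae_of_all _ fun w => ?_)
  simp only
  rw [sub_add_cancel_right, gaussKernel_neg]

/-- The evolved lattice profile converges to the macroscopic density. -/
theorem tendsto_evolve (hp : IsJumpKernel p) (hτ : 0 < τ) (hρ : Continuous ρ)
    (hC : ∀ u, ρ u ≤ C) (v : Space d) (y : Site d) :
    Tendsto (fun N : ℕ =>
        (evolve p ((N : ℝ≥0) ^ 2 * τ) (latticeProfile ρ N) (cell N v + y) : ℝ)) atTop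
      (𝓝 (macroDensity p ρ τ v : ℝ)) := by
  obtain ⟨B, hB, hBcov⟩ := exists_jumpCov_eq hp
  have hτ' : (0 : ℝ) < τ := by exact_mod_cast hτ
  obtain ⟨hgi, -⟩ := integrable_gaussKernel_and_integral hB hτ'
  rw [← hBcov] at hgi
  set g := gaussKernel (jumpCov p) τ with hg
  set R : ℕ → Space d → ℝ := fun N w => (ρ (scaledSite N (cell N w + (cell N v + y))) : ℝ) with hR
  have hRm : ∀ N, Measurable (R N) := fun N =>
    (measurable_of_countable
      (fun z : Site d => (ρ (scaledSite N (z + (cell N v + y))) : ℝ))).comp (measurable_cell N)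
  have hR0 : ∀ N w, |R N w| ≤ C := fun N w => by
    rw [hR, NNReal.abs_eq]; exact_mod_cast hC _
  have hgR : ∀ N w, ‖g w * R N w‖ ≤ g w * C := by
    intro N w
    rw [norm_mul, Real.norm_of_nonneg (gaussKernel_nonneg _ _ _)]
    exact mul_le_mul_of_nonneg_left (hR0 N w) (gaussKernel_nonneg _ _ _)
  have hgRi : ∀ N, Integrable fun w => g w * R N w := fun N =>
    (hgi.mul_const (C : ℝ)).mono' (hgi.aestronglyMeasurable.mul (hRm N).aestronglyMeasurable)
      (ae_of_all _ (hgR N))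
  have h1 : Tendsto (fun N => ∫ w, g w * R N w) atTop (𝓝 (macroDensity p ρ τ v : ℝ)) := by
    rw [coe_macroDensity]
    refine tendsto_integral_of_dominated_convergence (fun w => g w * C)
      (fun N => (hgRi N).aestronglyMeasurable) (hgi.mul_const _)
      (fun N => ae_of_all _ (hgR N)) (ae_of_all _ fun w => ?_)
    refine Tendsto.const_mul _ (((NNReal.continuous_coe.comp hρ).tendsto _).comp ?_)
    simp_rw [scaledSite_add _ (cell _ w)]
    exact (tendsto_scaledSite_cell w).add (tendsto_scaledSite_cell_add v y)
  -- Replacing the rescaled walk by the Gaussian costs at most `C` times their L¹ distance.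
  have h2 : Tendsto (fun N : ℕ =>
      (evolve p ((N : ℝ≥0) ^ 2 * τ) (latticeProfile ρ N) (cell N v + y) : ℝ)
        - ∫ w, g w * R N w) atTop (𝓝 0) := by
    have h3 := (tendsto_integral_abs_scaledHeat_sub hp hτ).mul_const (C : ℝ)
    rw [zero_mul] at h3
    refine squeeze_zero_norm' ?_ h3
    filter_upwards [eventually_ge_atTop 1] with N hN
    have hqi := (integral_scaledHeat_mul (p := p) (τ := τ) hN
      (f := fun z => (ρ (scaledSite N (z + (cell N v + y))) : ℝ)) (c := C)
      fun z => by rw [NNReal.abs_eq]; exact_mod_cast hC _).1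
    have hq1 := (integral_scaledHeat_mul (p := p) (τ := τ) hN
      (f := fun _ => 1) (c := 1) (by simp)).1
    simp only [mul_one] at hq1
    rw [evolve_eq_integral hp hC hN, ← integral_sub hqi (hgRi N), ← integral_mul_const]
    refine norm_integral_le_of_norm_le ((hq1.sub hgi).abs.mul_const _) (ae_of_all _ fun w => ?_)
    rw [← sub_mul, norm_mul]
    exact mul_le_mul_of_nonneg_left (hR0 N w) (abs_nonneg _)
  simpa using h2.add h1

end Evolve

/-! ### The scaling limit of the covariance -/

section ScalingLimit

variable {d k : ℕ} {p : Site d → PMF (Site d)} {ρ : Space d → ℝ≥0} {C : ℝ≥0} {s τ : ℝ≥0}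

/-- The rescaled two-time covariance of the summands of the field at two sites. -/
noncomputable def covDensity (p : Site d → PMF (Site d)) (ρ : Space d → ℝ≥0) (φ : 𝓢(Space d, ℝ))
    (x : Fin k → Site d) (s τ : ℝ≥0) (N : ℕ) (q : Site d × Site d) : ℝ :=
  φ (scaledSite N q.1) * φ (scaledSite N q.2) *
    ((∏ i, (evolve p ((N : ℝ≥0) ^ 2 * s) (latticeProfile ρ N) (q.2 + x i) : ℝ)) *
      ∑ σ : Equiv.Perm (Fin k), ∏ i, scaledHeat p N τ (q.2 + x (σ i) - (q.1 + x i)))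

theorem measurable_covDensity_cell (φ : 𝓢(Space d, ℝ)) (x : Fin k → Site d) (N : ℕ) :
    Measurable fun q : Space d × Space d =>
      covDensity p ρ φ x s τ N (Prod.map (cell N) (cell N) q) :=
  (measurable_of_countable (covDensity p ρ φ x s τ N)).comp
    ((measurable_cell N).prodMap (measurable_cell N))

/-- Schwartz decay supplies integrability in both variables; the densities contribute at most `C^k`,
and each of the `k!` permutations at most `L^k`. -/
theorem exists_covDensity_cell_bound (hp : IsJumpKernel p) (hτ : 0 < τ) (hC : ∀ u, ρ u ≤ C)
    (φ : 𝓢(Space d, ℝ)) (x : Fin k → Site d) :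
    ∃ F : Space d × Space d → ℝ, Integrable F ∧ ∀ N : ℕ, 1 ≤ N → ∀ q,
      ‖covDensity p ρ φ x s τ N (Prod.map (cell N) (cell N) q)‖ ≤ F q := by
  obtain ⟨K, hK0, hK⟩ := exists_schwartz_cell_bound φ
  obtain ⟨L, hL⟩ := exists_scaledHeat_bound hp hτ
  refine ⟨fun q => (K * (1 + ‖q.1‖) ^ (-((d : ℝ) + 1))) * (K * (1 + ‖q.2‖) ^ (-((d : ℝ) + 1))) *
    ((C : ℝ) ^ k * (k.factorial * L ^ k)), ?_, fun N hN q => ?_⟩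
  · exact ((integrable_japanese.const_mul K).mul_prod (integrable_japanese.const_mul K)).mul_const _
  · have hprod : ∀ σ : Equiv.Perm (Fin k), 0 ≤ ∏ i, scaledHeat p N τ
        (cell N q.2 + x (σ i) - (cell N q.1 + x i)) := fun σ =>
      Finset.prod_nonneg fun i _ => scaledHeat_nonneg _ _
    simp only [covDensity, Prod.map_fst, Prod.map_snd]
    rw [norm_mul, norm_mul, norm_mul, Real.norm_eq_abs, Real.norm_eq_abs,
      Real.norm_of_nonneg (Finset.prod_nonneg fun i _ => NNReal.coe_nonneg _),
      Real.norm_of_nonneg (Finset.sum_nonneg fun σ _ => hprod σ)]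
    refine mul_le_mul (mul_le_mul (hK N hN _) (hK N hN _) (abs_nonneg _) (by positivity))
      (mul_le_mul ?_ ?_ (Finset.sum_nonneg fun σ _ => hprod σ) (by positivity))
      (mul_nonneg (Finset.prod_nonneg fun i _ => NNReal.coe_nonneg _)
        (Finset.sum_nonneg fun σ _ => hprod σ)) (by positivity)
    · calc _ ≤ ∏ _i : Fin k, (C : ℝ) := Finset.prod_le_prod (fun _ _ => NNReal.coe_nonneg _)
            fun i _ => NNReal.coe_le_coe.2 (evolve_le _ (latticeProfile_le hC N) _)
        _ = (C : ℝ) ^ k := by simp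
    · calc _ ≤ ∑ _σ : Equiv.Perm (Fin k), ∏ _i : Fin k, L := Finset.sum_le_sum fun σ _ =>
            Finset.prod_le_prod (fun _ _ => scaledHeat_nonneg _ _) fun i _ => hL N hN _
        _ = k.factorial * L ^ k := by simp [Fintype.card_perm]

theorem tendsto_covDensity_cell (hp : IsJumpKernel p) (hs : 0 < s) (hτ : 0 < τ)
    (hρ : Continuous ρ) (hC : ∀ u, ρ u ≤ C) (φ : 𝓢(Space d, ℝ)) (x : Fin k → Site d)
    (q : Space d × Space d) :
    Tendsto (fun N => covDensity p ρ φ x s τ N (Prod.map (cell N) (cell N) q)) atTop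
      (𝓝 (fieldConst x (macroDensity p ρ s q.2) * gaussKernel (jumpCov p) τ (q.1 - q.2) ^ k *
        (φ q.1 * φ q.2))) := by
  have h1 : Tendsto (fun N : ℕ => ∏ i, (evolve p ((N : ℝ≥0) ^ 2 * s) (latticeProfile ρ N)
      (cell N q.2 + x i) : ℝ)) atTop (𝓝 (∏ _i : Fin k, (macroDensity p ρ s q.2 : ℝ))) :=
    tendsto_finsetProd _ fun i _ => tendsto_evolve hp hs hρ hC _ _
  have h2 : Tendsto (fun N : ℕ => ∑ σ : Equiv.Perm (Fin k), ∏ i, scaledHeat p N τ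
      (cell N q.2 + x (σ i) - (cell N q.1 + x i))) atTop
      (𝓝 (∑ _σ : Equiv.Perm (Fin k), ∏ _i : Fin k, gaussKernel (jumpCov p) τ (q.1 - q.2))) := by
    refine tendsto_finsetSum _ fun σ _ => tendsto_finsetProd _ fun i _ => ?_
    rw [← gaussKernel_neg, neg_sub]
    refine tendsto_scaledHeat hp hτ ?_
    simp_rw [scaledSite_sub]
    exact (tendsto_scaledSite_cell_add _ _).sub (tendsto_scaledSite_cell_add _ _)
  have h3 : ∀ u, Tendsto (fun N : ℕ => φ (scaledSite N (cell N u))) atTop (𝓝 (φ u)) := fun u =>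
    (φ.continuous.tendsto u).comp (tendsto_scaledSite_cell u)
  have h4 := ((h3 q.1).mul (h3 q.2)).mul (h1.mul h2)
  have h5 : fieldConst x (macroDensity p ρ s q.2) * gaussKernel (jumpCov p) τ (q.1 - q.2) ^ k *
      (φ q.1 * φ q.2) = φ q.1 * φ q.2 * ((∏ _i : Fin k, (macroDensity p ρ s q.2 : ℝ)) *
        ∑ _σ : Equiv.Perm (Fin k), ∏ _i : Fin k, gaussKernel (jumpCov p) τ (q.1 - q.2)) := by
    simp only [fieldConst_eq, Finset.prod_const, Finset.card_univ, Fintype.card_fin,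
      Finset.sum_const, Fintype.card_perm, nsmul_eq_mul]
    ring
  rw [h5]
  exact h4

/-- Both measurability and the majorant pass to the pointwise limit, so no separate regularity of
the macroscopic density is required. -/
theorem integrable_limitDensity (hp : IsJumpKernel p) (hs : 0 < s) (hτ : 0 < τ)
    (hρ : Continuous ρ) (hC : ∀ u, ρ u ≤ C) (φ : 𝓢(Space d, ℝ)) (x : Fin k → Site d) :
    Integrable fun q : Space d × Space d => fieldConst x (macroDensity p ρ s q.2) *
      gaussKernel (jumpCov p) τ (q.1 - q.2) ^ k * (φ q.1 * φ q.2) := by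
  obtain ⟨F, hF, hle⟩ := exists_covDensity_cell_bound (s := s) hp hτ hC φ x
  have hlim := tendsto_covDensity_cell hp hs hτ hρ hC φ x
  refine hF.mono' (aestronglyMeasurable_of_tendsto_ae atTop
    (fun N => (measurable_covDensity_cell φ x N).aestronglyMeasurable) (ae_of_all _ hlim))
    (ae_of_all _ fun q => ?_)
  exact le_of_tendsto (hlim q).norm ((eventually_ge_atTop 1).mono fun N hN => hle N hN q)

theorem tendsto_integral_covDensity (hp : IsJumpKernel p) (hs : 0 < s) (hτ : 0 < τ)
    (hρ : Continuous ρ) (hC : ∀ u, ρ u ≤ C) (φ : 𝓢(Space d, ℝ)) (x : Fin k → Site d) :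
    Tendsto (fun N : ℕ => ∫ q : Space d × Space d,
        covDensity p ρ φ x s τ N (Prod.map (cell N) (cell N) q)) atTop
      (𝓝 (∫ q : Space d × Space d, fieldConst x (macroDensity p ρ s q.2) *
        gaussKernel (jumpCov p) τ (q.1 - q.2) ^ k * (φ q.1 * φ q.2))) := by
  obtain ⟨F, hF, hle⟩ := exists_covDensity_cell_bound (s := s) hp hτ hC φ x
  exact tendsto_integral_filter_of_dominated_convergence F
    (Eventually.of_forall fun N => (measurable_covDensity_cell φ x N).aestronglyMeasurable)
    ((eventually_ge_atTop 1).mono fun N hN => ae_of_all _ (hle N hN)) hF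
    (ae_of_all _ (tendsto_covDensity_cell hp hs hτ hρ hC φ x))

/-- Bookkeeping of powers: `N^{dk}` is distributed over the `k` heat kernels, and `N^{-2d}` is the
volume of a pair of cells. The exponent is an integer because `k - 2` may be negative. -/
theorem pow_mul_integral_field_mul_eq (hp : IsJumpKernel p) (hC : ∀ u, ρ u ≤ C)
    {φ : 𝓢(Space d, ℝ)} {x : Fin k → Site d} {N : ℕ} (hN : 1 ≤ N) {Ω : Type*} [MeasurableSpace Ω]
    {P : Measure Ω} [IsProbabilityMeasure P] {η : ℝ≥0 → Ω → Config d}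
    (h : IsIRW p (poissonField (latticeProfile ρ N)) P η) {t : ℝ≥0} (hst : s ≤ t) :
    (N : ℝ) ^ ((d : ℤ) * ((k : ℤ) - 2)) * ∫ ω, field p ρ φ x N η t ω * field p ρ φ x N η s ω ∂P
      = ∫ q : Space d × Space d,
        covDensity p ρ φ x s (t - s) N (Prod.map (cell N) (cell N) q) := by
  have hN0 : (N : ℝ) ≠ 0 := by positivity
  have key := (hasSum_integral_field_mul (φ := φ) (x := x) hp hC hN h hst).mul_left
    ((N : ℝ) ^ (d * k))
  have hcov : ∀ q : Site d × Site d, (N : ℝ) ^ (d * k) *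
      (φ (scaledSite N q.1) * φ (scaledSite N q.2) *
        ((∏ i, (evolve p ((N : ℝ≥0) ^ 2 * s) (latticeProfile ρ N) (q.2 + x i) : ℝ)) *
          ∑ σ : Equiv.Perm (Fin k), ∏ i,
            (walkLaw p ((N : ℝ≥0) ^ 2 * (t - s)) (q.1 + x i) (q.2 + x (σ i))).toReal))
      = covDensity p ρ φ x s (t - s) N q := by
    intro q
    simp only [covDensity, scaledHeat, Finset.prod_mul_distrib, Finset.prod_const,
      Finset.card_univ, Fintype.card_fin, ← Finset.mul_sum, ← walkLaw_eq_sub hp, ← pow_mul]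
    ring
  simp_rw [hcov] at key
  rw [integral_comp_eq_tsum ((measurable_cell N).prodMap (measurable_cell N)) (map_cell_prod hN)
    key.summable, key.tsum_eq]
  simp only [ENNReal.toReal_mul, ENNReal.toReal_inv, ENNReal.toReal_pow, ENNReal.toReal_natCast]
  rw [← mul_assoc]
  congr 1
  rw [mul_sub, zpow_sub₀ hN0, ← Nat.cast_mul, zpow_natCast, mul_comm (d : ℤ) 2, zpow_mul]
  norm_cast
  field_simp
  push_cast
  ring

end ScalingLimit

end IRW
-- The theorem: well-posedness, exact covariance and scaling limit
theorem theorem4p3 {d k : ℕ} (hd : 0 < d)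
    (p : IRW.Site d → PMF (IRW.Site d)) (hp : IRW.IsJumpKernel p)
    (ρ : IRW.Space d → ℝ≥0) (hρ : Continuous ρ) (hρb : ∃ C : ℝ≥0, ∀ u, ρ u ≤ C)
    (φ : 𝓢(IRW.Space d, ℝ)) (x : Fin k → IRW.Site d)
    {Ω : ℕ → Type*} [∀ N, MeasurableSpace (Ω N)]
    (P : ∀ N, Measure (Ω N)) [∀ N, IsProbabilityMeasure (P N)]
    (η : ∀ N, ℝ≥0 → Ω N → IRW.Config d)
    (hη : ∀ N, 1 ≤ N →
      IRW.IsIRW p (IRW.poissonField (IRW.latticeProfile ρ N)) (P N) (η N)) :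
    -- the fields are well defined and square integrable
    (∀ N, 1 ≤ N → ∀ t : ℝ≥0,
      (∀ᵐ ω ∂(P N), Summable
        (IRW.fieldTerm p ρ φ x N t (η N ((N : ℝ≥0) ^ 2 * t) ω))) ∧
      MemLp (IRW.field p ρ φ x N (η N) t) 2 (P N)) ∧
    -- exact two-time covariance
    (∀ N, 1 ≤ N → ∀ t : ℝ≥0, 0 < t →
      HasSum (fun q : IRW.Site d × IRW.Site d =>
          φ (IRW.scaledSite N q.1) * φ (IRW.scaledSite N q.2) *
            IRW.normSq (IRW.latticeProfile ρ N) (IRW.shiftedConfig x q.2) *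
            IRW.transProb p ((N : ℝ≥0) ^ 2 * t)
              (IRW.shiftedConfig x q.1) (IRW.shiftedConfig x q.2))
        (∫ ω, IRW.field p ρ φ x N (η N) t ω * IRW.field p ρ φ x N (η N) 0 ω ∂(P N))) ∧
    -- scaling limit
    (∀ s t : ℝ≥0, 0 < s → s < t →
      Integrable (fun q : IRW.Space d × IRW.Space d =>
        IRW.fieldConst x (IRW.macroDensity p ρ s q.2) *
          IRW.gaussKernel (IRW.jumpCov p) ((t : ℝ) - s) (q.1 - q.2) ^ k * (φ q.1 * φ q.2)) ∧
      Tendsto (fun N : ℕ => (N : ℝ) ^ ((d : ℤ) * ((k : ℤ) - 2)) *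
          ∫ ω, IRW.field p ρ φ x N (η N) t ω * IRW.field p ρ φ x N (η N) s ω ∂(P N))
        atTop
        (𝓝 (∫ q : IRW.Space d × IRW.Space d,
          IRW.fieldConst x (IRW.macroDensity p ρ s q.2) *
            IRW.gaussKernel (IRW.jumpCov p) ((t : ℝ) - s) (q.1 - q.2) ^ k *
              (φ q.1 * φ q.2)))) := by
  obtain ⟨C, hC⟩ := hρb
  refine ⟨fun N hN t => IRW.field_summable_memLp hp hC hN (hη N hN) t, fun N hN t _ => ?_,
    fun s t hs hst => ?_⟩
  · have h := IRW.hasSum_integral_field_mul (φ := φ) (x := x) hp hC hN (hη N hN)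
      (zero_le (a := t))
    refine Eq.mp (congrArg (fun f => HasSum f _) (funext fun q => ?_)) h
    rw [IRW.shiftedConfig, IRW.shiftedConfig, mul_assoc _ (IRW.normSq _ _),
      IRW.normSq_mul_transProb, mul_zero, IRW.evolve_zero, tsub_zero]
  · have hτ : 0 < t - s := tsub_pos_of_lt hst
    rw [← NNReal.coe_sub hst.le]
    refine ⟨IRW.integrable_limitDensity hp hs hτ hρ hC φ x,
      (IRW.tendsto_integral_covDensity hp hs hτ hρ hC φ x).congr' ?_⟩
    filter_upwards [eventually_ge_atTop 1] with N hN
    exact (IRW.pow_mul_integral_field_mul_eq hp hC hN (hη N hN) hst.le).symm
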